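/- **Setup.** For functions $n,d,t,r:\mathbb N\to\mathbb N$ and $\eta,\zeta$ of the security parameter $k$ with $t\le n$ and $0\le\eta<1/2$, let $\mathsf{LDPC\text{-}PRC}_0[n,d,t,r,\eta,\zeta]$ be the following zero-bit public-key code over $\mathbb F_2$ (message space $\{1\}$). *Key generation:* sample $H\in\mathbb F_2^{r\times n}$ with i.i.d. uniformly random rows of Hamming weight exactly $t$, then $G\in\mathbb F_2^{n\times d}$ uniformly subject to $HG=0$, and $z\in\mathbb F_2^n$ uniformly; the public key is $(G,z)$ and the secret key is $(H,z)$. *Encoding* with coins $u\in\mathbb F_2^d$ and $e^*\in\mathbb F_2^n$ of weight $\lfloor\eta n\rfloor$ (both uniform for the honest encoder): output $Gu\oplus z\oplus e^*$. *Decoding* of $x$: output $1$ if $\mathrm{wt}(H(x\oplus z))<(\tfrac12-\zeta)r$, and $\bot$ otherwise. The code is *adaptively $\delta$-robust* (in the public-key game) if for every randomized adversary, even a computationally unbounded one, that is given the public key and outputs coins $(u,e^*)$ and a word $x\in\mathbb F_2^n$, the probability that $x$ is within Hamming distance $\delta n$ of the codeword $c=Gu\oplus z\oplus e^*$ and yet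 $x$ decodes to $\bot$ is negligible in $k$. **Theorem.** Let $\delta<1/2$, let $n=n(k)\ge k^{\Omega(1)}$, and let $r=r(k)\ge n^{\Omega(1)}$. Then there exist $\eta=\Omega(1)$, $t=\Theta(\log n)$ and $d=\Omega(\log^2 n)$ such that $\mathsf{LDPC\text{-}PRC}_0[n,d,t,r,\eta,r^{-1/4}]$ is adaptively $\delta$-robust. These parameters are efficiently computable from $n$: $\eta$ can be taken to be a rational constant, and $t=2\lfloor \lfloor\log_2 n\rfloor/p\rfloor$, $d=\lfloor\lfloor\log_2 n\rfloor^2/q\rfloor$ for positive integer constants $p,q$. -/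

import Mathlib

open Filter Topology Asymptotics

noncomputable section

/-- Vectors of length `n` over the field with two elements. -/
abbrev BitVec2 (n : ℕ) : Type := Fin n → ZMod 2

/-- The syntax of a public-key code, at every security parameter `k`: codeword length, message
space, keys, encoding coins, key generation, encoding with explicit coins (`Encode(pk, m; r)`), and
decoding, where `none` stands for `⊥`. -/
structure PublicKeyCode where
  len : ℕ → ℕ
  Msg : ℕ → Type
  SecretKey : ℕ → Type
  PublicKey : ℕ → Type
  Coins : ℕ → Type
  keyGen : ∀ k, PMF (SecretKey k × PublicKey k)
  coins : ∀ k, PMF (Coins k)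
  encode : ∀ k, PublicKey k → Msg k → Coins k → BitVec2 (len k)
  decode : ∀ k, SecretKey k → BitVec2 (len k) → Option (Msg k)

namespace PublicKeyCode

variable (C : PublicKeyCode)

/-- The randomized encoder `Encode(pk, m)`. -/
def encodeDist (k : ℕ) (pk : C.PublicKey k) (m : C.Msg k) : PMF (BitVec2 (C.len k)) :=
  (C.coins k).map (C.encode k pk m)

/-- A (randomized, computationally unbounded) adversary in the public-key robustness game: from the
public key it produces a message, encoding coins, and a received word. -/
def Adversary : Type :=
  ∀ k, C.PublicKey k → PMF (C.Msg k × C.Coins k × BitVec2 (C.len k))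

/-- The winning condition: the received word is within distance `δ n` of the codeword fixed by the
message and the coins, but it does not decode to the message. -/
def Wins (δ : ℝ) (k : ℕ) (sk : C.SecretKey k) (pk : C.PublicKey k)
    (a : C.Msg k × C.Coins k × BitVec2 (C.len k)) : Prop :=
  (hammingNorm (a.2.2 + C.encode k pk a.1 a.2.1) : ℝ) ≤ δ * C.len k ∧
    C.decode k sk a.2.2 ≠ some a.1

open Classical in
/-- The public-key robustness game; the output is `true` when the adversary wins. -/
def robustGame (δ : ℝ) (A : C.Adversary) (k : ℕ) : PMF Bool :=
  (C.keyGen k).bind fun key =>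
    (A k key.2).map fun a => decide (C.Wins δ k key.1 key.2 a)

/-- Public-key adaptive `δ`-robustness, against all adversaries (not only the efficient ones): the
winning probability is negligible in the security parameter. -/
def AdaptivelyRobust (δ : ℝ) : Prop :=
  ∀ A : C.Adversary,
    SuperpolynomialDecay atTop (fun k : ℕ => (k : ℝ)) fun k => (C.robustGame δ A k true).toReal

end PublicKeyCode

/-- The parameters of the zero-bit LDPC code, as functions of the security parameter: codeword
length, dimension, row sparsity, number of parity checks, noise rate, and decoding slack. -/
structure LDPCParams where
  n : ℕ → ℕ
  d : ℕ → ℕ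
  t : ℕ → ℕ
  r : ℕ → ℕ
  η : ℕ → ℝ
  ζ : ℕ → ℝ
  t_le : ∀ k, t k ≤ n k
  η_mem : ∀ k, η k ∈ Set.Ico (0 : ℝ) (1 / 2)

theorem exists_hammingNorm_eq {w n : ℕ} (h : w ≤ n) : ∃ v : BitVec2 n, hammingNorm v = w := by
  obtain ⟨s, -, hs⟩ := Finset.exists_subset_card_eq (s := (Finset.univ : Finset (Fin n)))
    (n := w) (by simpa using h)
  refine ⟨fun i => if i ∈ s then 1 else 0, ?_⟩
  simp [hammingNorm, hs]

/-- The `t`-row-sparse matrices with `r` rows and `n` columns. -/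
def sparseMatrices (r n t : ℕ) : Finset (Matrix (Fin r) (Fin n) (ZMod 2)) :=
  Finset.univ.filter fun H => ∀ i, hammingNorm (H i) = t

theorem sparseMatrices_nonempty {r n t : ℕ} (h : t ≤ n) : (sparseMatrices r n t).Nonempty := by
  obtain ⟨v, hv⟩ := exists_hammingNorm_eq h
  exact ⟨fun _ => v, Finset.mem_filter.mpr ⟨Finset.mem_univ _, fun _ => hv⟩⟩

/-- The matrices all of whose columns lie in the kernel of `H`. -/
def kernelMatrices {r n : ℕ} (H : Matrix (Fin r) (Fin n) (ZMod 2)) (d : ℕ) :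
    Finset (Matrix (Fin n) (Fin d) (ZMod 2)) :=
  Finset.univ.filter fun G => H * G = 0

theorem kernelMatrices_nonempty {r n : ℕ} (H : Matrix (Fin r) (Fin n) (ZMod 2)) (d : ℕ) :
    (kernelMatrices H d).Nonempty :=
  ⟨0, by simp [kernelMatrices]⟩

/-- The random LDPC code: `H` has i.i.d. uniform `t`-sparse rows, and then `G` is uniform subject
to `H * G = 0`. -/
def ldpc (n d t r : ℕ) (h : t ≤ n) :
    PMF (Matrix (Fin r) (Fin n) (ZMod 2) × Matrix (Fin n) (Fin d) (ZMod 2)) :=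
  (PMF.uniformOfFinset (sparseMatrices r n t) (sparseMatrices_nonempty h)).bind fun H =>
    (PMF.uniformOfFinset (kernelMatrices H d) (kernelMatrices_nonempty H d)).map fun G => (H, G)

namespace LDPCParams

variable (P : LDPCParams)

/-- The vectors of weight `⌊η n⌋`, from which the encoding noise is drawn. -/
abbrev Noise (k : ℕ) : Type :=
  {e : BitVec2 (P.n k) // hammingNorm e = ⌊P.η k * P.n k⌋₊}

instance (k : ℕ) : Nonempty (P.Noise k) := by
  have h : ⌊P.η k * P.n k⌋₊ ≤ P.n k := by
    apply Nat.floor_le_of_le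
    have := (P.η_mem k).2
    have : (0 : ℝ) ≤ P.n k := Nat.cast_nonneg _
    nlinarith
  obtain ⟨v, hv⟩ := exists_hammingNorm_eq h
  exact ⟨⟨v, hv⟩⟩

open Classical in
/-- The zero-bit public-key LDPC code. The message space is a one-point type, whose element is the
message `1`. The public key is `(G, z)`, the secret key is `(H, z)`, the encoding is `G u + z + e`
for coins `(u, e)`, and `x` decodes to `1` exactly if `wt (H (x + z)) < (1/2 - ζ) r`. -/
def zeroBitCode : PublicKeyCode where
  len := P.n
  Msg _ := Unit
  SecretKey k := Matrix (Fin (P.r k)) (Fin (P.n k)) (ZMod 2) × BitVec2 (P.n k)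
  PublicKey k := Matrix (Fin (P.n k)) (Fin (P.d k)) (ZMod 2) × BitVec2 (P.n k)
  Coins k := BitVec2 (P.d k) × P.Noise k
  keyGen k :=
    (ldpc (P.n k) (P.d k) (P.t k) (P.r k) (P.t_le k)).bind fun HG =>
      (PMF.uniformOfFintype (BitVec2 (P.n k))).map fun z => ((HG.1, z), (HG.2, z))
  coins k := PMF.uniformOfFintype (BitVec2 (P.d k) × P.Noise k)
  encode _ pk _ c := pk.1.mulVec c.1 + pk.2 + c.2.1
  decode k sk x :=
    if (hammingNorm (sk.1.mulVec (x + sk.2)) : ℝ) < (1 / 2 - P.ζ k) * P.r k then some () else none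

end LDPCParams

end

/-! Subtracting the codeword removes most of the game. A winning adversary yields, from G and
randomness independent of H given G, an error e of weight at most α n, where α = δ + η < 1/2, whose
syndrome has almost r/2 ones or more. Averaging makes e a function f of G
(`exists_deterministic_error`, `robustGame_le`). It remains to bound the probability that the sum of
the signs (-1)^(h_i · f(G)) is at most 2ζr. A fresh row of even weight t has mean sign at least 2b
on e, where b = `biasBound` is exp(-O(t)), but G depends on H, and r may be far too small for a
union bound over errors.

The main step exchanges the two sums. A pair (H, G) has probability proportional to |ker H|^(-d).
For fixed G the error is fixed and the admissible rows form a product set, so exponential moments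
factor over rows. The condition that a row annihilates G is an average of characters over all
combinations Gu, which leads to the mean signs on Gu and on Gu + e. These are Krawtchouk values.
Balanced vectors contribute exp(-Ω(t²)), which survives multiplication by 2^d since d is a small
multiple of t². Constant vectors contribute fully and harmlessly, because t is even. Hence the row
keeps its bias on e (`sum_fiber_exp_le`). The normalization by |ker H|^d costs one unit for each
possible space of coefficients, at most 2^(d²) in total (`sum_matsIn_weight_le`). The outcome is
2^(d²) exp(-b² r/64), see `sum_structured_bad_le`; it is small because r exceeds b^(-2) by a factor
exp(t) and d² is polynomial in t.

This requires each combination of columns to be balanced or essentially constant. First moments over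
the kernel give this when 2r ≤ n (`min_mul_sum_nonConstUnbalanced_le`). With more rows the argument
must also allow light kernel vectors. With high probability no kernel vector has weight between σn
and 2σn, so the light ones are closed under addition and live on a common set J of at most 2σn
coordinates (`exists_common_support`). Outside J every relevant combination is constant or the
vector is balanced. As J depends on rows, H is split in two: one block determines J and the other is
counted, conditionally on the parts of its rows in J (`sum_sum_matProb_le`). Few rows meet J, so the
average gain per row persists (`sum_rowFactor_le`).

With σ = exp(-t/64), n ≥ exp(2t), d ≤ t²/1024 and r at least a suitable exponential in t, everything
adds up to exp(-t²) (`advantage_le`), which is superpolynomially small since t grows at least like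
log k. -/

set_option linter.unusedSectionVars false

/-! ### Elementary symmetric functions of signs -/

/-- The elementary symmetric function of degree `k` in the values `x i`, `i ∈ s`. -/
def elemSymm {ι : Type*} (s : Finset ι) (x : ι → ℝ) (k : ℕ) : ℝ :=
  ∑ T ∈ s.powersetCard k, ∏ i ∈ T, x i

section ElemSymm

variable {ι : Type*} [DecidableEq ι]

theorem elemSymm_zero (s : Finset ι) (x : ι → ℝ) : elemSymm s x 0 = 1 := by
  simp [elemSymm]

theorem elemSymm_one (s : Finset ι) (x : ι → ℝ) : elemSymm s x 1 = ∑ i ∈ s, x i := by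
  simp [elemSymm, Finset.powersetCard_one]

theorem elemSymm_insert {a : ι} {s : Finset ι} (ha : a ∉ s) (x : ι → ℝ) (k : ℕ) :
    elemSymm (insert a s) x (k + 1) = elemSymm s x (k + 1) + x a * elemSymm s x k := by
  unfold elemSymm
  rw [Finset.powersetCard_succ_insert ha, Finset.sum_union, Finset.sum_image, Finset.mul_sum]
  · congr 1
    refine Finset.sum_congr rfl fun T hT => ?_
    rw [Finset.prod_insert]
    exact fun h => ha ((Finset.mem_powersetCard.mp hT).1 h)
  · intro T hT T' hT' h
    have h1 : a ∉ T := fun h => ha ((Finset.mem_powersetCard.mp hT).1 h)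
    have h2 : a ∉ T' := fun h => ha ((Finset.mem_powersetCard.mp hT').1 h)
    rw [← Finset.erase_insert h1, ← Finset.erase_insert h2, h]
  · rw [Finset.disjoint_left]
    intro T hT hT'
    obtain ⟨T', -, rfl⟩ := Finset.mem_image.mp hT'
    exact ha ((Finset.mem_powersetCard.mp hT).1 (Finset.mem_insert_self _ _))

theorem elemSymm_empty_succ (x : ι → ℝ) (k : ℕ) : elemSymm (∅ : Finset ι) x (k + 1) = 0 := by
  rw [elemSymm, Finset.powersetCard_eq_empty.mpr (by simp), Finset.sum_empty]

theorem elemSymm_neg (s : Finset ι) (x : ι → ℝ) (k : ℕ) :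
    elemSymm s (fun i => -x i) k = (-1) ^ k * elemSymm s x k := by
  unfold elemSymm
  rw [Finset.mul_sum]
  refine Finset.sum_congr rfl fun T hT => ?_
  rw [Finset.prod_neg, (Finset.mem_powersetCard.mp hT).2]

/-- The three-term recurrence of the elementary symmetric functions of signs. -/
theorem elemSymm_recurrence (x : ι → ℝ) (hx : ∀ i, x i ^ 2 = 1) (s : Finset ι) (k : ℕ) :
    ((k : ℝ) + 2) * elemSymm s x (k + 2) =
      (∑ i ∈ s, x i) * elemSymm s x (k + 1) - ((s.card : ℝ) - k) * elemSymm s x k := by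
  induction s using Finset.induction_on generalizing k with
  | empty =>
    rw [elemSymm_empty_succ]
    cases k with
    | zero => simp
    | succ k => simp [elemSymm_empty_succ]
  | insert a s ha ih =>
    rw [elemSymm_insert ha, elemSymm_insert ha, Finset.sum_insert ha,
      Finset.card_insert_of_notMem ha]
    have h1 := ih k
    cases k with
    | zero =>
      simp only [elemSymm_zero, zero_add, elemSymm_one] at *
      push_cast at *
      linear_combination h1 - hx a
    | succ k =>
      rw [elemSymm_insert ha]
      have h2 := ih k
      push_cast at *
      linear_combination h1 + x a * h2 - hx a * elemSymm s x (k + 1)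

theorem abs_elemSymm_le (x : ι → ℝ) (hx : ∀ i, x i ^ 2 = 1) (s : Finset ι) (k : ℕ) :
    |elemSymm s x k| ≤ s.card.choose k := by
  unfold elemSymm
  refine (Finset.abs_sum_le_sum_abs _ _).trans ?_
  rw [← Finset.card_powersetCard, Finset.card_eq_sum_ones, Nat.cast_sum]
  refine Finset.sum_le_sum fun T _ => ?_
  rw [Finset.abs_prod, Finset.prod_eq_one]
  · simp
  · intro i _
    rcases sq_eq_one_iff.mp (hx i) with h | h <;> simp [h]

end ElemSymm

/-! ### Bounds on normalized Krawtchouk values -/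

/-- The normalized elementary symmetric function, the mean of the monomials. -/
noncomputable def krawtchouk {ι : Type*} (s : Finset ι) (x : ι → ℝ) (k : ℕ) : ℝ :=
  elemSymm s x k / s.card.choose k

section Krawtchouk

variable {ι : Type*} [DecidableEq ι]

theorem krawtchouk_zero (s : Finset ι) (x : ι → ℝ) : krawtchouk s x 0 = 1 := by
  simp [krawtchouk, elemSymm_zero]

theorem krawtchouk_one (s : Finset ι) (x : ι → ℝ) : s.card * krawtchouk s x 1 = ∑ i ∈ s, x i := by
  rcases s.eq_empty_or_nonempty with rfl | h
  · simp
  · have : (s.card : ℝ) ≠ 0 := by exact_mod_cast h.card_pos.ne'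
    simp only [krawtchouk, elemSymm_one, Nat.choose_one_right]
    field_simp

theorem krawtchouk_neg (s : Finset ι) (x : ι → ℝ) (k : ℕ) :
    krawtchouk s (fun i => -x i) k = (-1) ^ k * krawtchouk s x k := by
  simp only [krawtchouk, elemSymm_neg]
  ring

theorem abs_krawtchouk_le_one (x : ι → ℝ) (hx : ∀ i, x i ^ 2 = 1) (s : Finset ι) (k : ℕ) :
    |krawtchouk s x k| ≤ 1 := by
  unfold krawtchouk
  rw [abs_div, Nat.abs_cast]
  exact div_le_one_of_le₀ (abs_elemSymm_le x hx s k) (by positivity)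

theorem krawtchouk_recurrence (x : ι → ℝ) (hx : ∀ i, x i ^ 2 = 1) (s : Finset ι) {k : ℕ}
    (hk : k + 2 ≤ s.card) :
    ((s.card : ℝ) - (k + 1 : ℕ)) * krawtchouk s x (k + 2) =
      (∑ i ∈ s, x i) * krawtchouk s x (k + 1) - (k + 1 : ℕ) * krawtchouk s x k := by
  have h0 := elemSymm_recurrence x hx s k
  have c0 : (0 : ℝ) < s.card.choose k := by exact_mod_cast Nat.choose_pos (by omega)
  have c1 : (0 : ℝ) < s.card.choose (k + 1) := by exact_mod_cast Nat.choose_pos (by omega)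
  have c2 : (0 : ℝ) < s.card.choose (k + 2) := by exact_mod_cast Nat.choose_pos (by omega)
  have e1 : (s.card.choose (k + 1) : ℝ) * (k + 1) = s.card.choose k * (s.card - k) := by
    have := Nat.choose_succ_right_eq s.card k
    rw [← Nat.cast_sub (by omega)]
    exact_mod_cast this
  have e2 : (s.card.choose (k + 2) : ℝ) * (k + 2) = s.card.choose (k + 1) * (s.card - (k + 1)) := by
    have := Nat.choose_succ_right_eq s.card (k + 1)
    have h : ((s.card : ℝ) - (k + 1)) = ((s.card - (k + 1) : ℕ) : ℝ) := by
      rw [Nat.cast_sub (by omega)]; push_cast; ring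
    rw [h]
    exact_mod_cast this
  have a0 : elemSymm s x k = krawtchouk s x k * s.card.choose k := by
    simp [krawtchouk, c0.ne']
  have a1 : elemSymm s x (k + 1) = krawtchouk s x (k + 1) * s.card.choose (k + 1) := by
    simp [krawtchouk, c1.ne']
  have a2 : elemSymm s x (k + 2) = krawtchouk s x (k + 2) * s.card.choose (k + 2) := by
    simp [krawtchouk, c2.ne']
  rw [a0, a1, a2] at h0
  apply mul_left_cancel₀ c1.ne'
  push_cast
  linear_combination h0 - krawtchouk s x (k + 2) * e2 + krawtchouk s x k * e1

variable {x : ι → ℝ} {s : Finset ι} {t : ℕ}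

/-- Normalized Krawtchouk values decay geometrically in the degree for nearly balanced signs. -/
theorem abs_krawtchouk_le_pow (hx : ∀ i, x i ^ 2 = 1) {σ : ℝ} (hσ : |∑ i ∈ s, x i| ≤ σ * s.card)
    (hσ0 : 0 ≤ σ) (ht : (t : ℝ) ≤ σ ^ 2 * s.card) (ht2 : 2 * t ≤ s.card) {k : ℕ} (hk : k ≤ t) :
    |krawtchouk s x k| ≤ (4 * σ) ^ k := by
  induction k using Nat.strong_induction_on with
  | _ k ih =>
    match k with
    | 0 => simp [krawtchouk_zero]
    | 1 =>
      have h1 := krawtchouk_one s x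
      have hN : (0 : ℝ) < s.card := by
        have : 0 < s.card := by omega
        exact_mod_cast this
      rw [← h1, abs_mul, Nat.abs_cast] at hσ
      have : |krawtchouk s x 1| ≤ σ := by
        by_contra! h
        nlinarith
      simp only [pow_one]
      linarith
    | k + 2 =>
      have hN : (0 : ℝ) < s.card := by
        have : 0 < s.card := by omega
        exact_mod_cast this
      have h0 := ih k (by omega) (by omega)
      have h1 := ih (k + 1) (by omega) (by omega)
      have hr := krawtchouk_recurrence x hx s (k := k) (by omega)
      have hk1 : ((k + 1 : ℕ) : ℝ) ≤ t := by exact_mod_cast (by omega : k + 1 ≤ t)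
      have ht2' : 2 * (t : ℝ) ≤ s.card := by exact_mod_cast ht2
      have hpos : (s.card : ℝ) / 2 ≤ s.card - (k + 1 : ℕ) := by linarith
      have hub : |((s.card : ℝ) - (k + 1 : ℕ)) * krawtchouk s x (k + 2)| ≤
          σ * s.card * (4 * σ) ^ (k + 1) + t * (4 * σ) ^ k := by
        rw [hr]
        refine (abs_sub _ _).trans ?_
        rw [abs_mul, abs_mul, Nat.abs_cast]
        gcongr
      rw [abs_mul, abs_of_nonneg (by linarith)] at hub
      have hp : 0 ≤ (4 * σ) ^ k := by positivity
      -- The base 4σ closes the induction because the two recurrence terms give 4 + 1 = 5 units of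
      -- σ²|s|(4σ)^k, while the target allows 4²/2 = 8.
      have h3 : (s.card : ℝ) / 2 * |krawtchouk s x (k + 2)| ≤
          s.card / 2 * (4 * σ) ^ (k + 2) := by
        calc _ ≤ ((s.card : ℝ) - (k + 1 : ℕ)) * |krawtchouk s x (k + 2)| := by gcongr
          _ ≤ _ := hub
          _ ≤ σ * s.card * (4 * σ) ^ (k + 1) + σ ^ 2 * s.card * (4 * σ) ^ k := by gcongr
          _ = 5 * (σ ^ 2 * s.card * (4 * σ) ^ k) := by ring
          _ ≤ 8 * (σ ^ 2 * s.card * (4 * σ) ^ k) := by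
              have : 0 ≤ σ ^ 2 * s.card * (4 * σ) ^ k := by positivity
              linarith
          _ = _ := by ring
      exact le_of_mul_le_mul_left h3 (by positivity)

/-- For positively biased signs the normalized Krawtchouk values are positive, and consecutive ratios
are at least half the bias. -/
theorem krawtchouk_pos_and_ratio (hx : ∀ i, x i ^ 2 = 1) {σ : ℝ} (hσ : σ * s.card ≤ ∑ i ∈ s, x i)
    (hσ0 : 0 < σ) (ht : 4 * (t : ℝ) ≤ σ ^ 2 * s.card) (ht2 : 2 * t ≤ s.card) {k : ℕ} (hk : k < t) :
    0 < krawtchouk s x k ∧ σ / 2 * krawtchouk s x k ≤ krawtchouk s x (k + 1) := by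
  have hN : (0 : ℝ) < s.card := by
    have : 0 < s.card := by omega
    exact_mod_cast this
  induction k with
  | zero =>
    have h1 := krawtchouk_one s x
    rw [← h1, mul_comm] at hσ
    have := le_of_mul_le_mul_left hσ hN
    simp only [krawtchouk_zero, zero_add]
    constructor <;> linarith
  | succ k ih =>
    obtain ⟨h0, h1⟩ := ih (by omega)
    have hr := krawtchouk_recurrence x hx s (k := k) (by omega)
    have hp : 0 < krawtchouk s x (k + 1) := lt_of_lt_of_le (by positivity) h1
    refine ⟨hp, ?_⟩
    have hk1 : ((k + 1 : ℕ) : ℝ) ≤ t := by exact_mod_cast (by omega : k + 1 ≤ t)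
    have hk0 : (0 : ℝ) < (k + 1 : ℕ) := by positivity
    have ht2' : 2 * (t : ℝ) ≤ s.card := by exact_mod_cast ht2
    have hpos : 0 < (s.card : ℝ) - (k + 1 : ℕ) := by linarith
    -- The ratio bound one degree lower makes the subtracted recurrence term at most half of the
    -- leading one.
    have h4 : (k + 1 : ℕ) * krawtchouk s x k ≤ σ / 2 * s.card * krawtchouk s x (k + 1) := by
      calc (k + 1 : ℕ) * krawtchouk s x k ≤ t * krawtchouk s x k := by gcongr
        _ ≤ (σ ^ 2 * s.card / 4) * krawtchouk s x k := by gcongr; linarith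
        _ = σ / 2 * s.card * (σ / 2 * krawtchouk s x k) := by ring
        _ ≤ _ := by gcongr
    apply le_of_mul_le_mul_left _ hpos
    calc ((s.card : ℝ) - (k + 1 : ℕ)) * (σ / 2 * krawtchouk s x (k + 1))
        ≤ s.card * (σ / 2 * krawtchouk s x (k + 1)) := by gcongr; linarith
      _ = σ * s.card * krawtchouk s x (k + 1) - σ / 2 * s.card * krawtchouk s x (k + 1) := by ring
      _ ≤ (∑ i ∈ s, x i) * krawtchouk s x (k + 1) - (k + 1 : ℕ) * krawtchouk s x k := by
          gcongr
      _ = _ := hr.symm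

theorem krawtchouk_pos (hx : ∀ i, x i ^ 2 = 1) {σ : ℝ} (hσ : σ * s.card ≤ ∑ i ∈ s, x i)
    (hσ0 : 0 < σ) (ht : 4 * (t : ℝ) ≤ σ ^ 2 * s.card) (ht2 : 2 * t ≤ s.card) {k : ℕ} (hk : k ≤ t) :
    0 < krawtchouk s x k := by
  cases k with
  | zero => simp [krawtchouk_zero]
  | succ k =>
    obtain ⟨h0, h1⟩ := krawtchouk_pos_and_ratio hx hσ hσ0 ht ht2 (k := k) (by omega)
    exact lt_of_lt_of_le (by positivity) h1

/-- Iterates the ratio bound. From degree 0 it gives the bias of a light error; ending at degree t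
it compares rows with a part of weight a in the exceptional set to rows without one, at the price
(2/σ)^a. -/
theorem pow_mul_krawtchouk_le (hx : ∀ i, x i ^ 2 = 1) {σ : ℝ} (hσ : σ * s.card ≤ ∑ i ∈ s, x i)
    (hσ0 : 0 < σ) (ht : 4 * (t : ℝ) ≤ σ ^ 2 * s.card) (ht2 : 2 * t ≤ s.card) {k a : ℕ}
    (hk : k + a ≤ t) : (σ / 2) ^ a * krawtchouk s x k ≤ krawtchouk s x (k + a) := by
  induction a with
  | zero => simp
  | succ a ih =>
    have h1 := (krawtchouk_pos_and_ratio hx hσ hσ0 ht ht2 (k := k + a) (by omega)).2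
    calc _ = σ / 2 * ((σ / 2) ^ a * krawtchouk s x k) := by ring
      _ ≤ σ / 2 * krawtchouk s x (k + a) := by gcongr; exact ih (by omega)
      _ ≤ _ := h1

/-- For positive bias the subtracted term of the recurrence is nonnegative. Dropping it leaves
consecutive ratios of at most S/(N - k), hence S/(N - t), with S the sum of the N signs. -/
theorem krawtchouk_le_pow (hx : ∀ i, x i ^ 2 = 1) {σ : ℝ} (hσ : σ * s.card ≤ ∑ i ∈ s, x i)
    (hσ0 : 0 < σ) (ht : 4 * (t : ℝ) ≤ σ ^ 2 * s.card) (ht2 : 2 * t < s.card) {k : ℕ} (hk : k ≤ t) :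
    krawtchouk s x k ≤ ((∑ i ∈ s, x i) / (s.card - t)) ^ k := by
  have ht2' : 2 * (t : ℝ) < s.card := by exact_mod_cast ht2
  have ht0 : (0 : ℝ) ≤ t := Nat.cast_nonneg _
  have hN : (0 : ℝ) < s.card := by linarith
  have hS : 0 < ∑ i ∈ s, x i := lt_of_lt_of_le (by positivity) hσ
  have hd : (0 : ℝ) < s.card - t := by linarith
  induction k with
  | zero => simp [krawtchouk_zero]
  | succ k ih =>
    have ihk := ih (by omega)
    have hp := krawtchouk_pos hx hσ hσ0 ht ht2.le (k := k + 1) hk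
    suffices h : krawtchouk s x (k + 1) ≤ (∑ i ∈ s, x i) / (s.card - t) * krawtchouk s x k by
      refine h.trans ?_
      rw [pow_succ']
      gcongr
    rw [div_mul_eq_mul_div, le_div_iff₀ hd, mul_comm]
    have hk1 : ((k : ℕ) : ℝ) ≤ t := by exact_mod_cast (by omega : k ≤ t)
    calc ((s.card : ℝ) - t) * krawtchouk s x (k + 1)
        ≤ (s.card - k) * krawtchouk s x (k + 1) := by gcongr
      _ ≤ (∑ i ∈ s, x i) * krawtchouk s x k := by
        cases k with
        | zero => simp [krawtchouk_zero, krawtchouk_one]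
        | succ k =>
          have h0 := krawtchouk_pos hx hσ hσ0 ht ht2.le (k := k) (by omega)
          rw [krawtchouk_recurrence x hx s (by omega)]
          have : (0 : ℝ) ≤ (k + 1 : ℕ) * krawtchouk s x k := by positivity
          linarith

/-- In even degree, normalized Krawtchouk values are at worst slightly negative. -/
theorem neg_pow_le_krawtchouk (hx : ∀ i, x i ^ 2 = 1) {σ : ℝ} (hσ0 : 0 < σ)
    (ht : 4 * (t : ℝ) ≤ σ ^ 2 * s.card) (ht2 : 2 * t ≤ s.card) (hte : Even t) :
    -(4 * σ) ^ t ≤ krawtchouk s x t := by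
  have ht0 : (0 : ℝ) ≤ t := Nat.cast_nonneg _
  have hp : 0 ≤ (4 * σ) ^ t := by positivity
  rcases le_total |∑ i ∈ s, x i| (σ * s.card) with h | h
  · exact (abs_le.mp (abs_krawtchouk_le_pow hx h hσ0.le (by linarith) ht2 le_rfl)).1
  · rcases le_abs.mp h with h | h
    · have := krawtchouk_pos hx h hσ0 ht ht2 le_rfl
      linarith
    · rw [← Finset.sum_neg_distrib] at h
      have := krawtchouk_pos (x := fun i => -x i) (fun i => by simpa using hx i) h hσ0 ht ht2 le_rfl
      rw [krawtchouk_neg, hte.neg_one_pow, one_mul] at this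
      linarith

end Krawtchouk

/-! ### Characters summed over sparse vectors with a prescribed restriction -/

/-- The nontrivial character of the field with two elements. -/
def sgn (a : ZMod 2) : ℝ := if a = 0 then 1 else -1

@[simp] theorem sgn_zero : sgn 0 = 1 := if_pos rfl

@[simp] theorem sgn_one : sgn 1 = -1 := if_neg one_ne_zero

theorem zmod_two_eq (a : ZMod 2) : a = 0 ∨ a = 1 := by revert a; decide

theorem sgn_add (a b : ZMod 2) : sgn (a + b) = sgn a * sgn b := by
  rcases zmod_two_eq a with rfl | rfl <;> rcases zmod_two_eq b with rfl | rfl <;>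
    simp [show (1 : ZMod 2) + 1 = 0 from rfl]

theorem sgn_sq (a : ZMod 2) : sgn a ^ 2 = 1 := by
  rcases zmod_two_eq a with rfl | rfl <;> simp

theorem abs_sgn (a : ZMod 2) : |sgn a| = 1 := by
  rcases zmod_two_eq a with rfl | rfl <;> simp

theorem sgn_sum {ι : Type*} [DecidableEq ι] (s : Finset ι) (f : ι → ZMod 2) :
    sgn (∑ i ∈ s, f i) = ∏ i ∈ s, sgn (f i) := by
  induction s using Finset.induction_on with
  | empty => simp
  | insert a s ha ih => rw [Finset.sum_insert ha, Finset.prod_insert ha, sgn_add, ih]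

theorem ite_eq_zero_eq_sgn (a : ZMod 2) : (if a = 0 then (1 : ℝ) else 0) = (1 + sgn a) / 2 := by
  rcases zmod_two_eq a with rfl | rfl <;> simp

theorem ite_eq_one_eq_sgn (a : ZMod 2) : (if a ≠ 0 then (1 : ℝ) else 0) = (1 - sgn a) / 2 := by
  rcases zmod_two_eq a with rfl | rfl <;> simp

theorem hammingNorm_eq_sum {n : ℕ} (v : BitVec2 n) :
    (hammingNorm v : ℝ) = ∑ i, (1 - sgn (v i)) / 2 := by
  rw [hammingNorm, Finset.card_eq_sum_ones, Finset.sum_filter]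
  push_cast
  exact Finset.sum_congr rfl fun i _ => ite_eq_one_eq_sgn (v i)

theorem sum_sgn_eq {n : ℕ} (v : BitVec2 n) : ∑ i, sgn (v i) = n - 2 * hammingNorm v := by
  rw [hammingNorm_eq_sum, ← Finset.sum_div, Finset.sum_sub_distrib]
  simp
  ring

/-- Orthogonality of the characters of `𝔽₂ ^ d`. -/
theorem sum_sgn_dotProduct {d : ℕ} (a : BitVec2 d) :
    ∑ u : BitVec2 d, sgn (dotProduct a u) = if a = 0 then 2 ^ d else 0 := by
  split_ifs with h
  · simp [h]
  · obtain ⟨i, hi⟩ : ∃ i, a i ≠ 0 := by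
      by_contra! h'
      exact h (funext h')
    have hi1 : a i = 1 := (zmod_two_eq _).resolve_left hi
    have := Equiv.sum_comp (Equiv.addRight (Pi.single i (1 : ZMod 2))) fun u : BitVec2 d =>
      sgn (dotProduct a u)
    simp only [Equiv.coe_addRight, dotProduct_add, sgn_add, dotProduct_single, hi1, mul_one,
      sgn_one, mul_neg, Finset.sum_neg_distrib] at this
    linarith

/-- The vectors of Hamming weight `t`. -/
def sparse (n t : ℕ) : Finset (BitVec2 n) := Finset.univ.filter fun h => hammingNorm h = t

theorem mem_sparse {n t : ℕ} {h : BitVec2 n} : h ∈ sparse n t ↔ hammingNorm h = t := by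
  simp [sparse]

/-- The restriction of a vector to the coordinates in `J`, extended by zero. -/
def part {n : ℕ} (J : Finset (Fin n)) (h : BitVec2 n) : BitVec2 n :=
  fun i => if i ∈ J then h i else 0

/-- The indicator vector of a set of coordinates. -/
def ind {n : ℕ} (T : Finset (Fin n)) : BitVec2 n := fun i => if i ∈ T then 1 else 0

/-- The vectors of weight `t` whose restriction to `J` is `A`. -/
def fiber {n : ℕ} (J : Finset (Fin n)) (t : ℕ) (A : BitVec2 n) : Finset (BitVec2 n) :=
  (sparse n t).filter fun h => part J h = A

theorem mem_fiber {n t : ℕ} {J : Finset (Fin n)} {A h : BitVec2 n} :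
    h ∈ fiber J t A ↔ hammingNorm h = t ∧ part J h = A := by
  simp [fiber, mem_sparse]

theorem hammingNorm_part_add {n : ℕ} (J : Finset (Fin n)) (h : BitVec2 n) :
    hammingNorm (part J h) + (Jᶜ.filter fun i => h i ≠ 0).card = hammingNorm h := by
  rw [hammingNorm, hammingNorm, ← Finset.card_union_of_disjoint]
  · congr 1
    ext i
    by_cases hi : i ∈ J <;> simp [part, hi]
  · rw [Finset.disjoint_left]
    intro i h1 h2
    simp only [Finset.mem_filter, Finset.mem_compl] at h1 h2
    exact h1.2 (by simp [part, h2.1])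

theorem hammingNorm_part_le {n : ℕ} (J : Finset (Fin n)) (h : BitVec2 n) :
    hammingNorm (part J h) ≤ hammingNorm h := by
  have := hammingNorm_part_add J h
  omega

theorem part_part {n : ℕ} (J : Finset (Fin n)) (h : BitVec2 n) : part J (part J h) = part J h := by
  ext i
  by_cases hi : i ∈ J <;> simp [part, hi]

theorem sum_fiber {n t : ℕ} (J : Finset (Fin n)) {A : BitVec2 n} (hA : part J A = A)
    (hAt : hammingNorm A ≤ t) (f : BitVec2 n → ℝ) :
    ∑ h ∈ fiber J t A, f h =
      ∑ T ∈ Jᶜ.powersetCard (t - hammingNorm A), f (A + ind T) := by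
  refine Finset.sum_nbij' (fun h => Jᶜ.filter fun i => h i ≠ 0) (fun T => A + ind T) ?_ ?_ ?_ ?_ ?_
  · intro h hh
    obtain ⟨h1, h2⟩ := mem_fiber.mp hh
    rw [Finset.mem_powersetCard]
    refine ⟨Finset.filter_subset _ _, ?_⟩
    have := hammingNorm_part_add J h
    rw [h1, h2] at this
    omega
  · intro T hT
    obtain ⟨h1, h2⟩ := Finset.mem_powersetCard.mp hT
    have hp : part J (A + ind T) = A := by
      ext i
      have hi' := congrFun hA i
      by_cases hi : i ∈ J
      · have : i ∉ T := fun h => by simpa [hi] using h1 h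
        simp [part, hi, ind, this]
      · simpa [part, hi] using hi'
    rw [mem_fiber]
    refine ⟨?_, hp⟩
    have := hammingNorm_part_add J (A + ind T)
    rw [hp] at this
    have e : (Jᶜ.filter fun i => (A + ind T) i ≠ 0) = T := by
      ext i
      have hi' := congrFun hA i
      by_cases hi : i ∈ J
      · have : i ∉ T := fun h => by simpa [hi] using h1 h
        simp [hi, this]
      · simp only [part, hi, if_false] at hi'
        rw [Finset.mem_filter, Finset.mem_compl, Pi.add_apply, ← hi']
        simp [hi, ind]
    rw [e] at this
    omega
  · intro h hh
    obtain ⟨h1, h2⟩ := mem_fiber.mp hh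
    ext i
    rw [← h2]
    by_cases hi : i ∈ J
    · simp [part, hi, ind]
    · rcases zmod_two_eq (h i) with h0 | h0 <;> simp [part, hi, ind, h0]
  · intro T hT
    obtain ⟨h1, h2⟩ := Finset.mem_powersetCard.mp hT
    ext i
    have hi' := congrFun hA i
    by_cases hi : i ∈ J
    · have : i ∉ T := fun h => by simpa [hi] using h1 h
      simp [hi, this]
    · simp only [part, hi, if_false] at hi'
      rw [Finset.mem_filter, Finset.mem_compl, Pi.add_apply, ← hi']
      simp [hi, ind]
  · intro h hh
    obtain ⟨h1, h2⟩ := mem_fiber.mp hh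
    congr 1
    ext i
    rw [← h2]
    by_cases hi : i ∈ J
    · simp [part, hi, ind]
    · rcases zmod_two_eq (h i) with h0 | h0 <;> simp [part, hi, ind, h0]

theorem card_fiber {n t : ℕ} (J : Finset (Fin n)) {A : BitVec2 n} (hA : part J A = A)
    (hAt : hammingNorm A ≤ t) :
    (fiber J t A).card = (Jᶜ.card).choose (t - hammingNorm A) := by
  have := sum_fiber J hA hAt fun _ => 1
  simp only [Finset.sum_const, nsmul_eq_mul, mul_one, Finset.card_powersetCard] at this
  exact_mod_cast this

theorem dotProduct_ind {n : ℕ} (T : Finset (Fin n)) (v : BitVec2 n) :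
    dotProduct (ind T) v = ∑ i ∈ T, v i := by
  simp [dotProduct, ind]

/-- The mean of the character `h ↦ (-1) ^ (h · v)` over a fiber. -/
noncomputable def fiberMean {n : ℕ} (J : Finset (Fin n)) (t : ℕ) (A v : BitVec2 n) : ℝ :=
  sgn (dotProduct A v) * krawtchouk Jᶜ (fun i => sgn (v i)) (t - hammingNorm A)

/-- The part in J contributes a fixed sign and the free part is a uniform subset of the complement
of fixed size, so the character sum is an elementary symmetric function of the signs outside J. -/
theorem sum_fiber_sgn {n t : ℕ} (J : Finset (Fin n)) {A : BitVec2 n} (hA : part J A = A)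
    (hAt : hammingNorm A ≤ t) (v : BitVec2 n) :
    ∑ h ∈ fiber J t A, sgn (dotProduct h v) = (fiber J t A).card * fiberMean J t A v := by
  rw [sum_fiber J hA hAt, card_fiber J hA hAt, fiberMean, krawtchouk, mul_div_assoc',
    mul_div_assoc']
  simp only [add_dotProduct, sgn_add, dotProduct_ind, sgn_sum]
  rw [← Finset.mul_sum]
  change _ * elemSymm _ _ _ = _
  -- If the binomial coefficient vanishes, the normalization divides by zero; the sum is then zero
  -- as well.
  rcases Nat.eq_zero_or_pos ((Jᶜ.card).choose (t - hammingNorm A)) with h | h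
  · have := abs_elemSymm_le (fun i => sgn (v i)) (fun i => sgn_sq _) Jᶜ (t - hammingNorm A)
    rw [h, Nat.cast_zero, abs_nonpos_iff] at this
    simp [this]
  · have : ((Jᶜ.card).choose (t - hammingNorm A) : ℝ) ≠ 0 := by exact_mod_cast h.ne'
    field_simp

theorem fiber_empty {n t : ℕ} : fiber (∅ : Finset (Fin n)) t 0 = sparse n t := by
  rw [fiber, Finset.filter_true_of_mem]
  intro h _
  ext i
  simp [part]

theorem card_sparse (n t : ℕ) : (sparse n t).card = n.choose t := by
  rw [← fiber_empty, card_fiber] <;> simp [part, funext_iff]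

theorem sum_sparse_sgn (n t : ℕ) (v : BitVec2 n) :
    ∑ h ∈ sparse n t, sgn (dotProduct h v) =
      n.choose t * krawtchouk Finset.univ (fun i => sgn (v i)) t := by
  rw [← card_sparse, ← fiber_empty, sum_fiber_sgn] <;> simp [part, fiberMean, funext_iff]

theorem card_filter_sparse (n t : ℕ) (v : BitVec2 n) :
    (((sparse n t).filter fun h => dotProduct h v = 0).card : ℝ) =
      n.choose t * ((1 + krawtchouk Finset.univ (fun i => sgn (v i)) t) / 2) := by
  rw [Finset.card_filter]
  push_cast
  simp_rw [ite_eq_zero_eq_sgn]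
  rw [← Finset.sum_div, Finset.sum_add_distrib, sum_sparse_sgn]
  simp [card_sparse]
  ring

/-- This is the bound (t/n)^a on the chance that a random t-subset contains a given a-subset: each
further element costs (t - a)/(n - a) ≤ t/n. -/
theorem choose_sub_mul_pow_le {n t a : ℕ} (ha : a ≤ t) (ht : t ≤ n) :
    (n - a).choose (t - a) * n ^ a ≤ t ^ a * n.choose t := by
  induction a with
  | zero => simp
  | succ a ih =>
    have h1 := ih (by omega)
    obtain ⟨m, hm⟩ : ∃ m, n - a = m + 1 := ⟨n - a - 1, by omega⟩
    obtain ⟨s, hs⟩ : ∃ s, t - a = s + 1 := ⟨t - a - 1, by omega⟩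
    have e1 : n - (a + 1) = m := by omega
    have e2 : t - (a + 1) = s := by omega
    rw [hm, hs] at h1
    rw [e1, e2]
    have h2 := Nat.add_one_mul_choose_eq m s
    have h3 : m.choose s * n ≤ t * (m + 1).choose (s + 1) := by
      have hmn : n = m + 1 + a := by omega
      have hst : t = s + 1 + a := by omega
      have : m.choose s ≤ (m + 1).choose (s + 1) := by
        rw [Nat.choose_succ_succ]; omega
      rw [hmn, hst]
      nlinarith
    calc m.choose s * n ^ (a + 1) = (m.choose s * n) * n ^ a := by ring
      _ ≤ (t * (m + 1).choose (s + 1)) * n ^ a := Nat.mul_le_mul_right _ h3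
      _ = t * ((m + 1).choose (s + 1) * n ^ a) := by ring
      _ ≤ t * (t ^ a * n.choose t) := Nat.mul_le_mul_left _ h1
      _ = _ := by ring

theorem card_filter_superset_le {n t : ℕ} (ht : t ≤ n) (hn : 0 < n) (T : Finset (Fin n)) :
    (((sparse n t).filter fun h => ∀ i ∈ T, h i ≠ 0).card : ℝ) ≤
      n.choose t * ((t : ℝ) / n) ^ T.card := by
  have hn' : (0 : ℝ) < n := by exact_mod_cast hn
  have hw : hammingNorm (ind T) = T.card := by
    rw [hammingNorm]
    congr 1
    ext i
    simp [ind]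
  have e : ((sparse n t).filter fun h => ∀ i ∈ T, h i ≠ 0) = fiber T t (ind T) := by
    ext h
    rw [mem_fiber, Finset.mem_filter, mem_sparse]
    refine and_congr_right fun _ => ⟨fun hT => ?_, fun hT i hi => ?_⟩
    · ext i
      by_cases hi : i ∈ T
      · simp [part, ind, hi, (zmod_two_eq _).resolve_left (hT i hi)]
      · simp [part, ind, hi]
    · have := congrFun hT i
      simp only [part, ind, hi, if_true] at this
      simp [this]
  have hp : part T (ind T) = ind T := by
    ext i
    by_cases hi : i ∈ T <;> simp [part, ind, hi]
  rw [e]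
  by_cases hT : T.card ≤ t
  · rw [card_fiber T hp (by omega), hw, Finset.card_compl, Fintype.card_fin, div_pow,
      mul_div_assoc', le_div_iff₀ (by positivity)]
    have := choose_sub_mul_pow_le hT ht
    rw [mul_comm (n.choose t : ℝ)]
    exact_mod_cast this
  · have : fiber T t (ind T) = ∅ := by
      rw [Finset.eq_empty_iff_forall_notMem]
      intro h hh
      obtain ⟨h1, h2⟩ := mem_fiber.mp hh
      have := hammingNorm_part_le T h
      rw [h2, h1, hw] at this
      omega
    rw [this]
    simp only [Finset.card_empty, Nat.cast_zero]
    positivity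

/-- Exponential moment of the number of ones of a random sparse vector in a set of coordinates. -/
theorem sum_pow_part_le {n t : ℕ} (ht : t ≤ n) (hn : 0 < n) (J : Finset (Fin n)) {y : ℝ}
    (hy : 1 ≤ y) :
    ∑ h ∈ sparse n t, y ^ hammingNorm (part J h) ≤
      n.choose t * Real.exp ((y - 1) * (t * J.card / n)) := by
  -- Writing y as 1 + (y - 1) and expanding over subsets of J reduces the moment to containment
  -- probabilities; y ≥ 1 keeps the coefficients nonnegative.
  have h1 : ∀ h : BitVec2 n, y ^ hammingNorm (part J h) =
      ∑ T ∈ J.powerset, if ∀ i ∈ T, h i ≠ 0 then (y - 1) ^ T.card else 0 := by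
    intro h
    have e : y ^ hammingNorm (part J h) = ∏ i ∈ J, (1 + if h i ≠ 0 then y - 1 else 0) := by
      have : hammingNorm (part J h) = (J.filter fun i => h i ≠ 0).card := by
        rw [hammingNorm]
        congr 1
        ext i
        by_cases hi : i ∈ J <;> simp [part, hi]
      rw [this, Finset.prod_congr rfl (g := fun i => if h i ≠ 0 then y else 1),
        Finset.prod_ite]
      · simp
      · intro i _
        split_ifs <;> ring
    rw [e, Finset.prod_one_add]
    refine Finset.sum_congr rfl fun T _ => ?_
    split_ifs with hT
    · rw [Finset.prod_congr rfl fun i hi => if_pos (hT i hi), Finset.prod_const]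
    · push Not at hT
      obtain ⟨i, hi, h0⟩ := hT
      exact Finset.prod_eq_zero hi (by simp [h0])
  calc ∑ h ∈ sparse n t, y ^ hammingNorm (part J h)
      = ∑ T ∈ J.powerset, (y - 1) ^ T.card *
          ((sparse n t).filter fun h => ∀ i ∈ T, h i ≠ 0).card := by
        simp_rw [h1]
        rw [Finset.sum_comm]
        refine Finset.sum_congr rfl fun T _ => ?_
        rw [← Finset.sum_filter, Finset.sum_const, nsmul_eq_mul, mul_comm]
    _ ≤ ∑ T ∈ J.powerset, (y - 1) ^ T.card * (n.choose t * ((t : ℝ) / n) ^ T.card) := by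
        refine Finset.sum_le_sum fun T _ => ?_
        have : 0 ≤ y - 1 := by linarith
        gcongr
        exact card_filter_superset_le ht hn T
    _ = n.choose t * ∑ T ∈ J.powerset, ∏ i ∈ T, ((y - 1) * (t / n)) := by
        rw [Finset.mul_sum]
        refine Finset.sum_congr rfl fun T _ => ?_
        rw [Finset.prod_const, mul_pow]
        ring
    _ = n.choose t * (1 + (y - 1) * (t / n)) ^ J.card := by
        rw [← Finset.prod_one_add, Finset.prod_const]
    _ ≤ n.choose t * Real.exp ((y - 1) * (t / n)) ^ J.card := by
        have : 0 ≤ (y - 1) * ((t : ℝ) / n) := mul_nonneg (by linarith) (by positivity)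
        gcongr
        rw [add_comm]
        exact Real.add_one_le_exp _
    _ = _ := by
        rw [← Real.exp_nat_mul]
        congr 2
        ring

/-! ### Kernels of row tuples and matrices with columns in a subspace -/

/-- The tuples of rows of weight `t`. -/
def rowTuples (ι : Type*) [Fintype ι] [DecidableEq ι] (n t : ℕ) : Finset (ι → BitVec2 n) :=
  Fintype.piFinset fun _ => sparse n t

theorem mem_rowTuples {ι : Type*} [Fintype ι] [DecidableEq ι] {n t : ℕ} {H : ι → BitVec2 n} :
    H ∈ rowTuples ι n t ↔ ∀ i, hammingNorm (H i) = t := by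
  simp [rowTuples, mem_sparse]

theorem card_rowTuples (ι : Type*) [Fintype ι] [DecidableEq ι] (n t : ℕ) :
    (rowTuples ι n t).card = n.choose t ^ Fintype.card ι := by
  simp [rowTuples, card_sparse]

/-- The number of sparse row tuples that annihilate a given vector. -/
theorem card_filter_rowTuples (ι : Type*) [Fintype ι] [DecidableEq ι] (n t : ℕ) (v : BitVec2 n) :
    (((rowTuples ι n t).filter fun H => ∀ i, dotProduct (H i) v = 0).card : ℝ) =
      n.choose t ^ Fintype.card ι *
        ((1 + krawtchouk Finset.univ (fun i => sgn (v i)) t) / 2) ^ Fintype.card ι := by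
  have : ((rowTuples ι n t).filter fun H => ∀ i, dotProduct (H i) v = 0) =
      Fintype.piFinset fun _ : ι => (sparse n t).filter fun h => dotProduct h v = 0 := by
    ext H
    simp [rowTuples, Fintype.mem_piFinset, forall_and]
  rw [this, Fintype.card_piFinset, Finset.prod_const, Finset.card_univ, Nat.cast_pow,
    card_filter_sparse, mul_pow]

/-- The vectors annihilated by all rows. -/
def kerRows {ι : Type*} {n : ℕ} (H : ι → BitVec2 n) : Submodule (ZMod 2) (BitVec2 n) where
  carrier := {v | ∀ i, dotProduct (H i) v = 0}
  add_mem' := fun {v w} hv hw i => by rw [dotProduct_add, hv i, hw i, add_zero]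
  zero_mem' := fun i => dotProduct_zero _
  smul_mem' := fun c v hv i => by rw [dotProduct_smul, hv i, smul_zero]

theorem mem_kerRows {ι : Type*} {n : ℕ} {H : ι → BitVec2 n} {v : BitVec2 n} :
    v ∈ kerRows H ↔ ∀ i, dotProduct (H i) v = 0 := Iff.rfl

/-- Each row is one linear condition, so it at most halves the space (rank-nullity for the syndrome
map on V). -/
theorem card_le_card_inf_kerRows_mul {ι : Type*} [Fintype ι] {n : ℕ} (H : ι → BitVec2 n)
    (V : Submodule (ZMod 2) (BitVec2 n)) :
    Nat.card V ≤ Nat.card ↥(V ⊓ kerRows H) * 2 ^ Fintype.card ι := by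
  let f : V →ₗ[ZMod 2] (ι → ZMod 2) :=
    { toFun := fun v i => dotProduct (H i) v
      map_add' := fun v w => by ext i; simp
      map_smul' := fun c v => by ext i; simp }
  have h1 : Nat.card V = Nat.card (LinearMap.ker f) * Nat.card (LinearMap.range f) := by
    rw [Submodule.card_eq_card_quotient_mul_card (LinearMap.ker f),
      Nat.card_congr f.quotKerEquivRange.toEquiv, mul_comm]
  have h2 : Nat.card (LinearMap.ker f) ≤ Nat.card ↥(V ⊓ kerRows H) := by
    refine Nat.card_le_card_of_injective
      (fun v => (⟨v.1.1, v.1.2, fun i => congrFun v.2 i⟩ : ↥(V ⊓ kerRows H))) ?_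
    intro v w h
    exact Subtype.ext (Subtype.ext (Subtype.mk.inj h))
  have h3 : Nat.card (LinearMap.range f) ≤ 2 ^ Fintype.card ι := by
    refine (Nat.card_le_card_of_injective _ Subtype.val_injective).trans ?_
    rw [Nat.card_fun]
    simp
  rw [h1]
  exact Nat.mul_le_mul h2 h3

theorem nat_card_pos {n : ℕ} (V : Submodule (ZMod 2) (BitVec2 n)) : 0 < Nat.card V :=
  Nat.card_pos

open Classical in
/-- The matrices all of whose columns lie in a given subspace. -/
noncomputable def matsIn {n : ℕ} (K : Submodule (ZMod 2) (BitVec2 n)) (d : ℕ) :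
    Finset (Matrix (Fin n) (Fin d) (ZMod 2)) :=
  Finset.univ.filter fun G => ∀ u, G.mulVec u ∈ K

theorem mem_matsIn {n d : ℕ} {K : Submodule (ZMod 2) (BitVec2 n)}
    {G : Matrix (Fin n) (Fin d) (ZMod 2)} : G ∈ matsIn K d ↔ ∀ u, G.mulVec u ∈ K := by
  simp [matsIn]

theorem card_matsIn {n : ℕ} (K : Submodule (ZMod 2) (BitVec2 n)) (d : ℕ) :
    (matsIn K d).card = Nat.card K ^ d := by
  classical
  have e : {G // G ∈ matsIn K d} ≃ (Fin d → K) :=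
    { toFun := fun G j => ⟨G.1.col j, by
        have := mem_matsIn.mp G.2 (Pi.single j 1)
        rwa [Matrix.mulVec_single_one] at this⟩
      invFun := fun c => ⟨Matrix.of fun i j => (c j).1 i, mem_matsIn.mpr fun u => by
        have : (Matrix.of fun i j => (c j).1 i).mulVec u = ∑ j, u j • (c j).1 := by
          ext i
          simp [Matrix.mulVec, dotProduct, mul_comm]
        rw [this]
        exact K.sum_mem fun j _ => K.smul_mem _ (c j).2⟩
      left_inv := fun G => rfl
      right_inv := fun c => rfl }
  have h := Nat.card_congr e
  rw [Nat.card_fun, Nat.card_eq_fintype_card, Fintype.card_coe] at h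
  simpa using h

open Classical in
/-- A fixed nontrivial combination of the columns is equidistributed. -/
theorem card_filter_matsIn_mul_le {n d : ℕ} (K : Submodule (ZMod 2) (BitVec2 n)) {u : BitVec2 d}
    (hu : u ≠ 0) (v : BitVec2 n) :
    ((matsIn K d).filter fun G => G.mulVec u = v).card * Nat.card K ≤ (matsIn K d).card := by
  by_cases hv : v ∈ K
  swap
  · have : ((matsIn K d).filter fun G => G.mulVec u = v) = ∅ := by
      rw [Finset.filter_eq_empty_iff]
      intro G hG h
      exact hv (h ▸ mem_matsIn.mp hG u)
    simp [this]
  obtain ⟨l, hl⟩ : ∃ l, u l ≠ 0 := by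
    by_contra! h'
    exact hu (funext h')
  have hl1 : u l = 1 := (zmod_two_eq _).resolve_left hl
  have hmul : ∀ (w : BitVec2 n) (u' : BitVec2 d),
      (Matrix.vecMulVec w (Pi.single l (1 : ZMod 2))).mulVec u' = u' l • w := by
    intro w u'
    ext i
    simp [Matrix.vecMulVec, Matrix.mulVec, dotProduct, Pi.single_apply, mul_comm]
  -- Adding v' - v to a column l with u l = 1 injects the matrices sending u to v into those sending
  -- it to v'.
  have hle : ∀ v' : K, ((matsIn K d).filter fun G => G.mulVec u = v).card ≤
      ((matsIn K d).filter fun G => G.mulVec u = v'.1).card := by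
    intro v'
    refine Finset.card_le_card_of_injOn
      (fun G => G + Matrix.vecMulVec (v'.1 - v) (Pi.single l (1 : ZMod 2))) ?_ ?_
    · intro G hG
      obtain ⟨h1, h2⟩ := Finset.mem_filter.mp hG
      refine Finset.mem_coe.mpr (Finset.mem_filter.mpr ⟨mem_matsIn.mpr fun u' => ?_, ?_⟩)
      · rw [Matrix.add_mulVec, hmul]
        exact K.add_mem (mem_matsIn.mp h1 u') (K.smul_mem _ (K.sub_mem v'.2 hv))
      · rw [Matrix.add_mulVec, hmul, h2, hl1, one_smul]
        abel
    · intro G _ G' _ h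
      exact add_right_cancel h
  calc _ = ∑ _v' : K, ((matsIn K d).filter fun G => G.mulVec u = v).card := by
        rw [Finset.sum_const, Finset.card_univ, smul_eq_mul, mul_comm, Nat.card_eq_fintype_card]
    _ ≤ ∑ v' : K, ((matsIn K d).filter fun G => G.mulVec u = v'.1).card :=
        Finset.sum_le_sum fun v' _ => hle v'
    _ = (matsIn K d).card := by
        rw [Finset.card_eq_sum_card_fiberwise (t := Finset.univ.image fun v' : K => v'.1)
          (f := fun G => G.mulVec u)]
        · rw [Finset.sum_image]
          intro a _ b _ h
          exact Subtype.ext h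
        · intro G hG
          simpa using mem_matsIn.mp hG u

/-- Every subspace is the range of a projection, hence of some d × d matrix. -/
theorem card_submodule_le (d : ℕ) :
    Nat.card (Submodule (ZMod 2) (BitVec2 d)) ≤ 2 ^ (d * d) := by
  have hs : Function.Surjective fun M : Matrix (Fin d) (Fin d) (ZMod 2) =>
      LinearMap.range (Matrix.toLin' M) := by
    intro W
    obtain ⟨g, hg⟩ := LinearMap.exists_leftInverse_of_injective W.subtype
      (LinearMap.ker_eq_bot.mpr W.subtype_injective)
    refine ⟨LinearMap.toMatrix' (W.subtype ∘ₗ g), ?_⟩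
    simp only [Matrix.toLin'_toMatrix']
    rw [LinearMap.range_comp, LinearMap.range_eq_top.mpr, Submodule.map_top,
      Submodule.range_subtype]
    exact fun w => ⟨w.1, LinearMap.congr_fun hg w⟩
  refine (Nat.card_le_card_of_surjective _ hs).trans ?_
  simp [Matrix, pow_mul]

/-- The coefficient vectors of the combinations of columns that lie in `C`. -/
def coeffsIn {n d : ℕ} (C : Submodule (ZMod 2) (BitVec2 n)) (G : Matrix (Fin n) (Fin d) (ZMod 2)) :
    Submodule (ZMod 2) (BitVec2 d) :=
  C.comap G.mulVecLin

theorem mem_coeffsIn {n d : ℕ} {C : Submodule (ZMod 2) (BitVec2 n)}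
    {G : Matrix (Fin n) (Fin d) (ZMod 2)} {u : BitVec2 d} :
    u ∈ coeffsIn C G ↔ G.mulVec u ∈ C := Iff.rfl

-- A matrix is determined by its values on bases of U and of a complement; the former lie in V₁, the
-- latter in V.
open Classical in
theorem card_mats_le {n d : ℕ} (V V₁ : Submodule (ZMod 2) (BitVec2 n))
    (U : Submodule (ZMod 2) (BitVec2 d)) :
    ((matsIn V d).filter fun G => ∀ u ∈ U, G.mulVec u ∈ V₁).card ≤
      Nat.card V₁ ^ Module.finrank (ZMod 2) U *
        Nat.card V ^ (d - Module.finrank (ZMod 2) U) := by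
  obtain ⟨U', hU'⟩ := Submodule.exists_isCompl U
  have hdim := Submodule.finrank_add_eq_of_isCompl hU'
  rw [Module.finrank_fin_fun] at hdim
  let b := Module.finBasis (ZMod 2) U
  let b' := Module.finBasis (ZMod 2) U'
  let Φ : {G // G ∈ (matsIn V d).filter fun G => ∀ u ∈ U, G.mulVec u ∈ V₁} →
      (Fin (Module.finrank (ZMod 2) U) → V₁) × (Fin (Module.finrank (ZMod 2) U') → V) := fun G =>
    (fun i => ⟨G.1.mulVec (b i), (Finset.mem_filter.mp G.2).2 _ (b i).2⟩,
      fun i => ⟨G.1.mulVec (b' i), mem_matsIn.mp (Finset.mem_filter.mp G.2).1 _⟩)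
  have hΦ : Function.Injective Φ := by
    intro G G' h
    have h1 : ∀ u ∈ U, G.1.mulVec u = G'.1.mulVec u := by
      have : G.1.mulVecLin ∘ₗ U.subtype = G'.1.mulVecLin ∘ₗ U.subtype := by
        refine b.ext fun i => ?_
        exact congrArg Subtype.val (congrFun (congrArg Prod.fst h) i)
      intro u hu
      exact LinearMap.congr_fun this ⟨u, hu⟩
    have h2 : ∀ u ∈ U', G.1.mulVec u = G'.1.mulVec u := by
      have : G.1.mulVecLin ∘ₗ U'.subtype = G'.1.mulVecLin ∘ₗ U'.subtype := by
        refine b'.ext fun i => ?_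
        exact congrArg Subtype.val (congrFun (congrArg Prod.snd h) i)
      intro u hu
      exact LinearMap.congr_fun this ⟨u, hu⟩
    apply Subtype.ext
    apply Matrix.mulVec_injective
    ext1 u
    obtain ⟨y, hy, z, hz, rfl⟩ : ∃ y ∈ U, ∃ z ∈ U', y + z = u := by
      rw [← Submodule.mem_sup, hU'.sup_eq_top]
      trivial
    rw [Matrix.mulVec_add, Matrix.mulVec_add, h1 y hy, h2 z hz]
  have := Nat.card_le_card_of_injective Φ hΦ
  rw [Nat.card_prod, Nat.card_fun, Nat.card_fun, Nat.card_eq_fintype_card, Fintype.card_coe] at this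
  simpa [show Module.finrank (ZMod 2) U' = d - Module.finrank (ZMod 2) U by omega] using this

open Classical in
/-- The weighted count of the matrices with columns in `V` whose column combinations meet `C` inside
`V₁` only. -/
theorem sum_matsIn_weight_le {n : ℕ} (d : ℕ) (V V₁ C : Submodule (ZMod 2) (BitVec2 n)) :
    ∑ G ∈ (matsIn V d).filter (fun G => ∀ u ∈ coeffsIn C G, G.mulVec u ∈ V₁),
      (((Nat.card V₁ : ℝ) ^ Module.finrank (ZMod 2) (coeffsIn C G) *
        (Nat.card V : ℝ) ^ (d - Module.finrank (ZMod 2) (coeffsIn C G)))⁻¹ : ℝ) ≤ 2 ^ (d * d) := by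
  have : Finite (Submodule (ZMod 2) (BitVec2 d)) :=
    Finite.of_injective (fun W => (W : Set (BitVec2 d))) SetLike.coe_injective
  have : Fintype (Submodule (ZMod 2) (BitVec2 d)) := Fintype.ofFinite _
  -- The weight depends on G only through its coefficient space. By `card_mats_le` each class has
  -- total weight at most one, so the sum is at most the number of subspaces.
  rw [← Finset.sum_fiberwise_of_maps_to (t := Finset.univ) (g := fun G => coeffsIn C G)
    (fun _ _ => Finset.mem_univ _)]
  calc _ ≤ ∑ _U : Submodule (ZMod 2) (BitVec2 d), (1 : ℝ) := by
        refine Finset.sum_le_sum fun U _ => ?_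
        have hV : (0 : ℝ) < Nat.card V := by exact_mod_cast nat_card_pos V
        have hV₁ : (0 : ℝ) < Nat.card V₁ := by exact_mod_cast nat_card_pos V₁
        have hpos : (0 : ℝ) < (Nat.card V₁ : ℝ) ^ Module.finrank (ZMod 2) U *
            (Nat.card V : ℝ) ^ (d - Module.finrank (ZMod 2) U) := by positivity
        rw [Finset.sum_congr rfl (g := fun _ => ((Nat.card V₁ : ℝ) ^ Module.finrank (ZMod 2) U *
          (Nat.card V : ℝ) ^ (d - Module.finrank (ZMod 2) U))⁻¹)
          (fun G hG => by rw [(Finset.mem_filter.mp hG).2]), Finset.sum_const, nsmul_eq_mul,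
          ← div_eq_mul_inv, div_le_one hpos]
        have h2 := card_mats_le (d := d) V V₁ U
        have h3 : (((matsIn V d).filter (fun G => ∀ u ∈ coeffsIn C G, G.mulVec u ∈ V₁)).filter
            fun G => coeffsIn C G = U).card ≤
            ((matsIn V d).filter fun G => ∀ u ∈ U, G.mulVec u ∈ V₁).card := by
          refine Finset.card_le_card fun G hG => ?_
          simp only [Finset.mem_filter] at hG ⊢
          exact ⟨hG.1.1, hG.2 ▸ hG.1.2⟩
        exact_mod_cast h3.trans h2
    _ = (Nat.card (Submodule (ZMod 2) (BitVec2 d)) : ℝ) := by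
        simp [Nat.card_eq_fintype_card]
    _ ≤ 2 ^ (d * d) := by exact_mod_cast card_submodule_le d

/-! ### Biases of a row with a prescribed part in the exceptional set -/

theorem krawtchouk_congr {ι : Type*} {s : Finset ι} {x y : ι → ℝ} (h : ∀ i ∈ s, x i = y i) (k : ℕ) :
    krawtchouk s x k = krawtchouk s y k := by
  unfold krawtchouk elemSymm
  congr 1
  refine Finset.sum_congr rfl fun T hT => Finset.prod_congr rfl fun i hi => ?_
  exact h i ((Finset.mem_powersetCard.mp hT).1 hi)

/-- The vectors that are constant outside `J`. -/
def constOff {n : ℕ} (J : Finset (Fin n)) : Submodule (ZMod 2) (BitVec2 n) where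
  carrier := {v | ∃ c, ∀ i ∉ J, v i = c}
  add_mem' := by
    rintro v w ⟨c, hc⟩ ⟨c', hc'⟩
    exact ⟨c + c', fun i hi => by rw [Pi.add_apply, hc i hi, hc' i hi]⟩
  zero_mem' := ⟨0, fun _ _ => rfl⟩
  smul_mem' := by
    rintro a v ⟨c, hc⟩
    exact ⟨a * c, fun i hi => by rw [Pi.smul_apply, hc i hi, smul_eq_mul]⟩

/-- The lower bound on the bias of a sparse row on a vector of bounded weight. -/
noncomputable def biasBound (σ₁ : ℝ) (t : ℕ) : ℝ := (σ₁ / 2) ^ t / 2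

/-- The numerical conditions of the counting argument. Here `σ` bounds the bias of balanced vectors,
`j` the number of exceptional coordinates, `α` the relative weight of the error, `ζ` the slack. -/
structure CountingConditions (n t d : ℕ) (j σ α s₂ σ₁ x₀ ζ : ℝ) : Prop where
  even : Even t
  t_le : t ≤ n
  n_pos : 0 < n
  s₂_pos : 0 < s₂
  s₂_le : 4 * s₂ ≤ 1
  σ₁_pos : 0 < σ₁
  σ₁_le : σ₁ ≤ 1
  t_le_s₂ : 4 * (t : ℝ) ≤ s₂ ^ 2 * (n - j)
  t_le_σ₁ : 4 * (t : ℝ) ≤ σ₁ ^ 2 * (n - j)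
  t_le_half : 2 * (t : ℝ) ≤ n - j
  balanced_le : σ * n + j ≤ s₂ * (n - j)
  bias_le : σ₁ * n ≤ (1 - 2 * α) * n - j
  error_le : 2 ^ d * (4 * s₂) ^ (t / 2) ≤ biasBound σ₁ t ^ 2 / 1024
  x₀_pos : 0 < x₀
  x₀_le : x₀ ≤ 1
  tj_le : t * j ≤ x₀ * n
  exp_le : 10 * (Real.exp (2 / s₂ * x₀) - 1) ≤ 1 / 8
  tail_le : 4 * 2 ^ d * (Real.exp 1 * x₀ ^ (t / 2)) ≤ biasBound σ₁ t ^ 2 / 128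
  slack_le : 8 * ζ ≤ biasBound σ₁ t

theorem biasBound_pos {σ₁ : ℝ} (h : 0 < σ₁) (t : ℕ) : 0 < biasBound σ₁ t := by
  unfold biasBound
  positivity

theorem biasBound_le {σ₁ : ℝ} (h : 0 < σ₁) (h1 : σ₁ ≤ 1) (t : ℕ) : biasBound σ₁ t ≤ 1 / 2 := by
  unfold biasBound
  have : (σ₁ / 2) ^ t ≤ 1 := pow_le_one₀ (by linarith) (by linarith)
  linarith

section RowMean

variable {n t d : ℕ} {j σ α s₂ σ₁ x₀ ζ : ℝ} {J : Finset (Fin n)}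

theorem card_compl_ge (hJ : (J.card : ℝ) ≤ j) : (n : ℝ) - j ≤ (Jᶜ.card : ℝ) := by
  have h1 : J.card + Jᶜ.card = n := by simp
  have h2 : (J.card : ℝ) + (Jᶜ.card : ℝ) = n := by exact_mod_cast h1
  linarith

theorem abs_sum_sub_sum_compl_le (v : BitVec2 n) :
    |∑ i, sgn (v i) - ∑ i ∈ Jᶜ, sgn (v i)| ≤ J.card := by
  rw [← Finset.sum_add_sum_compl J, add_sub_cancel_right]
  refine (Finset.abs_sum_le_sum_abs _ _).trans ?_
  simp [abs_sgn]

theorem sgn_signs_sq (v : BitVec2 n) (i : Fin n) : (fun i => sgn (v i)) i ^ 2 = 1 := sgn_sq _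

theorem fiberMean_zero (v : BitVec2 n) :
    fiberMean J t 0 v = krawtchouk Jᶜ (fun i => sgn (v i)) t := by
  simp [fiberMean]

theorem abs_fiberMean (A v : BitVec2 n) :
    |fiberMean J t A v| = |krawtchouk Jᶜ (fun i => sgn (v i)) (t - hammingNorm A)| := by
  rw [fiberMean, abs_mul, abs_sgn, one_mul]

namespace CountingConditions

variable (hc : CountingConditions n t d j σ α s₂ σ₁ x₀ ζ) (hJ : (J.card : ℝ) ≤ j)
include hc hJ

theorem t_le_s₂_compl : 4 * (t : ℝ) ≤ s₂ ^ 2 * Jᶜ.card :=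
  hc.t_le_s₂.trans (mul_le_mul_of_nonneg_left (card_compl_ge hJ) (by positivity))

theorem two_t_le_compl : 2 * t ≤ Jᶜ.card := by
  have := hc.t_le_half.trans (card_compl_ge hJ)
  exact_mod_cast this

/-- At least half of the row lies outside J, so the Krawtchouk degree is at least t/2; this is the
source of the exponent. -/
theorem abs_fiberMean_le_of_sum_le {A v : BitVec2 n} (hA : 2 * hammingNorm A ≤ t)
    (hv : |∑ i ∈ Jᶜ, sgn (v i)| ≤ s₂ * Jᶜ.card) :
    |fiberMean J t A v| ≤ (4 * s₂) ^ (t / 2) := by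
  have h0 := hc.s₂_pos
  have h1 := hc.t_le_s₂_compl hJ
  have ht0 : (0 : ℝ) ≤ t := Nat.cast_nonneg _
  rw [abs_fiberMean]
  refine (abs_krawtchouk_le_pow (sgn_signs_sq v) hv hc.s₂_pos.le (by linarith)
    (hc.two_t_le_compl hJ) (Nat.sub_le t _)).trans ?_
  exact pow_le_pow_of_le_one (by linarith) hc.s₂_le (by omega)

theorem abs_fiberMean_le_of_balanced {A v : BitVec2 n} (hA : 2 * hammingNorm A ≤ t)
    (hv : |∑ i, sgn (v i)| ≤ σ * n) : |fiberMean J t A v| ≤ (4 * s₂) ^ (t / 2) := by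
  have h0 := hc.s₂_pos
  apply hc.abs_fiberMean_le_of_sum_le hJ hA
  have h1 := abs_sum_sub_sum_compl_le (J := J) v
  have h2 := abs_sub_abs_le_abs_sub (∑ i ∈ Jᶜ, sgn (v i)) (∑ i, sgn (v i))
  rw [abs_sub_comm] at h2
  have h3 := mul_le_mul_of_nonneg_left (card_compl_ge (n := n) hJ) h0.le
  have := hc.balanced_le
  linarith

/-- Evenness of t is essential: near-constant vectors of either sign have positive means, so only
nearly balanced ones can be negative, and these are tiny. -/
theorem neg_le_fiberMean_zero (v : BitVec2 n) : -(4 * s₂) ^ (t / 2) ≤ fiberMean J t 0 v := by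
  have h0 := hc.s₂_pos
  rw [fiberMean_zero]
  have h1 := neg_pow_le_krawtchouk (sgn_signs_sq v) h0 (hc.t_le_s₂_compl hJ)
    (hc.two_t_le_compl hJ) hc.even
  have h2 : (4 * s₂) ^ t ≤ (4 * s₂) ^ (t / 2) :=
    pow_le_pow_of_le_one (by linarith) hc.s₂_le (by omega)
  linarith

/-- The bound is twice `biasBound`; the spare half later absorbs the negative contributions of
balanced shifts. -/
theorem le_fiberMean_zero {e : BitVec2 n} (he : (hammingNorm e : ℝ) ≤ α * n) :
    2 * biasBound σ₁ t ≤ fiberMean J t 0 e := by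
  have h0 := hc.σ₁_pos
  rw [fiberMean_zero, biasBound, mul_div_cancel₀ _ two_ne_zero]
  have h1 := abs_le.mp (abs_sum_sub_sum_compl_le (J := J) e)
  rw [sum_sgn_eq] at h1
  have h2 : (Jᶜ.card : ℝ) ≤ n := by
    have : Jᶜ.card ≤ n := by simpa using Finset.card_le_univ Jᶜ
    exact_mod_cast this
  have h3 : σ₁ * Jᶜ.card ≤ ∑ i ∈ Jᶜ, sgn (e i) := by
    have := mul_le_mul_of_nonneg_left h2 h0.le
    have := hc.bias_le
    linarith [h1.2]
  have h4 := pow_mul_krawtchouk_le (sgn_signs_sq e) h3 h0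
    (hc.t_le_σ₁.trans (mul_le_mul_of_nonneg_left (card_compl_ge hJ) (by positivity)))
    (hc.two_t_le_compl hJ) (k := 0) (a := t) (by omega)
  simpa [krawtchouk_zero] using h4

/-- Outside J, v is either nearly balanced, where the mean is below the error term, or biased, where
the ratio bound lowers the degree from t at a cost of (2/s₂) per step. The error term added inside
the bracket keeps it nonnegative. -/
theorem abs_fiberMean_le {A : BitVec2 n} (v : BitVec2 n) (hA : 2 * hammingNorm A ≤ t) :
    |fiberMean J t A v| ≤ (2 / s₂) ^ hammingNorm A * (fiberMean J t 0 v + (4 * s₂) ^ (t / 2)) +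
      (4 * s₂) ^ (t / 2) := by
  have h0 := hc.s₂_pos
  have hτ : 0 ≤ (4 * s₂) ^ (t / 2) := by positivity
  have h1 := hc.neg_le_fiberMean_zero hJ v
  have hM : 0 < (2 / s₂) ^ hammingNorm A := by positivity
  have hnn : 0 ≤ (2 / s₂) ^ hammingNorm A * (fiberMean J t 0 v + (4 * s₂) ^ (t / 2)) :=
    mul_nonneg hM.le (by linarith)
  rcases le_total |∑ i ∈ Jᶜ, sgn (v i)| (s₂ * Jᶜ.card) with h | h
  · have := hc.abs_fiberMean_le_of_sum_le hJ hA h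
    linarith
  · have key : ∀ x : Fin n → ℝ, (∀ i, x i ^ 2 = 1) → s₂ * Jᶜ.card ≤ ∑ i ∈ Jᶜ, x i →
        |krawtchouk Jᶜ x (t - hammingNorm A)| ≤
          (2 / s₂) ^ hammingNorm A * krawtchouk Jᶜ x t := by
      intro x hx hs
      have h2 := pow_mul_krawtchouk_le hx hs h0 (hc.t_le_s₂_compl hJ)
        (hc.two_t_le_compl hJ) (k := t - hammingNorm A) (a := hammingNorm A) (by omega)
      have h3 := krawtchouk_pos hx hs h0 (hc.t_le_s₂_compl hJ)
        (hc.two_t_le_compl hJ) (k := t - hammingNorm A) (Nat.sub_le _ _)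
      rw [Nat.sub_add_cancel (by omega)] at h2
      rw [abs_of_pos h3]
      have h4 : (2 / s₂) ^ hammingNorm A * ((s₂ / 2) ^ hammingNorm A *
          krawtchouk Jᶜ x (t - hammingNorm A)) = krawtchouk Jᶜ x (t - hammingNorm A) := by
        rw [← mul_assoc, ← mul_pow]
        have : 2 / s₂ * (s₂ / 2) = 1 := by field_simp
        rw [this, one_pow, one_mul]
      rw [← h4]
      gcongr
    have key2 : |fiberMean J t A v| ≤ (2 / s₂) ^ hammingNorm A * fiberMean J t 0 v := by
      rw [abs_fiberMean, fiberMean_zero]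
      rcases le_abs.mp h with h | h
      · exact key _ (sgn_signs_sq v) h
      · have := key (fun i => -sgn (v i)) (fun i => by simpa using sgn_sq (v i))
          (by rwa [Finset.sum_neg_distrib])
        rwa [krawtchouk_neg, krawtchouk_neg, hc.even.neg_one_pow, one_mul, abs_mul, abs_pow,
          abs_neg, abs_one, one_pow, one_mul] at this
    nlinarith [mul_nonneg hM.le hτ]

-- Outside J, such a v either preserves all signs of e or flips all of them, and the degree t is
-- even.
omit hJ in
theorem fiberMean_zero_add {v : BitVec2 n} (hv : v ∈ constOff J) (e : BitVec2 n) :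
    fiberMean J t 0 (v + e) = fiberMean J t 0 e := by
  obtain ⟨c, hcv⟩ := hv
  rw [fiberMean_zero, fiberMean_zero]
  rcases zmod_two_eq c with rfl | rfl
  · refine krawtchouk_congr (fun i hi => ?_) t
    rw [Pi.add_apply, hcv i (by simpa using hi), zero_add]
  · rw [krawtchouk_congr (y := fun i => -sgn (e i)), krawtchouk_neg, hc.even.neg_one_pow, one_mul]
    intro i hi
    rw [Pi.add_apply, hcv i (by simpa using hi), sgn_add, sgn_one, neg_one_mul]

end CountingConditions

end RowMean

/-! ### Exponential moment of one row annihilating a fixed matrix -/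

theorem exp_neg_mul_sgn (l : ℝ) (a : ZMod 2) :
    Real.exp (-(l * sgn a)) = Real.cosh l - Real.sinh l * sgn a := by
  rcases zmod_two_eq a with rfl | rfl
  · rw [sgn_zero, mul_one, mul_one, Real.cosh_sub_sinh]
  · rw [sgn_one, mul_neg_one, neg_neg, mul_neg_one, sub_neg_eq_add, Real.cosh_add_sinh]

theorem cosh_le_one_add_sq {l : ℝ} (h0 : 0 ≤ l) (h1 : l ≤ 1) : Real.cosh l ≤ 1 + l ^ 2 := by
  have h := Real.abs_exp_sub_one_le (x := l ^ 2 / 2) (by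
    rw [abs_of_nonneg (by positivity)]
    nlinarith)
  rw [abs_of_nonneg (by positivity : 0 ≤ l ^ 2 / 2)] at h
  have := (abs_le.mp h).2
  linarith [Real.cosh_le_exp_half_sq l]

theorem sinh_le_two_mul {l : ℝ} (h0 : 0 ≤ l) (h1 : l ≤ 1) : Real.sinh l ≤ 2 * l := by
  have h := (abs_le.mp (Real.abs_exp_sub_one_le (x := l) (by rwa [abs_of_nonneg h0]))).2
  rw [abs_of_nonneg h0] at h
  have h2 := Real.add_one_le_exp (-l)
  rw [Real.sinh_eq]
  linarith

/-- The bound on the exponential weight of a row whose exceptional part has weight `a`. -/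
noncomputable def rowFactor (θ s₂ : ℝ) (t d a : ℕ) : ℝ :=
  if a = 0 then 1 - 7 / 8 * θ
  else if 2 * a ≤ t then 1 + θ / 8 + 4 * θ * (2 / s₂) ^ a
  else 4 * 2 ^ d

theorem dotProduct_mulVec_eq_zero_iff {n d : ℕ} (h : BitVec2 n)
    (G : Matrix (Fin n) (Fin d) (ZMod 2)) :
    (∀ u, dotProduct h (G.mulVec u) = 0) ↔ Matrix.vecMul h G = 0 := by
  simp only [Matrix.dotProduct_mulVec]
  refine ⟨fun H => ?_, fun H u => by rw [H, zero_dotProduct]⟩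
  ext i
  simpa using H (Pi.single i 1)

-- Fourier expansion of the constraint on a row: annihilating every column is an average of
-- characters over all combinations of columns.
open Classical in
theorem ite_forall_dotProduct_eq {n d : ℕ} (h : BitVec2 n) (G : Matrix (Fin n) (Fin d) (ZMod 2)) :
    (if ∀ u, dotProduct h (G.mulVec u) = 0 then (1 : ℝ) else 0) =
      (2 ^ d)⁻¹ * ∑ u, sgn (dotProduct h (G.mulVec u)) := by
  rw [if_congr (dotProduct_mulVec_eq_zero_iff h G) rfl rfl]
  simp only [Matrix.dotProduct_mulVec, sum_sgn_dotProduct]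
  split_ifs <;> simp

theorem card_coeffsIn {n d : ℕ} (C : Submodule (ZMod 2) (BitVec2 n))
    (G : Matrix (Fin n) (Fin d) (ZMod 2)) :
    Nat.card (coeffsIn C G) = 2 ^ Module.finrank (ZMod 2) (coeffsIn C G) := by
  rw [Module.natCard_eq_pow_finrank (K := ZMod 2)]
  simp

section Row

variable {n t d : ℕ} {j σ α s₂ σ₁ x₀ ζ : ℝ} {J : Finset (Fin n)}

/-- Every combination of columns is constant outside `J` or balanced. -/
def Structured (J : Finset (Fin n)) (σ : ℝ) (G : Matrix (Fin n) (Fin d) (ZMod 2)) : Prop :=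
  ∀ u, G.mulVec u ∈ constOff J ∨ |∑ i, sgn (G.mulVec u i)| ≤ σ * n

/-- The mean bias of the shifts of `e` by the combinations of columns. -/
noncomputable def shiftBias (J : Finset (Fin n)) (t : ℕ) (G : Matrix (Fin n) (Fin d) (ZMod 2))
    (e : BitVec2 n) : ℝ :=
  (2 ^ Module.finrank (ZMod 2) (coeffsIn (constOff J) G))⁻¹ *
    ∑ u, fiberMean J t 0 (G.mulVec u + e)

open Classical in
theorem card_filter_coeffsIn (C : Submodule (ZMod 2) (BitVec2 n))
    (G : Matrix (Fin n) (Fin d) (ZMod 2)) :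
    ((Finset.univ.filter fun u => u ∈ coeffsIn C G).card : ℝ) =
      2 ^ Module.finrank (ZMod 2) (coeffsIn C G) := by
  have h := card_coeffsIn C G
  rw [Nat.card_eq_fintype_card, Fintype.card_subtype] at h
  exact_mod_cast h

-- The character average replaces the constraint, and the exponential of a sign is linear in it. The
-- constrained moment thus becomes two sums of fiber means, one without and one with the shift by e.
open Classical in
theorem sum_fiber_exp_eq {A : BitVec2 n} (hpA : part J A = A) (hwA : hammingNorm A ≤ t)
    (G : Matrix (Fin n) (Fin d) (ZMod 2)) (e : BitVec2 n) (l : ℝ) :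
    ∑ h ∈ (fiber J t A).filter (fun h => ∀ u, dotProduct h (G.mulVec u) = 0),
      Real.exp (-(l * sgn (dotProduct h e))) = (fiber J t A).card / 2 ^ d *
        (Real.cosh l * ∑ u, fiberMean J t A (G.mulVec u) -
          Real.sinh l * ∑ u, fiberMean J t A (G.mulVec u + e)) := by
  have e1 : ∀ u, ((fiber J t A).card : ℝ) * fiberMean J t A (G.mulVec u) =
      ∑ h ∈ fiber J t A, sgn (dotProduct h (G.mulVec u)) :=
    fun u => (sum_fiber_sgn J hpA hwA _).symm
  have e2 : ∀ u, ((fiber J t A).card : ℝ) * fiberMean J t A (G.mulVec u + e) =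
      ∑ h ∈ fiber J t A, sgn (dotProduct h (G.mulVec u)) * sgn (dotProduct h e) := by
    intro u
    rw [← sum_fiber_sgn J hpA hwA]
    exact Finset.sum_congr rfl fun h _ => by rw [dotProduct_add, sgn_add]
  rw [Finset.sum_filter]
  have e3 : ∀ h, (if ∀ u, dotProduct h (G.mulVec u) = 0 then
      Real.exp (-(l * sgn (dotProduct h e))) else 0) =
      (2 ^ d)⁻¹ * ∑ u, (Real.cosh l * sgn (dotProduct h (G.mulVec u)) -
        Real.sinh l * (sgn (dotProduct h (G.mulVec u)) * sgn (dotProduct h e))) := by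
    intro h
    rw [Finset.sum_sub_distrib, ← Finset.mul_sum, ← Finset.mul_sum, ← Finset.sum_mul,
      ← mul_one (Real.exp _), ← mul_ite_zero, ite_forall_dotProduct_eq, exp_neg_mul_sgn]
    ring
  simp_rw [e3]
  rw [← Finset.mul_sum, Finset.sum_comm]
  simp_rw [Finset.sum_sub_distrib, ← Finset.mul_sum, ← e1, ← e2]
  rw [← Finset.mul_sum, ← Finset.mul_sum]
  ring

namespace CountingConditions

variable (hc : CountingConditions n t d j σ α s₂ σ₁ x₀ ζ) (hJ : (J.card : ℝ) ≤ j)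
include hc

theorem error_le' : 2 ^ d * (4 * s₂) ^ (t / 2) ≤ biasBound σ₁ t ^ 2 / 16 / 64 := by
  have := hc.error_le
  linarith

theorem bias_pos : 0 < biasBound σ₁ t := biasBound_pos hc.σ₁_pos t

theorem bias_le_half : biasBound σ₁ t ≤ 1 / 2 := biasBound_le hc.σ₁_pos hc.σ₁_le t

include hJ

/-- Of the 2^d shifts, the 2^m by vectors constant outside J keep the full bias 2b and the others
lose at most τ each. Since 2^d τ is negligible, normalization by 2^m rather than 2^d leaves at least
b. -/
theorem le_shiftBias {G : Matrix (Fin n) (Fin d) (ZMod 2)} {e : BitVec2 n}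
    (he : (hammingNorm e : ℝ) ≤ α * n) : biasBound σ₁ t ≤ shiftBias J t G e := by
  classical
  have hb := hc.bias_pos
  have hb1 := hc.bias_le_half
  have hE := hc.error_le
  have h0 := hc.s₂_pos
  set τ := (4 * s₂) ^ (t / 2) with hτ
  have hτ0 : 0 ≤ τ := by positivity
  set m := Module.finrank (ZMod 2) (coeffsIn (constOff J) G)
  have hm : (1 : ℝ) ≤ 2 ^ m := one_le_pow₀ (by norm_num)
  rw [shiftBias, inv_mul_eq_div, le_div_iff₀ (by positivity)]
  have hlow : ∀ u : BitVec2 d, (if u ∈ coeffsIn (constOff J) G then 2 * biasBound σ₁ t else 0) - τ ≤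
      fiberMean J t 0 (G.mulVec u + e) := by
    intro u
    split_ifs with hu
    · rw [hc.fiberMean_zero_add (mem_coeffsIn.mp hu)]
      linarith [hc.le_fiberMean_zero hJ he]
    · linarith [hc.neg_le_fiberMean_zero hJ (G.mulVec u + e)]
  have hs := Finset.sum_le_sum fun u (_ : u ∈ Finset.univ) => hlow u
  rw [Finset.sum_sub_distrib, ← Finset.sum_filter, Finset.sum_const, Finset.sum_const,
    nsmul_eq_mul, nsmul_eq_mul, card_filter_coeffsIn] at hs
  simp only [Finset.card_univ, Fintype.card_fun, ZMod.card, Fintype.card_fin] at hs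
  push_cast at hs
  have h3 : 2 ^ d * τ ≤ biasBound σ₁ t := by nlinarith
  have h4 : biasBound σ₁ t * 1 ≤ biasBound σ₁ t * 2 ^ m := by gcongr
  change _ * 2 ^ m ≤ _
  linarith

set_option maxHeartbeats 1000000 in
open Classical in
/-- The exponential weight of the rows with exceptional part `A` that annihilate the columns of
`G`. -/
theorem sum_fiber_exp_le {G : Matrix (Fin n) (Fin d) (ZMod 2)} (hG : Structured J σ G)
    {e : BitVec2 n} (he : (hammingNorm e : ℝ) ≤ α * n) (A : BitVec2 n)
    (hA : ∀ u ∈ coeffsIn (constOff J) G, ∀ h ∈ fiber J t A, dotProduct h (G.mulVec u) = 0) :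
    ∑ h ∈ (fiber J t A).filter (fun h => ∀ u, dotProduct h (G.mulVec u) = 0),
      Real.exp (-(biasBound σ₁ t ^ 2 / 16 / shiftBias J t G e * sgn (dotProduct h e))) ≤
    (fiber J t A).card * (2 ^ Module.finrank (ZMod 2) (coeffsIn (constOff J) G) / 2 ^ d) *
      rowFactor (biasBound σ₁ t ^ 2 / 16) s₂ t d (hammingNorm A) := by
  have hb := hc.bias_pos
  have hb1 := hc.bias_le_half
  have hE := hc.error_le'
  have h0 := hc.s₂_pos
  have hK := hc.le_shiftBias hJ (G := G) he
  have hS : ∑ u, fiberMean J t 0 (G.mulVec u + e) =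
      2 ^ Module.finrank (ZMod 2) (coeffsIn (constOff J) G) * shiftBias J t G e := by
    rw [shiftBias, ← mul_assoc, mul_inv_cancel₀ (by positivity), one_mul]
  set m := Module.finrank (ZMod 2) (coeffsIn (constOff J) G) with hmdef
  set K := shiftBias J t G e
  set b := biasBound σ₁ t
  set θ := b ^ 2 / 16 with hθ
  set τ := (4 * s₂) ^ (t / 2) with hτ
  have hτ0 : 0 ≤ τ := by positivity
  have hθ0 : 0 < θ := by positivity
  have hm : (1 : ℝ) ≤ 2 ^ m := one_le_pow₀ (by norm_num)
  have hK0 : 0 < K := lt_of_lt_of_le hb hK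
  -- The tilt adapts to G and e so that the linear gain l K equals θ, the same for all of them. As K
  -- ≥ b, also l ≤ b/16, and the quadratic loss l² is at most θ/16.
  set l := θ / K with hl
  have hl0 : 0 ≤ l := by positivity
  have hlK : l * K = θ := by rw [hl]; field_simp
  have hlb : l ≤ b / 16 := by
    rw [hl, div_le_iff₀ hK0, hθ]
    nlinarith
  have hl1 : l ≤ 1 := by linarith
  have hl2 : l ^ 2 ≤ θ / 16 := by
    rw [hθ]
    nlinarith
  rcases (fiber J t A).eq_empty_or_nonempty with hF | ⟨h₀, hh₀⟩
  · simp [hF]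
  have hpA : part J A = A := by
    rw [← (mem_fiber.mp hh₀).2, part_part]
  have hwA : hammingNorm A ≤ t := by
    rw [← (mem_fiber.mp hh₀).2, ← (mem_fiber.mp hh₀).1]
    exact hammingNorm_part_le _ _
  have hC : (0 : ℝ) < (fiber J t A).card := by
    exact_mod_cast Finset.card_pos.mpr ⟨h₀, hh₀⟩
  -- When most of the row lies in J no Krawtchouk decay is available. The trivial bound by exp 1 <
  -- 4, without any use of the constraint, suffices because such rows are very rare.
  by_cases h2A : 2 * hammingNorm A ≤ t
  swap
  · have hF : rowFactor θ s₂ t d (hammingNorm A) = 4 * 2 ^ d := by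
      rw [rowFactor, if_neg (by omega), if_neg h2A]
    rw [hF]
    calc _ ≤ ∑ h ∈ (fiber J t A).filter (fun h => ∀ u, dotProduct h (G.mulVec u) = 0), (4 : ℝ) := by
          refine Finset.sum_le_sum fun h _ => ?_
          have : -(l * sgn (dotProduct h e)) ≤ 1 := by
            have h1 := abs_sgn (dotProduct h e)
            have h2 := (abs_le.mp h1.le).1
            nlinarith
          have h3 := Real.exp_le_exp.mpr this
          have := Real.exp_one_lt_d9
          linarith
      _ ≤ (fiber J t A).card * 4 := by
          rw [Finset.sum_const, nsmul_eq_mul]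
          gcongr
          exact Finset.filter_subset _ _
      _ ≤ (fiber J t A).card * 4 * 2 ^ m := le_mul_of_one_le_right (by positivity) hm
      _ = _ := by field_simp
  rw [sum_fiber_exp_eq hpA hwA G e l]
  -- The vectors constant outside J are annihilated by the whole fiber and contribute 1 each; the
  -- others are balanced and contribute at most 2^d τ ≤ θ/64 together.
  have hsum1 : ∑ u, fiberMean J t A (G.mulVec u) ≤ 2 ^ m * (1 + θ / 64) := by
    have hup : ∀ u : BitVec2 d, fiberMean J t A (G.mulVec u) ≤
        (if u ∈ coeffsIn (constOff J) G then 1 else 0) + τ := by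
      intro u
      split_ifs with hu
      · have h1 := sum_fiber_sgn J hpA hwA (G.mulVec u)
        rw [Finset.sum_congr rfl fun h hh => by rw [hA u hu h hh, sgn_zero], Finset.sum_const,
          nsmul_eq_mul] at h1
        rw [← mul_left_cancel₀ hC.ne' h1]
        linarith
      · have := (abs_le.mp (hc.abs_fiberMean_le_of_balanced hJ h2A ((hG u).resolve_left hu))).2
        linarith
    have hs := Finset.sum_le_sum fun u (_ : u ∈ Finset.univ) => hup u
    rw [Finset.sum_add_distrib, ← Finset.sum_filter, Finset.sum_const, Finset.sum_const,
      nsmul_eq_mul, nsmul_eq_mul, card_filter_coeffsIn] at hs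
    simp only [Finset.card_univ, Fintype.card_fun, ZMod.card, Fintype.card_fin] at hs
    push_cast at hs
    change _ ≤ 2 ^ m * 1 + _ at hs
    nlinarith
  have hch := cosh_le_one_add_sq hl0 hl1
  have hsh := sinh_le_two_mul hl0 hl1
  have hsh' : l ≤ Real.sinh l := Real.self_le_sinh_iff.mpr hl0
  have hθ1 : θ ≤ 1 := by rw [hθ]; nlinarith
  have hcosh : Real.cosh l * ∑ u, fiberMean J t A (G.mulVec u) ≤ 2 ^ m * (1 + θ / 8) := by
    calc _ ≤ Real.cosh l * (2 ^ m * (1 + θ / 64)) := by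
          have := Real.cosh_pos l
          gcongr
      _ ≤ (1 + θ / 16) * (2 ^ m * (1 + θ / 64)) := by
          gcongr
          linarith
      _ = 2 ^ m * ((1 + θ / 16) * (1 + θ / 64)) := by ring
      _ ≤ _ := by
          gcongr
          nlinarith
  have hgoal : Real.cosh l * ∑ u, fiberMean J t A (G.mulVec u) -
      Real.sinh l * ∑ u, fiberMean J t A (G.mulVec u + e) ≤
        2 ^ m * rowFactor θ s₂ t d (hammingNorm A) := by
    -- With empty exceptional part the sinh term gains 2^m θ. Otherwise the sign of the bias is not
    -- controlled, and the term can only be bounded in absolute value.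
    by_cases hA0 : A = 0
    · subst hA0
      rw [hS, rowFactor, if_pos hammingNorm_zero]
      have : l * (2 ^ m * K) ≤ Real.sinh l * (2 ^ m * K) := by gcongr
      have : l * (2 ^ m * K) = 2 ^ m * θ := by rw [← hlK]; ring
      linarith
    · rw [rowFactor, if_neg (by rwa [hammingNorm_eq_zero]), if_pos h2A]
      set M := (2 / s₂) ^ hammingNorm A with hM
      have hM1 : 1 ≤ M := by
        refine one_le_pow₀ ?_
        rw [le_div_iff₀ h0]
        linarith [hc.s₂_le]
      have h1 : |∑ u, fiberMean J t A (G.mulVec u + e)| ≤ 2 * M * (2 ^ m * K) := by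
        refine (Finset.abs_sum_le_sum_abs _ _).trans ?_
        refine (Finset.sum_le_sum fun u _ => hc.abs_fiberMean_le hJ (G.mulVec u + e) h2A).trans ?_
        rw [Finset.sum_add_distrib, ← Finset.mul_sum, Finset.sum_add_distrib, hS, Finset.sum_const,
          nsmul_eq_mul]
        simp only [Finset.card_univ, Fintype.card_fun, ZMod.card, Fintype.card_fin]
        push_cast
        have h3 : 2 * (2 ^ d * τ) ≤ 2 ^ m * K := by
          have : 1 * K ≤ 2 ^ m * K := by gcongr
          nlinarith
        have h4 : 1 * (2 ^ d * τ) ≤ M * (2 ^ d * τ) := by gcongr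
        have h5 : M * (2 * (2 ^ d * τ)) ≤ M * (2 ^ m * K) := by gcongr
        linarith
      have h2 : -(Real.sinh l * ∑ u, fiberMean J t A (G.mulVec u + e)) ≤
          2 * l * (2 * M * (2 ^ m * K)) := by
        calc _ ≤ |Real.sinh l * ∑ u, fiberMean J t A (G.mulVec u + e)| := neg_le_abs _
          _ = Real.sinh l * |∑ u, fiberMean J t A (G.mulVec u + e)| := by
              rw [abs_mul, abs_of_nonneg (hl0.trans hsh')]
          _ ≤ _ := by gcongr
      have h3 : 2 * l * (2 * M * (2 ^ m * K)) = 2 ^ m * (4 * θ * M) := by rw [← hlK]; ring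
      linarith
  calc _ ≤ ((fiber J t A).card : ℝ) / 2 ^ d * (2 ^ m * rowFactor θ s₂ t d (hammingNorm A)) := by
        gcongr
    _ = _ := by ring

end CountingConditions

end Row

/-- Outside J the product is c times the parity of t minus the weight of A, the same for the whole
fiber. Whether a row annihilates such a v is thus decided by its exceptional part. -/
theorem dotProduct_eq_of_mem_constOff {n t : ℕ} {J : Finset (Fin n)} {v : BitVec2 n}
    (hv : v ∈ constOff J) {A h h' : BitVec2 n} (hh : h ∈ fiber J t A) (hh' : h' ∈ fiber J t A) :
    dotProduct h v = dotProduct h' v := by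
  obtain ⟨c, hc⟩ := hv
  have key : ∀ g ∈ fiber J t A, dotProduct g v =
      dotProduct A v + ((t - hammingNorm A : ℕ) : ZMod 2) * c := by
    intro g hg
    obtain ⟨h1, h2⟩ := mem_fiber.mp hg
    have h3 := hammingNorm_part_add J g
    rw [h1, h2] at h3
    have h4 : t - hammingNorm A = (Jᶜ.filter fun i => g i ≠ 0).card := by omega
    rw [h4, Finset.card_filter, Nat.cast_sum, Finset.sum_mul, ← h2, dotProduct, dotProduct,
      ← Finset.sum_add_sum_compl J, ← Finset.sum_add_sum_compl J (fun i => part J g i * v i)]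
    have h5 : ∑ i ∈ Jᶜ, part J g i * v i = 0 := by
      refine Finset.sum_eq_zero fun i hi => ?_
      simp [part, Finset.mem_compl.mp hi]
    rw [h5, add_zero]
    congr 1
    · refine Finset.sum_congr rfl fun i hi => ?_
      simp [part, hi]
    · refine Finset.sum_congr rfl fun i hi => ?_
      rw [hc i (Finset.mem_compl.mp hi)]
      rcases zmod_two_eq (g i) with h0 | h0 <;> simp [h0]
  rw [key h hh, key h' hh']

/-! ### Counting rows and structured matrices together -/

section Count

variable {n t d : ℕ} {j σ α s₂ σ₁ x₀ ζ : ℝ} {J : Finset (Fin n)}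

/-- A single expression, exponential in a, that covers all three cases and can be averaged with
`sum_pow_part_le`. For 2a > t the factor x₀^(t/2 - a) is at least one, a Chernoff weight. -/
theorem rowFactor_le {θ : ℝ} (hθ0 : 0 ≤ θ) (hθ1 : θ ≤ 1) (hs₂ : 0 < s₂) (hs₂' : 4 * s₂ ≤ 1)
    (hx₀ : 0 < x₀) (hx₀' : x₀ ≤ 1) (a : ℕ) :
    rowFactor θ s₂ t d a ≤ 1 - 7 / 8 * θ + 10 * θ * ((2 / s₂) ^ a - 1) +
      4 * 2 ^ d * x₀ ^ (t / 2) * x₀⁻¹ ^ a := by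
  have hM : 8 ≤ 2 / s₂ := by
    rw [le_div_iff₀ hs₂]
    linarith
  have hpos : 0 ≤ 4 * 2 ^ d * x₀ ^ (t / 2) * x₀⁻¹ ^ a := by positivity
  rw [rowFactor]
  split_ifs with h0 h1
  · subst h0
    simp only [pow_zero, sub_self, mul_zero, add_zero] at *
    linarith
  · have : 8 ≤ (2 / s₂) ^ a := hM.trans (le_self_pow₀ (by linarith) h0)
    nlinarith
  · have h2 : 1 ≤ x₀ ^ (t / 2) * x₀⁻¹ ^ a := by
      obtain ⟨c, rfl⟩ : ∃ c, a = t / 2 + c := ⟨a - t / 2, by omega⟩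
      rw [pow_add, ← mul_assoc, ← mul_pow, mul_inv_cancel₀ hx₀.ne', one_pow, one_mul]
      exact one_le_pow₀ ((one_le_inv₀ hx₀).mpr hx₀')
    have h3 : 1 ≤ (2 / s₂) ^ a := one_le_pow₀ (by linarith)
    have h4 : (4 * 2 ^ d : ℝ) * 1 ≤ 4 * 2 ^ d * (x₀ ^ (t / 2) * x₀⁻¹ ^ a) := by gcongr
    have h5 : 0 ≤ 10 * θ * ((2 / s₂) ^ a - 1) := mul_nonneg (by linarith) (by linarith)
    linarith

namespace CountingConditions

variable (hc : CountingConditions n t d j σ α s₂ σ₁ x₀ ζ) (hJ : (J.card : ℝ) ≤ j)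
include hc hJ

/-- A random row has on average at most x₀ ones in J. Rows with a small part there and rows with a
large part there each cost at most θ/8 of the gain 7θ/8, leaving more than θ/2. -/
theorem sum_rowFactor_le :
    ∑ h ∈ sparse n t, rowFactor (biasBound σ₁ t ^ 2 / 16) s₂ t d (hammingNorm (part J h)) ≤
      n.choose t * (1 - biasBound σ₁ t ^ 2 / 16 / 2) := by
  have hb := hc.bias_pos
  have hb1 := hc.bias_le_half
  have hs := hc.s₂_pos
  have hx := hc.x₀_pos
  have htail := hc.tail_le
  set b := biasBound σ₁ t
  set θ := b ^ 2 / 16 with hθ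
  have hθ0 : 0 < θ := by positivity
  have hθ1 : θ ≤ 1 := by rw [hθ]; nlinarith
  have hM : 8 ≤ 2 / s₂ := by
    rw [le_div_iff₀ hs]
    linarith [hc.s₂_le]
  have hn : (0 : ℝ) < n := by exact_mod_cast hc.n_pos
  have hxJ : (t : ℝ) * J.card / n ≤ x₀ := by
    rw [div_le_iff₀ hn]
    exact (mul_le_mul_of_nonneg_left hJ (Nat.cast_nonneg _)).trans hc.tj_le
  have hxJ0 : 0 ≤ (t : ℝ) * J.card / n := by positivity
  have hy : 1 ≤ x₀⁻¹ := (one_le_inv₀ hx).mpr hc.x₀_le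
  have m1 := sum_pow_part_le hc.t_le hc.n_pos J (y := 2 / s₂) (by linarith)
  have m2 := sum_pow_part_le hc.t_le hc.n_pos J hy
  have e1 : Real.exp ((2 / s₂ - 1) * (t * J.card / n)) ≤ Real.exp (2 / s₂ * x₀) := by
    apply Real.exp_le_exp.mpr
    nlinarith
  have e2 : Real.exp ((x₀⁻¹ - 1) * (t * J.card / n)) ≤ Real.exp 1 := by
    apply Real.exp_le_exp.mpr
    calc _ ≤ x₀⁻¹ * x₀ := by
          gcongr
          linarith
      _ = 1 := inv_mul_cancel₀ hx.ne'
  have hexp := hc.exp_le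
  have hC : (0 : ℝ) ≤ n.choose t := Nat.cast_nonneg _
  have hcardS : ((sparse n t).card : ℝ) = n.choose t := by rw [card_sparse]
  calc _ ≤ ∑ h ∈ sparse n t, (1 - 7 / 8 * θ +
        10 * θ * ((2 / s₂) ^ hammingNorm (part J h) - 1) +
        4 * 2 ^ d * x₀ ^ (t / 2) * x₀⁻¹ ^ hammingNorm (part J h)) :=
        Finset.sum_le_sum fun h _ => rowFactor_le hθ0.le hθ1 hs hc.s₂_le hx hc.x₀_le _
    _ = n.choose t * (1 - 7 / 8 * θ - 10 * θ) +
        10 * θ * ∑ h ∈ sparse n t, (2 / s₂) ^ hammingNorm (part J h) +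
        4 * 2 ^ d * x₀ ^ (t / 2) * ∑ h ∈ sparse n t, x₀⁻¹ ^ hammingNorm (part J h) := by
        rw [Finset.mul_sum, Finset.mul_sum, ← hcardS, ← nsmul_eq_mul, ← Finset.sum_const,
          ← Finset.sum_add_distrib, ← Finset.sum_add_distrib]
        refine Finset.sum_congr rfl fun h _ => ?_
        ring
    _ ≤ n.choose t * (1 - 7 / 8 * θ - 10 * θ) +
        10 * θ * (n.choose t * Real.exp (2 / s₂ * x₀)) +
        4 * 2 ^ d * x₀ ^ (t / 2) * (n.choose t * Real.exp 1) := by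
        gcongr
        · exact m1.trans (by gcongr)
        · exact m2.trans (by gcongr)
    _ = n.choose t * (1 - 7 / 8 * θ + θ * (10 * (Real.exp (2 / s₂ * x₀) - 1)) +
        4 * 2 ^ d * (Real.exp 1 * x₀ ^ (t / 2))) := by ring
    _ ≤ n.choose t * (1 - 7 / 8 * θ + θ * (1 / 8) + θ / 8) := by
        have : b ^ 2 / 128 = θ / 8 := by rw [hθ]; ring
        gcongr
        linarith
    _ ≤ _ := by
        gcongr
        linarith

variable {ι : Type*} [Fintype ι] [DecidableEq ι]

/-- The subspace of `V` on which the rows with exceptional parts `A` vanish, among the vectors that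
are constant outside `J`. -/
def visibleKernel (V : Submodule (ZMod 2) (BitVec2 n)) (J : Finset (Fin n)) (t : ℕ)
    (A : ι → BitVec2 n) : Submodule (ZMod 2) (BitVec2 n) :=
  V ⊓ constOff J ⊓ kerRows fun p : {p : ι × BitVec2 n // p.2 ∈ fiber J t (A p.1)} => p.1.2

omit hc hJ [Fintype ι] [DecidableEq ι] in
theorem mem_visibleKernel {V : Submodule (ZMod 2) (BitVec2 n)} {A : ι → BitVec2 n}
    {v : BitVec2 n} : v ∈ visibleKernel V J t A ↔
      (v ∈ V ∧ v ∈ constOff J) ∧ ∀ i, ∀ h ∈ fiber J t (A i), dotProduct h v = 0 := by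
  rw [visibleKernel, Submodule.mem_inf, Submodule.mem_inf, mem_kerRows]
  refine and_congr_right fun _ => ⟨fun H i h hh => H ⟨(i, h), hh⟩, fun H p => H _ _ p.2⟩

-- Of the d factors |V ∩ ker H|, m are bounded below by the visible kernel and d - m by |V|/2^r. The
-- resulting loss 2^(r(d - m)) cancels against the probability 2^(m - d) per row of annihilating the
-- balanced combinations.
omit hc hJ [DecidableEq ι] in
theorem inv_card_pow_le (V : Submodule (ZMod 2) (BitVec2 n)) {A H : ι → BitVec2 n}
    (hH : ∀ i, H i ∈ fiber J t (A i)) {m : ℕ} (hm : m ≤ d) :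
    ((Nat.card ↥(V ⊓ kerRows H) : ℝ) ^ d)⁻¹ ≤ (2 ^ Fintype.card ι) ^ (d - m) *
      ((Nat.card ↥(visibleKernel V J t A) : ℝ) ^ m * (Nat.card V : ℝ) ^ (d - m))⁻¹ := by
  have h1 : (0 : ℝ) < Nat.card ↥(visibleKernel V J t A) := by exact_mod_cast nat_card_pos _
  have h2 : (0 : ℝ) < Nat.card V := by exact_mod_cast nat_card_pos _
  have h3 : (0 : ℝ) < Nat.card ↥(V ⊓ kerRows H) := by exact_mod_cast nat_card_pos _
  have h4 : (Nat.card ↥(visibleKernel V J t A) : ℝ) ≤ Nat.card ↥(V ⊓ kerRows H) := by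
    have hle : visibleKernel V J t A ≤ V ⊓ kerRows H := by
      intro v hv
      obtain ⟨⟨hv1, -⟩, hv2⟩ := mem_visibleKernel.mp hv
      exact ⟨hv1, fun i => hv2 i _ (hH i)⟩
    exact_mod_cast Nat.card_le_card_of_injective _ (Submodule.inclusion_injective hle)
  have h5 : (Nat.card V : ℝ) ≤ Nat.card ↥(V ⊓ kerRows H) * 2 ^ Fintype.card ι := by
    exact_mod_cast card_le_card_inf_kerRows_mul H V
  rw [← div_eq_mul_inv, le_div_iff₀ (by positivity), inv_mul_le_iff₀ (by positivity)]
  calc _ ≤ (Nat.card ↥(V ⊓ kerRows H) : ℝ) ^ m *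
        (Nat.card ↥(V ⊓ kerRows H) * 2 ^ Fintype.card ι) ^ (d - m) := by gcongr
    _ = (Nat.card ↥(V ⊓ kerRows H) : ℝ) ^ (m + (d - m)) * (2 ^ Fintype.card ι) ^ (d - m) := by
        rw [mul_pow, pow_add]
        ring
    _ = _ := by rw [Nat.add_sub_cancel' hm]

-- From K ≥ b and 8ζ ≤ b, the slack costs at most θ/4 per row, half of the gain θ/2.
omit hJ in
theorem exp_slack_le {K : ℝ} (hK : biasBound σ₁ t ≤ K) (r : ℕ) :
    Real.exp (biasBound σ₁ t ^ 2 / 16 / K * (2 * ζ * r)) ≤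
      Real.exp (biasBound σ₁ t ^ 2 / 16 / 4 * r) := by
  have hb := hc.bias_pos
  have hs := hc.slack_le
  apply Real.exp_le_exp.mpr
  have h1 : biasBound σ₁ t ^ 2 / 16 / K * (2 * ζ) ≤ biasBound σ₁ t ^ 2 / 16 / 4 := by
    rw [div_mul_eq_mul_div, div_le_iff₀ (by linarith)]
    have : biasBound σ₁ t ^ 2 / 16 / 4 * biasBound σ₁ t ≤ biasBound σ₁ t ^ 2 / 16 / 4 * K := by
      gcongr
    nlinarith [sq_nonneg (biasBound σ₁ t)]
  calc _ = biasBound σ₁ t ^ 2 / 16 / K * (2 * ζ) * r := by ring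
    _ ≤ _ := by gcongr

open Classical in
/-- For a fixed structured matrix, the number of row tuples with given exceptional parts that
annihilate it and on which the error looks unbiased. -/
theorem card_bad_rows_le {A : ι → BitVec2 n} {G : Matrix (Fin n) (Fin d) (ZMod 2)}
    (hG : Structured J σ G) {e : BitVec2 n} (he : (hammingNorm e : ℝ) ≤ α * n)
    (hA : ∀ i, ∀ u ∈ coeffsIn (constOff J) G, ∀ h ∈ fiber J t (A i),
      dotProduct h (G.mulVec u) = 0) :
    (((Fintype.piFinset fun i => fiber J t (A i)).filter fun H =>
      (∀ i u, dotProduct (H i) (G.mulVec u) = 0) ∧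
        ∑ i, sgn (dotProduct (H i) e) ≤ 2 * ζ * Fintype.card ι).card : ℝ) ≤
      Real.exp (biasBound σ₁ t ^ 2 / 16 / 4 * Fintype.card ι) *
        ∏ i, ((fiber J t (A i)).card *
          (2 ^ Module.finrank (ZMod 2) (coeffsIn (constOff J) G) / 2 ^ d) *
          rowFactor (biasBound σ₁ t ^ 2 / 16) s₂ t d (hammingNorm (A i))) := by
  have hb := hc.bias_pos
  have hK := hc.le_shiftBias hJ (G := G) he
  set K := shiftBias J t G e
  have hK0 : 0 < K := hb.trans_le hK
  set l := biasBound σ₁ t ^ 2 / 16 / K with hl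
  have hl0 : 0 ≤ l := by positivity
  calc _ ≤ ∑ H ∈ (Fintype.piFinset fun i => fiber J t (A i)).filter fun H =>
      (∀ i u, dotProduct (H i) (G.mulVec u) = 0) ∧
        ∑ i, sgn (dotProduct (H i) e) ≤ 2 * ζ * Fintype.card ι,
        Real.exp (l * (2 * ζ * Fintype.card ι)) *
          ∏ i, Real.exp (-(l * sgn (dotProduct (H i) e))) := by
        -- Markov's inequality after tilting: for a bad tuple the summand is at least one.
        rw [Finset.card_eq_sum_ones, Nat.cast_sum]
        refine Finset.sum_le_sum fun H hH => ?_
        rw [← Real.exp_sum, ← Real.exp_add, Nat.cast_one, Finset.sum_neg_distrib, ← Finset.mul_sum]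
        apply Real.one_le_exp
        have := (Finset.mem_filter.mp hH).2.2
        nlinarith
    _ ≤ ∑ H ∈ Fintype.piFinset fun i =>
          (fiber J t (A i)).filter fun h => ∀ u, dotProduct h (G.mulVec u) = 0,
        Real.exp (l * (2 * ζ * Fintype.card ι)) *
          ∏ i, Real.exp (-(l * sgn (dotProduct (H i) e))) := by
        refine Finset.sum_le_sum_of_subset_of_nonneg ?_ fun _ _ _ => by positivity
        intro H hH
        obtain ⟨h1, h2, -⟩ := Finset.mem_filter.mp hH
        rw [Fintype.mem_piFinset] at h1 ⊢
        exact fun i => Finset.mem_filter.mpr ⟨h1 i, h2 i⟩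
    _ = Real.exp (l * (2 * ζ * Fintype.card ι)) *
        ∏ i, ∑ h ∈ (fiber J t (A i)).filter fun h => ∀ u, dotProduct h (G.mulVec u) = 0,
          Real.exp (-(l * sgn (dotProduct h e))) := by
        rw [← Finset.mul_sum, Finset.prod_univ_sum]
    _ ≤ _ := by
        refine mul_le_mul (hc.exp_slack_le hK _) ?_ ?_ (Real.exp_pos _).le
        · refine Finset.prod_le_prod (fun i _ => Finset.sum_nonneg fun _ _ => (Real.exp_pos _).le)
            fun i _ => ?_
          exact hc.sum_fiber_exp_le hJ hG he (A i) (hA i)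
        · exact Finset.prod_nonneg fun i _ => Finset.sum_nonneg fun _ _ => (Real.exp_pos _).le

omit hJ in
theorem rowFactor_nonneg (a : ℕ) : 0 ≤ rowFactor (biasBound σ₁ t ^ 2 / 16) s₂ t d a := by
  have hb := hc.bias_pos
  have hb1 := hc.bias_le_half
  have hs := hc.s₂_pos
  rw [rowFactor]
  split_ifs
  · nlinarith
  · positivity
  · positivity

open Classical in
/-- The counting bound for rows with fixed exceptional parts. -/
theorem sum_fixed_parts_le (V : Submodule (ZMod 2) (BitVec2 n))
    (f : Matrix (Fin n) (Fin d) (ZMod 2) → BitVec2 n)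
    (hf : ∀ G, (hammingNorm (f G) : ℝ) ≤ α * n) (A : ι → BitVec2 n) :
    ∑ H ∈ Fintype.piFinset fun i => fiber J t (A i),
      ((Nat.card ↥(V ⊓ kerRows H) : ℝ) ^ d)⁻¹ *
        ((matsIn (V ⊓ kerRows H) d).filter fun G => Structured J σ G ∧
          ∑ i, sgn (dotProduct (H i) (f G)) ≤ 2 * ζ * Fintype.card ι).card ≤
      2 ^ (d * d) * (Real.exp (biasBound σ₁ t ^ 2 / 16 / 4 * Fintype.card ι) *
        ∏ i, ((fiber J t (A i)).card *
          rowFactor (biasBound σ₁ t ^ 2 / 16) s₂ t d (hammingNorm (A i)))) := by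
  set Θ := Real.exp (biasBound σ₁ t ^ 2 / 16 / 4 * Fintype.card ι) *
        ∏ i, ((fiber J t (A i)).card *
          rowFactor (biasBound σ₁ t ^ 2 / 16) s₂ t d (hammingNorm (A i))) with hΘ
  have hΘ0 : 0 ≤ Θ := mul_nonneg (Real.exp_pos _).le
    (Finset.prod_nonneg fun i _ => mul_nonneg (Nat.cast_nonneg _) (hc.rowFactor_nonneg _))
  set W := visibleKernel V J t A with hW
  let wt : Matrix (Fin n) (Fin d) (ZMod 2) → ℝ := fun G =>
    ((Nat.card W : ℝ) ^ Module.finrank (ZMod 2) (coeffsIn (constOff J) G) *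
        (Nat.card V : ℝ) ^ (d - Module.finrank (ZMod 2) (coeffsIn (constOff J) G)))⁻¹
  have hwt0 : ∀ G, 0 ≤ wt G := fun G => by positivity
  -- By `dotProduct_eq_of_mem_constOff`, if one row tuple with parts A annihilates G, then every
  -- combination of columns that is constant outside J lies in W. This condition no longer mentions
  -- H.
  let good := (matsIn V d).filter fun G => ∀ u ∈ coeffsIn (constOff J) G, G.mulVec u ∈ W
  let r := Fintype.card ι
  have hfin : ∀ G : Matrix (Fin n) (Fin d) (ZMod 2),
      Module.finrank (ZMod 2) (coeffsIn (constOff J) G) ≤ d := fun G => by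
    simpa using Submodule.finrank_le (coeffsIn (constOff J) G)
  calc _ ≤ ∑ H ∈ Fintype.piFinset fun i => fiber J t (A i), ∑ G ∈ good,
        if (Structured J σ G ∧ ((∀ i u, dotProduct (H i) (G.mulVec u) = 0) ∧
          ∑ i, sgn (dotProduct (H i) (f G)) ≤ 2 * ζ * Fintype.card ι)) then
          (2 ^ r) ^ (d - Module.finrank (ZMod 2) (coeffsIn (constOff J) G)) * wt G else 0 := by
        refine Finset.sum_le_sum fun H hH => ?_
        rw [Fintype.mem_piFinset] at hH
        rw [mul_comm, ← nsmul_eq_mul, ← Finset.sum_const, ← Finset.sum_filter]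
        refine (Finset.sum_le_sum_of_subset_of_nonneg (t := good.filter fun G =>
          Structured J σ G ∧ ((∀ i u, dotProduct (H i) (G.mulVec u) = 0) ∧
          ∑ i, sgn (dotProduct (H i) (f G)) ≤ 2 * ζ * Fintype.card ι)) ?_
          fun _ _ _ => by positivity).trans ?_
        · intro G hG
          obtain ⟨h1, h2, h3⟩ := Finset.mem_filter.mp hG
          have h4 := mem_matsIn.mp h1
          refine Finset.mem_filter.mpr ⟨Finset.mem_filter.mpr ⟨mem_matsIn.mpr fun u => (h4 u).1, ?_⟩,
            h2, fun i u => (h4 u).2 i, h3⟩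
          intro u hu
          refine mem_visibleKernel.mpr ⟨⟨(h4 u).1, hu⟩, fun i h hh => ?_⟩
          rw [dotProduct_eq_of_mem_constOff (mem_coeffsIn.mp hu) hh (hH i)]
          exact (h4 u).2 i
        · refine Finset.sum_le_sum fun G _ => ?_
          exact inv_card_pow_le V hH (hfin G)
    _ = ∑ G ∈ good, (if Structured J σ G then
        (2 ^ r) ^ (d - Module.finrank (ZMod 2) (coeffsIn (constOff J) G)) * wt G *
        ((Fintype.piFinset fun i => fiber J t (A i)).filter fun H =>
          (∀ i u, dotProduct (H i) (G.mulVec u) = 0) ∧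
          ∑ i, sgn (dotProduct (H i) (f G)) ≤ 2 * ζ * Fintype.card ι).card else 0) := by
        -- The decisive exchange: with G outermost the error f G is fixed while the rows vary, so no
        -- union bound over errors is needed.
        rw [Finset.sum_comm]
        refine Finset.sum_congr rfl fun G _ => ?_
        split_ifs with h
        · simp only [h, true_and]
          rw [← Finset.sum_filter, Finset.sum_const, nsmul_eq_mul, mul_comm]
        · simp [h]
    _ ≤ ∑ G ∈ good, wt G * Θ := by
        refine Finset.sum_le_sum fun G hG => ?_
        split_ifs with h
        · have h1 := hc.card_bad_rows_le hJ h (hf G) (A := A) (ι := ι) (fun i u hu h' hh' =>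
            (mem_visibleKernel.mp ((Finset.mem_filter.mp hG).2 u hu)).2 i h' hh')
          have hm := hfin G
          set m := Module.finrank (ZMod 2) (coeffsIn (constOff J) G) with hmdef
          -- The normalization loss and the annihilation probabilities cancel exactly, row by row.
          have h2 : (2 ^ r) ^ (d - m) * ∏ i, ((fiber J t (A i)).card * ((2 : ℝ) ^ m / 2 ^ d) *
              rowFactor (biasBound σ₁ t ^ 2 / 16) s₂ t d (hammingNorm (A i))) =
              ∏ i, ((fiber J t (A i)).card *
                rowFactor (biasBound σ₁ t ^ 2 / 16) s₂ t d (hammingNorm (A i))) := by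
            have e : ((2 : ℝ) ^ r) ^ (d - m) = ∏ _i : ι, (2 : ℝ) ^ (d - m) := by
              rw [Finset.prod_const, Finset.card_univ, ← pow_mul, ← pow_mul, mul_comm]
            rw [e, ← Finset.prod_mul_distrib]
            refine Finset.prod_congr rfl fun i _ => ?_
            have e2 : (2 : ℝ) ^ (d - m) * (2 ^ m / 2 ^ d) = 1 := by
              rw [mul_div_assoc', ← pow_add, Nat.sub_add_cancel hm, div_self (by positivity)]
            linear_combination ((fiber J t (A i)).card *
              rowFactor (biasBound σ₁ t ^ 2 / 16) s₂ t d (hammingNorm (A i))) * e2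
          refine (mul_le_mul_of_nonneg_left h1
            (mul_nonneg (by positivity) (hwt0 G))).trans_eq ?_
          rw [hΘ, ← h2]
          ring
        · exact mul_nonneg (hwt0 G) hΘ0
    _ ≤ _ := by
        rw [← Finset.sum_mul]
        exact mul_le_mul_of_nonneg_right (sum_matsIn_weight_le d V W (constOff J)) hΘ0

theorem sum_card_fiber_mul_le :
    ∑ A : BitVec2 n, ((fiber J t A).card : ℝ) *
      rowFactor (biasBound σ₁ t ^ 2 / 16) s₂ t d (hammingNorm A) ≤
      n.choose t * Real.exp (-(biasBound σ₁ t ^ 2 / 16 / 2)) := by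
  set θ := biasBound σ₁ t ^ 2 / 16
  calc _ = ∑ h ∈ sparse n t, rowFactor θ s₂ t d (hammingNorm (part J h)) := by
        refine Eq.trans ?_ (Finset.sum_fiberwise_of_maps_to (s := sparse n t) (t := Finset.univ)
          (g := fun h => part J h) (fun _ _ => Finset.mem_univ _) _)
        refine Finset.sum_congr rfl fun A _ => ?_
        rw [← nsmul_eq_mul, ← Finset.sum_const]
        refine Finset.sum_congr rfl fun h hh => ?_
        rw [(mem_fiber.mp hh).2]
    _ ≤ n.choose t * (1 - θ / 2) := hc.sum_rowFactor_le hJ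
    _ ≤ _ := by
        gcongr
        linarith [Real.add_one_le_exp (-(θ / 2))]

open Classical in
/-- The counting bound: structured matrices give no information that helps to find an error on which
many rows look unbiased. -/
theorem sum_structured_bad_le (V : Submodule (ZMod 2) (BitVec2 n))
    (f : Matrix (Fin n) (Fin d) (ZMod 2) → BitVec2 n)
    (hf : ∀ G, (hammingNorm (f G) : ℝ) ≤ α * n) :
    ∑ H ∈ rowTuples ι n t,
      ((Nat.card ↥(V ⊓ kerRows H) : ℝ) ^ d)⁻¹ *
        ((matsIn (V ⊓ kerRows H) d).filter fun G => Structured J σ G ∧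
          ∑ i, sgn (dotProduct (H i) (f G)) ≤ 2 * ζ * Fintype.card ι).card ≤
      n.choose t ^ Fintype.card ι *
        (2 ^ (d * d) * Real.exp (-(biasBound σ₁ t ^ 2 / 64 * Fintype.card ι))) := by
  have hb := hc.bias_pos
  have hb1 := hc.bias_le_half
  set θ := biasBound σ₁ t ^ 2 / 16 with hθ
  have hθ0 : 0 < θ := by positivity
  have hθ1 : θ ≤ 1 := by rw [hθ]; nlinarith
  have hfib : ∀ A : ι → BitVec2 n, (rowTuples ι n t).filter (fun H => (fun i => part J (H i)) = A) =
      Fintype.piFinset fun i => fiber J t (A i) := by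
    intro A
    ext H
    simp [mem_rowTuples, Fintype.mem_piFinset, mem_fiber, funext_iff, forall_and]
  rw [← Finset.sum_fiberwise_of_maps_to (t := Finset.univ)
    (g := fun (H : ι → BitVec2 n) => fun i => part J (H i)) (fun _ _ => Finset.mem_univ _)]
  simp_rw [hfib]
  refine (Finset.sum_le_sum fun A _ => hc.sum_fixed_parts_le hJ V f hf A).trans ?_
  rw [← Finset.mul_sum, ← Finset.mul_sum, ← Fintype.piFinset_univ,
    ← Finset.prod_univ_sum (fun _ => Finset.univ) fun _ A => ((fiber J t A).card : ℝ) *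
      rowFactor θ s₂ t d (hammingNorm A), Finset.prod_const, Finset.card_univ]
  have hrow := hc.sum_card_fiber_mul_le hJ
  have hrow0 : 0 ≤ ∑ A : BitVec2 n, ((fiber J t A).card : ℝ) * rowFactor θ s₂ t d (hammingNorm A) :=
    Finset.sum_nonneg fun A _ => mul_nonneg (Nat.cast_nonneg _) (hc.rowFactor_nonneg _)
  calc _ ≤ 2 ^ (d * d) * (Real.exp (θ / 4 * Fintype.card ι) *
        (n.choose t * Real.exp (-(θ / 2))) ^ Fintype.card ι) :=
        mul_le_mul_of_nonneg_left (mul_le_mul_of_nonneg_left (pow_le_pow_left₀ hrow0 hrow _)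
          (Real.exp_pos _).le) (by positivity)
    _ = n.choose t ^ Fintype.card ι * (2 ^ (d * d) * (Real.exp (θ / 4 * Fintype.card ι) *
        Real.exp (-(θ / 2)) ^ Fintype.card ι)) := by rw [mul_pow]; ring
    _ = _ := by
        rw [← Real.exp_nat_mul, ← Real.exp_add]
        congr 3
        rw [hθ]
        ring

end CountingConditions

end Count

/-! ### First-moment bounds on kernel vectors and column combinations -/

section Weight

variable {n d : ℕ} {K : Submodule (ZMod 2) (BitVec2 n)}

open Classical in
/-- The probability of an event for a uniform matrix with columns in `K`. -/
noncomputable def matProb (K : Submodule (ZMod 2) (BitVec2 n)) (d : ℕ)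
    (P : Matrix (Fin n) (Fin d) (ZMod 2) → Prop) : ℝ :=
  ((Nat.card K : ℝ) ^ d)⁻¹ * ((matsIn K d).filter P).card

theorem matProb_le_one (P : Matrix (Fin n) (Fin d) (ZMod 2) → Prop) : matProb K d P ≤ 1 := by
  classical
  have hK : (0 : ℝ) < Nat.card K := by exact_mod_cast nat_card_pos K
  rw [matProb, inv_mul_le_iff₀ (by positivity), mul_one]
  have : ((matsIn K d).filter P).card ≤ Nat.card K ^ d := by
    rw [← card_matsIn]
    exact Finset.card_filter_le _ _
  exact_mod_cast this

theorem matProb_mono {P Q : Matrix (Fin n) (Fin d) (ZMod 2) → Prop}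
    (h : ∀ G ∈ matsIn K d, P G → Q G) : matProb K d P ≤ matProb K d Q := by
  classical
  unfold matProb
  refine mul_le_mul_of_nonneg_left (Nat.cast_le.mpr (Finset.card_le_card fun G hG => ?_))
    (by positivity)
  rw [Finset.mem_filter] at hG ⊢
  exact ⟨hG.1, h G hG.1 hG.2⟩

theorem matProb_or_le (P Q : Matrix (Fin n) (Fin d) (ZMod 2) → Prop) :
    matProb K d (fun G => P G ∨ Q G) ≤ matProb K d P + matProb K d Q := by
  unfold matProb
  rw [← mul_add]
  refine mul_le_mul_of_nonneg_left ?_ (by positivity)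
  rw [← Nat.cast_add]
  refine Nat.cast_le.mpr ((Finset.card_le_card fun G hG => ?_).trans (Finset.card_union_le _ _))
  simp only [Finset.mem_filter, Finset.mem_union] at hG ⊢
  tauto

open Classical in
theorem card_filter_matsIn_le (S : Finset (BitVec2 n)) (h0 : (0 : BitVec2 n) ∉ S) (u : BitVec2 d)
    {v : BitVec2 n} (hv : v ∈ S) :
    (((matsIn K d).filter fun G => G.mulVec u = v).card : ℝ) ≤
      (Nat.card K : ℝ) ^ d * if v ∈ K then (Nat.card K : ℝ)⁻¹ else 0 := by
  have hK : (0 : ℝ) < Nat.card K := by exact_mod_cast nat_card_pos K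
  split_ifs with hvK
  · by_cases hu : u = 0
    · have : ((matsIn K d).filter fun G => G.mulVec u = v) = ∅ := by
        rw [Finset.filter_eq_empty_iff]
        intro G _ h
        rw [hu, Matrix.mulVec_zero] at h
        exact h0 (h ▸ hv)
      rw [this, Finset.card_empty, Nat.cast_zero]
      positivity
    · rw [← div_eq_mul_inv, le_div_iff₀ hK]
      have := card_filter_matsIn_mul_le K hu v
      rw [card_matsIn] at this
      exact_mod_cast this
  · have : ((matsIn K d).filter fun G => G.mulVec u = v) = ∅ := by
      rw [Finset.filter_eq_empty_iff]
      intro G hG h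
      exact hvK (h ▸ mem_matsIn.mp hG u)
    rw [this, Finset.card_empty, Nat.cast_zero, mul_zero]

open Classical in
theorem card_filter_exists_le (S : Finset (BitVec2 n)) :
    ((matsIn K d).filter fun G => ∃ u, G.mulVec u ∈ S).card ≤
      ∑ u : BitVec2 d, ∑ v ∈ S, ((matsIn K d).filter fun G => G.mulVec u = v).card := by
  have hsub : ((matsIn K d).filter fun G => ∃ u, G.mulVec u ∈ S) ⊆
      Finset.univ.biUnion fun u : BitVec2 d => S.biUnion fun v =>
        (matsIn K d).filter fun G => G.mulVec u = v := by
    intro G hG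
    obtain ⟨h1, u, hu⟩ := Finset.mem_filter.mp hG
    exact Finset.mem_biUnion.mpr ⟨u, Finset.mem_univ _, Finset.mem_biUnion.mpr
      ⟨_, hu, Finset.mem_filter.mpr ⟨h1, rfl⟩⟩⟩
  exact ((Finset.card_le_card hsub).trans Finset.card_biUnion_le).trans
    (Finset.sum_le_sum fun u _ => Finset.card_biUnion_le)

-- Union bound over u and v: a nonzero combination is uniform on K, and the zero combination misses
-- S.
open Classical in
theorem matProb_exists_mem_le (S : Finset (BitVec2 n)) (h0 : (0 : BitVec2 n) ∉ S) :
    matProb K d (fun G => ∃ u, G.mulVec u ∈ S) ≤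
      2 ^ d * ∑ v ∈ S, if v ∈ K then (Nat.card K : ℝ)⁻¹ else 0 := by
  have hK : (0 : ℝ) < Nat.card K := by exact_mod_cast nat_card_pos K
  have h1 : (((matsIn K d).filter fun G => ∃ u, G.mulVec u ∈ S).card : ℝ) ≤
      ∑ u : BitVec2 d, ∑ v ∈ S, (((matsIn K d).filter fun G => G.mulVec u = v).card : ℝ) := by
    have := card_filter_exists_le (K := K) (d := d) S
    exact_mod_cast this
  rw [matProb, inv_mul_le_iff₀ (by positivity)]
  refine le_trans (le_of_eq (by congr)) (h1.trans <|
    (Finset.sum_le_sum fun u _ => Finset.sum_le_sum fun v hv =>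
    card_filter_matsIn_le S h0 u hv).trans_eq ?_)
  rw [Finset.sum_const, ← Finset.mul_sum, nsmul_eq_mul]
  simp only [Finset.card_univ, Fintype.card_fun, ZMod.card, Fintype.card_fin]
  push_cast
  ring

end Weight

section FirstMoment

variable {n t d : ℕ} {ι : Type*} [Fintype ι] [DecidableEq ι]

/-- The probability that a random sparse row annihilates `v`. -/
noncomputable def annihProb (t : ℕ) (v : BitVec2 n) : ℝ :=
  (1 + krawtchouk Finset.univ (fun i => sgn (v i)) t) / 2

theorem annihProb_nonneg (v : BitVec2 n) : 0 ≤ annihProb t v := by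
  have := (abs_le.mp (abs_krawtchouk_le_one (fun i => sgn (v i)) (fun i => sgn_sq _)
    Finset.univ t)).1
  unfold annihProb
  linarith

-- After the kernel size is bounded uniformly, only the expected number of vectors of S in a random
-- kernel matters, and rows are independent.
open Classical in
theorem sum_matProb_exists_mem_le (S : Finset (BitVec2 n)) (h0 : (0 : BitVec2 n) ∉ S) {B : ℝ}
    (hB : ∀ H : ι → BitVec2 n, (Nat.card (kerRows H) : ℝ)⁻¹ ≤ B) :
    ∑ H ∈ rowTuples ι n t, matProb (kerRows H) d (fun G => ∃ u, G.mulVec u ∈ S) ≤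
      n.choose t ^ Fintype.card ι * (2 ^ d * (B * ∑ v ∈ S, annihProb t v ^ Fintype.card ι)) := by
  calc _ ≤ ∑ H ∈ rowTuples ι n t, 2 ^ d * ∑ v ∈ S, if v ∈ kerRows H then B else 0 := by
        refine Finset.sum_le_sum fun H _ => (matProb_exists_mem_le S h0).trans ?_
        refine mul_le_mul_of_nonneg_left (Finset.sum_le_sum fun v _ => ?_) (by positivity)
        split_ifs
        · exact hB H
        · exact le_rfl
    _ = 2 ^ d * ∑ v ∈ S,
        (((rowTuples ι n t).filter fun H => ∀ i, dotProduct (H i) v = 0).card : ℝ) * B := by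
        rw [← Finset.mul_sum, Finset.sum_comm]
        congr 1
        refine Finset.sum_congr rfl fun v _ => ?_
        rw [← Finset.sum_filter, Finset.sum_const, nsmul_eq_mul]
        simp only [mem_kerRows]
    _ = _ := by
        simp_rw [card_filter_rowTuples]
        rw [← Finset.sum_mul, ← Finset.mul_sum]
        unfold annihProb
        ring

open Classical in
theorem card_filter_exists_ker_le (S : Finset (BitVec2 n)) :
    (((rowTuples ι n t).filter fun H => ∃ v ∈ S, v ∈ kerRows H).card : ℝ) ≤
      n.choose t ^ Fintype.card ι * ∑ v ∈ S, annihProb t v ^ Fintype.card ι := by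
  have hsub : ((rowTuples ι n t).filter fun H => ∃ v ∈ S, v ∈ kerRows H) ⊆
      S.biUnion fun v => (rowTuples ι n t).filter fun H => ∀ i, dotProduct (H i) v = 0 := by
    intro H hH
    obtain ⟨h1, v, hv, hvH⟩ := Finset.mem_filter.mp hH
    exact Finset.mem_biUnion.mpr ⟨v, hv, Finset.mem_filter.mpr ⟨h1, hvH⟩⟩
  calc _ ≤ ∑ v ∈ S,
        (((rowTuples ι n t).filter fun H => ∀ i, dotProduct (H i) v = 0).card : ℝ) := by
        exact_mod_cast (Finset.card_le_card hsub).trans Finset.card_biUnion_le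
    _ = _ := by
        simp_rw [card_filter_rowTuples]
        rw [← Finset.mul_sum]
        rfl

theorem two_pow_le_card_kerRows_mul (H : ι → BitVec2 n) :
    2 ^ n ≤ Nat.card (kerRows H) * 2 ^ Fintype.card ι := by
  have h := card_le_card_inf_kerRows_mul H ⊤
  rw [top_inf_eq, Nat.card_congr (Submodule.topEquiv (R := ZMod 2)).toEquiv, Nat.card_fun] at h
  simpa using h

theorem inv_card_kerRows_le (H : ι → BitVec2 n) :
    (Nat.card (kerRows H) : ℝ)⁻¹ ≤ min 1 (2 ^ Fintype.card ι / 2 ^ n) := by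
  have h1 : (1 : ℝ) ≤ Nat.card (kerRows H) := by exact_mod_cast nat_card_pos (kerRows H)
  have h2 : (2 : ℝ) ^ n ≤ Nat.card (kerRows H) * 2 ^ Fintype.card ι := by
    exact_mod_cast two_pow_le_card_kerRows_mul H
  refine le_min (inv_le_one_of_one_le₀ h1) ?_
  rw [le_div_iff₀ (by positivity), inv_mul_le_iff₀ (by linarith)]
  exact h2

end FirstMoment

/-! ### Exceptional coordinates, few rows and many rows -/

/-- The common support of an additively closed family of light vectors is small. -/
theorem exists_common_support {n : ℕ} (S : Finset (BitVec2 n)) (h0 : (0 : BitVec2 n) ∈ S)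
    (hadd : ∀ v ∈ S, ∀ w ∈ S, v + w ∈ S) {m : ℝ} (hm : ∀ v ∈ S, (hammingNorm v : ℝ) ≤ m) :
    ∃ J : Finset (Fin n), (J.card : ℝ) ≤ 2 * m ∧ ∀ v ∈ S, ∀ i ∉ J, v i = 0 := by
  classical
  refine ⟨Finset.univ.filter fun i => ∃ v ∈ S, v i ≠ 0, ?_, ?_⟩
  swap
  · intro v hv i hi
    by_contra h
    exact hi (Finset.mem_filter.mpr ⟨Finset.mem_univ _, v, hv, h⟩)
  set J := Finset.univ.filter fun i => ∃ v ∈ S, v i ≠ 0 with hJ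
  -- Translation by a member w with w i = 1 injects the members vanishing at i into those that do
  -- not. Each coordinate of J is therefore one in at least half of S, and double counting bounds J.
  have hhalf : ∀ i ∈ J, S.card ≤ 2 * (S.filter fun v => v i ≠ 0).card := by
    intro i hi
    obtain ⟨w, hw, hwi⟩ := (Finset.mem_filter.mp hi).2
    have h1 : (S.filter fun v => ¬ v i ≠ 0).card ≤ (S.filter fun v => v i ≠ 0).card := by
      refine Finset.card_le_card_of_injOn (fun v => v + w) ?_ fun v _ v' _ h => add_right_cancel h
      intro v hv
      obtain ⟨h2, h3⟩ := Finset.mem_filter.mp hv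
      refine Finset.mem_coe.mpr (Finset.mem_filter.mpr ⟨hadd v h2 w hw, ?_⟩)
      rw [not_not] at h3
      simpa [h3] using hwi
    have h2 := Finset.card_filter_add_card_filter_not (s := S) (fun v => v i ≠ 0)
    omega
  have hcount : ∑ v ∈ S, (hammingNorm v) = ∑ i, (S.filter fun v => v i ≠ 0).card := by
    simp only [hammingNorm, Finset.card_filter]
    rw [Finset.sum_comm]
  have h1 : J.card * S.card ≤ 2 * ∑ v ∈ S, hammingNorm v := by
    rw [hcount, Finset.mul_sum, ← smul_eq_mul, ← Finset.sum_const]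
    exact (Finset.sum_le_sum hhalf).trans (Finset.sum_le_sum_of_subset (Finset.subset_univ J))
  have h2 : ((∑ v ∈ S, hammingNorm v : ℕ) : ℝ) ≤ S.card * m := by
    push_cast
    refine (Finset.sum_le_sum hm).trans ?_
    rw [Finset.sum_const, nsmul_eq_mul]
  have h3 : (0 : ℝ) < S.card := by exact_mod_cast Finset.card_pos.mpr ⟨0, h0⟩
  have h4 : (J.card : ℝ) * S.card ≤ 2 * ((∑ v ∈ S, hammingNorm v : ℕ) : ℝ) := by exact_mod_cast h1
  nlinarith

section Cases

variable {n t d : ℕ} {σ α s₂ σ₁ x₀ ζ : ℝ}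

/-- The sum of the row biases is too small for the error to be accepted. -/
def LooksUnbiased {ι : Type*} [Fintype ι] (ζ : ℝ) (H : ι → BitVec2 n) (e : BitVec2 n) : Prop :=
  ∑ i, sgn (dotProduct (H i) e) ≤ 2 * ζ * Fintype.card ι

open Classical in
/-- The vectors that are neither balanced nor constant. -/
noncomputable def nonConstUnbalanced (n : ℕ) (σ : ℝ) : Finset (BitVec2 n) :=
  Finset.univ.filter fun v => v ∉ constOff (∅ : Finset (Fin n)) ∧ σ * n < |∑ i, sgn (v i)|

open Classical in
/-- The vectors that are neither balanced nor close to a constant vector. -/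
noncomputable def unstructured (n : ℕ) (σ : ℝ) : Finset (BitVec2 n) :=
  Finset.univ.filter fun v => (σ * n < hammingNorm v ∧ (hammingNorm v : ℝ) < n - σ * n) ∧
    σ * n < |∑ i, sgn (v i)|

open Classical in
/-- The vectors of weight between `σ n` and `2 σ n`. -/
noncomputable def midWeight (n : ℕ) (σ : ℝ) : Finset (BitVec2 n) :=
  Finset.univ.filter fun v => σ * n < hammingNorm v ∧ (hammingNorm v : ℝ) ≤ 2 * (σ * n)

theorem CountingConditions.sum_matProb_structured_le {j : ℝ} {J : Finset (Fin n)}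
    (hc : CountingConditions n t d j σ α s₂ σ₁ x₀ ζ) (hJ : (J.card : ℝ) ≤ j)
    {ι : Type*} [Fintype ι] [DecidableEq ι] (V : Submodule (ZMod 2) (BitVec2 n))
    (f : Matrix (Fin n) (Fin d) (ZMod 2) → BitVec2 n)
    (hf : ∀ G, (hammingNorm (f G) : ℝ) ≤ α * n) :
    ∑ H ∈ rowTuples ι n t, matProb (V ⊓ kerRows H) d
      (fun G => Structured J σ G ∧ LooksUnbiased ζ H (f G)) ≤
      n.choose t ^ Fintype.card ι *
        (2 ^ (d * d) * Real.exp (-(biasBound σ₁ t ^ 2 / 64 * Fintype.card ι))) := by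
  unfold matProb LooksUnbiased
  convert hc.sum_structured_bad_le hJ V f hf

/-- The advantage bound for few rows. -/
theorem CountingConditions.sum_matProb_le_of_few_rows {j : ℝ} (hj : 0 ≤ j)
    (hc : CountingConditions n t d j σ α s₂ σ₁ x₀ ζ) {ι : Type*} [Fintype ι] [DecidableEq ι]
    (f : Matrix (Fin n) (Fin d) (ZMod 2) → BitVec2 n)
    (hf : ∀ G, (hammingNorm (f G) : ℝ) ≤ α * n) :
    ∑ H ∈ rowTuples ι n t, matProb (kerRows H) d (fun G => LooksUnbiased ζ H (f G)) ≤
      n.choose t ^ Fintype.card ι *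
        (2 ^ d * (min 1 (2 ^ Fintype.card ι / 2 ^ n) *
          ∑ v ∈ nonConstUnbalanced n σ, annihProb t v ^ Fintype.card ι) +
        2 ^ (d * d) * Real.exp (-(biasBound σ₁ t ^ 2 / 64 * Fintype.card ι))) := by
  classical
  have h1 := sum_matProb_exists_mem_le (t := t) (d := d) (ι := ι) (nonConstUnbalanced n σ)
    (by simp [nonConstUnbalanced, (constOff (∅ : Finset (Fin n))).zero_mem])
    inv_card_kerRows_le
  -- With few rows no exceptional coordinates are needed: structured then means balanced or
  -- constant, and all rows are counted at once.
  have h2 := hc.sum_matProb_structured_le (J := ∅) (by simpa using hj) (ι := ι) ⊤ f hf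
  rw [mul_add]
  refine le_trans ?_ (add_le_add h1 h2)
  rw [← Finset.sum_add_distrib]
  refine Finset.sum_le_sum fun H _ => ?_
  rw [top_inf_eq]
  refine (matProb_mono fun G _ hG => ?_).trans (matProb_or_le _ _)
  by_cases h : ∃ u, G.mulVec u ∈ nonConstUnbalanced n σ
  · exact Or.inl h
  · refine Or.inr ⟨fun u => ?_, hG⟩
    by_contra! h'
    exact h ⟨u, Finset.mem_filter.mpr ⟨Finset.mem_univ _, h'⟩⟩

theorem ones_mem_kerRows {ι : Type*} [Fintype ι] [DecidableEq ι] (ht : Even t) {H : ι → BitVec2 n}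
    (hH : H ∈ rowTuples ι n t) : (fun _ => 1) ∈ kerRows H := by
  intro i
  have h1 := mem_rowTuples.mp hH i
  have h2 : dotProduct (H i) (fun _ => 1) = ((hammingNorm (H i) : ℕ) : ZMod 2) := by
    rw [hammingNorm, Finset.card_filter, Nat.cast_sum, dotProduct]
    refine Finset.sum_congr rfl fun k _ => ?_
    rcases zmod_two_eq (H i k) with h | h <;> simp [h]
  rw [h2, h1]
  exact (ZMod.natCast_eq_zero_iff_even).mpr ht

theorem hammingNorm_add_ones (v : BitVec2 n) :
    (hammingNorm (v + fun _ => 1) : ℝ) = n - hammingNorm v := by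
  rw [hammingNorm_eq_sum, hammingNorm_eq_sum]
  have : (n : ℝ) = ∑ _i : Fin n, (1 : ℝ) := by simp
  rw [this, ← Finset.sum_sub_distrib]
  refine Finset.sum_congr rfl fun i _ => ?_
  rw [Pi.add_apply, sgn_add, sgn_one]
  ring

theorem hammingNorm_add_le' (v w : BitVec2 n) :
    (hammingNorm (v + w) : ℝ) ≤ hammingNorm v + hammingNorm w := by
  have h : hammingNorm (v + w) ≤ hammingNorm v + hammingNorm w := by
    unfold hammingNorm
    refine (Finset.card_le_card ?_).trans (Finset.card_union_le _ _)
    intro i hi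
    simp only [Finset.mem_filter, Finset.mem_union, Finset.mem_univ, true_and, Pi.add_apply] at hi ⊢
    by_contra! h
    exact hi (by rw [h.1, h.2, add_zero])
  exact_mod_cast h

/-- If the kernel of the rows has no vectors of intermediate weight, then the light vectors of the
kernel have a small common support, outside of which the vectors that are not balanced are
constant. -/
theorem exists_exceptional_coordinates {ι : Type*} [Fintype ι] [DecidableEq ι] (ht : Even t)
    (hσ : 0 ≤ σ) {H : ι → BitVec2 n} (hH : H ∈ rowTuples ι n t)
    (hmid : ¬ ∃ v ∈ midWeight n σ, v ∈ kerRows H) :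
    ∃ J : Finset (Fin n), (J.card : ℝ) ≤ 2 * (σ * n) ∧
      ∀ v ∈ kerRows H, v ∉ unstructured n σ → v ∈ constOff J ∨ |∑ i, sgn (v i)| ≤ σ * n := by
  classical
  obtain ⟨J, hJ, hJ'⟩ := exists_common_support
    (Finset.univ.filter fun v => v ∈ kerRows H ∧ (hammingNorm v : ℝ) ≤ σ * n)
    (Finset.mem_filter.mpr ⟨Finset.mem_univ _, (kerRows H).zero_mem, by
      rw [hammingNorm_zero, Nat.cast_zero]; positivity⟩) (by
      intro v hv w hw
      obtain ⟨-, hv1, hv2⟩ := Finset.mem_filter.mp hv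
      obtain ⟨-, hw1, hw2⟩ := Finset.mem_filter.mp hw
      refine Finset.mem_filter.mpr ⟨Finset.mem_univ _, (kerRows H).add_mem hv1 hw1, ?_⟩
      -- A sum of two light vectors weighs at most 2σn, so by the gap in the kernel weights it is
      -- light again.
      by_contra! h
      refine hmid ⟨v + w, Finset.mem_filter.mpr ⟨Finset.mem_univ _, h, ?_⟩,
        (kerRows H).add_mem hv1 hw1⟩
      linarith [hammingNorm_add_le' v w]) (fun v hv => (Finset.mem_filter.mp hv).2.2)
  refine ⟨J, hJ, fun v hv hvu => ?_⟩
  by_cases h1 : (hammingNorm v : ℝ) ≤ σ * n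
  · exact Or.inl ⟨0, hJ' v (Finset.mem_filter.mpr ⟨Finset.mem_univ _, hv, h1⟩)⟩
  by_cases h2 : (n : ℝ) - σ * n ≤ hammingNorm v
  -- The all-ones vector is in the kernel since t is even, so the complement of v is a light kernel
  -- vector.
  · refine Or.inl ⟨1, fun i hi => ?_⟩
    have h3 := hJ' (v + fun _ => 1) (Finset.mem_filter.mpr ⟨Finset.mem_univ _,
      (kerRows H).add_mem hv (ones_mem_kerRows ht hH), by
        rw [hammingNorm_add_ones]; linarith⟩) i hi
    rcases zmod_two_eq (v i) with h | h
    · simp [h] at h3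
    · exact h
  · right
    by_contra! h3
    push Not at h1 h2
    exact hvu (Finset.mem_filter.mpr ⟨Finset.mem_univ _, ⟨h1, h2⟩, h3⟩)

variable {ι κ : Type*} [Fintype ι] [DecidableEq ι] [Fintype κ] [DecidableEq κ]

theorem sum_rowTuples_sum (F : (ι → BitVec2 n) → (κ → BitVec2 n) → ℝ) :
    ∑ H ∈ rowTuples (ι ⊕ κ) n t, F (fun i => H (.inl i)) (fun i => H (.inr i)) =
      ∑ H₁ ∈ rowTuples ι n t, ∑ H₂ ∈ rowTuples κ n t, F H₁ H₂ := by
  rw [← Finset.sum_product']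
  refine Finset.sum_nbij' (fun H => (fun i => H (.inl i), fun i => H (.inr i)))
    (fun p => Sum.elim p.1 p.2) ?_ ?_ ?_ ?_ ?_
  · intro H hH
    rw [mem_rowTuples] at hH
    exact Finset.mem_product.mpr ⟨mem_rowTuples.mpr fun i => hH _, mem_rowTuples.mpr fun i => hH _⟩
  · intro p hp
    obtain ⟨h1, h2⟩ := Finset.mem_product.mp hp
    rw [mem_rowTuples] at h1 h2 ⊢
    rintro (i | i)
    · exact h1 i
    · exact h2 i
  · intro H _
    ext i
    cases i <;> rfl
  · intro p _
    rfl
  · intro H _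
    rfl

theorem kerRows_sum (H : ι ⊕ κ → BitVec2 n) :
    kerRows H = kerRows (fun i => H (.inl i)) ⊓ kerRows fun i => H (.inr i) := by
  ext v
  simp [mem_kerRows, Sum.forall]

/-- The advantage on one block of rows, given that the other block is typical. -/
theorem CountingConditions.sum_sum_matProb_le (hσ : 0 ≤ σ)
    (hc : CountingConditions n t d (2 * (σ * n)) σ α s₂ σ₁ x₀ ζ)
    (f : Matrix (Fin n) (Fin d) (ZMod 2) → BitVec2 n)
    (hf : ∀ G, (hammingNorm (f G) : ℝ) ≤ α * n) :
    ∑ H₁ ∈ rowTuples ι n t, ∑ H₂ ∈ rowTuples κ n t, matProb (kerRows H₁ ⊓ kerRows H₂) d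
      (fun G => (∀ u, G.mulVec u ∉ unstructured n σ) ∧ LooksUnbiased ζ H₂ (f G)) ≤
      n.choose t ^ Fintype.card ι * n.choose t ^ Fintype.card κ *
        (∑ v ∈ midWeight n σ, annihProb t v ^ Fintype.card ι +
        2 ^ (d * d) * Real.exp (-(biasBound σ₁ t ^ 2 / 64 * Fintype.card κ))) := by
  classical
  have h1 := card_filter_exists_ker_le (t := t) (ι := ι) (midWeight n σ)
  set E : ℝ := n.choose t ^ Fintype.card κ *
    (2 ^ (d * d) * Real.exp (-(biasBound σ₁ t ^ 2 / 64 * Fintype.card κ))) with hE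
  have hE0 : 0 ≤ E := by positivity
  calc _ ≤ ∑ H₁ ∈ rowTuples ι n t,
        ((if ∃ v ∈ midWeight n σ, v ∈ kerRows H₁ then (n.choose t : ℝ) ^ Fintype.card κ else 0) + E)
        := by
        refine Finset.sum_le_sum fun H₁ hH₁ => ?_
        split_ifs with hmid
        · have : ∑ H₂ ∈ rowTuples κ n t, matProb (kerRows H₁ ⊓ kerRows H₂) d
              (fun G => (∀ u, G.mulVec u ∉ unstructured n σ) ∧ LooksUnbiased ζ H₂ (f G)) ≤
              ∑ H₂ ∈ rowTuples κ n t, (1 : ℝ) := Finset.sum_le_sum fun _ _ => matProb_le_one _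
          rw [Finset.sum_const, card_rowTuples, nsmul_eq_mul, mul_one, Nat.cast_pow] at this
          linarith
        · rw [zero_add]
          -- J and the ambient space ker H₁ depend on the first block only, so the rows of the
          -- second block remain free in the counting bound.
          obtain ⟨J, hJ, hJ'⟩ := exists_exceptional_coordinates hc.even hσ hH₁ hmid
          refine le_trans (Finset.sum_le_sum fun H₂ _ => matProb_mono fun G hG h => ?_)
            (hc.sum_matProb_structured_le hJ (ι := κ) (kerRows H₁) f hf)
          exact ⟨fun u => hJ' _ (mem_matsIn.mp hG u).1 (h.1 u), h.2⟩
    _ = (n.choose t : ℝ) ^ Fintype.card κ *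
        ((rowTuples ι n t).filter fun H => ∃ v ∈ midWeight n σ, v ∈ kerRows H).card +
        n.choose t ^ Fintype.card ι * E := by
        rw [Finset.sum_add_distrib, ← Finset.sum_filter, Finset.sum_const, Finset.sum_const,
          card_rowTuples]
        simp only [nsmul_eq_mul]
        push_cast
        ring
    _ ≤ (n.choose t : ℝ) ^ Fintype.card κ * (n.choose t ^ Fintype.card ι *
        ∑ v ∈ midWeight n σ, annihProb t v ^ Fintype.card ι) + n.choose t ^ Fintype.card ι * E := by
        gcongr
    _ = _ := by
        rw [hE]
        ring

/-- The advantage bound for many rows, split into two blocks. -/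
theorem CountingConditions.sum_matProb_le_of_many_rows (hσ : 0 ≤ σ)
    (hc : CountingConditions n t d (2 * (σ * n)) σ α s₂ σ₁ x₀ ζ)
    (f : Matrix (Fin n) (Fin d) (ZMod 2) → BitVec2 n)
    (hf : ∀ G, (hammingNorm (f G) : ℝ) ≤ α * n) :
    ∑ H ∈ rowTuples (ι ⊕ κ) n t, matProb (kerRows H) d (fun G => LooksUnbiased ζ H (f G)) ≤
      n.choose t ^ Fintype.card (ι ⊕ κ) *
        (2 ^ d * (min 1 (2 ^ Fintype.card (ι ⊕ κ) / 2 ^ n) *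
          ∑ v ∈ unstructured n σ, annihProb t v ^ Fintype.card (ι ⊕ κ)) +
        (∑ v ∈ midWeight n σ, annihProb t v ^ Fintype.card ι +
          2 ^ (d * d) * Real.exp (-(biasBound σ₁ t ^ 2 / 64 * Fintype.card κ))) +
        (∑ v ∈ midWeight n σ, annihProb t v ^ Fintype.card κ +
          2 ^ (d * d) * Real.exp (-(biasBound σ₁ t ^ 2 / 64 * Fintype.card ι)))) := by
  classical
  have h0 : (0 : BitVec2 n) ∉ unstructured n σ := by
    intro h
    have := (Finset.mem_filter.mp h).2.1.1
    rw [hammingNorm_zero, Nat.cast_zero] at this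
    have : 0 ≤ σ * n := by positivity
    linarith
  have h1 := sum_matProb_exists_mem_le (t := t) (d := d) (ι := ι ⊕ κ) (unstructured n σ) h0
    inv_card_kerRows_le
  have h2 := hc.sum_sum_matProb_le hσ (ι := ι) (κ := κ) f hf
  have h3 := hc.sum_sum_matProb_le hσ (ι := κ) (κ := ι) f hf
  rw [Finset.sum_comm] at h3
  rw [← sum_rowTuples_sum fun H₁ H₂ => matProb (kerRows H₁ ⊓ kerRows H₂) d
      (fun G => (∀ u, G.mulVec u ∉ unstructured n σ) ∧ LooksUnbiased ζ H₂ (f G))] at h2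
  rw [← sum_rowTuples_sum fun H₁ H₂ => matProb (kerRows H₂ ⊓ kerRows H₁) d
      (fun G => (∀ u, G.mulVec u ∉ unstructured n σ) ∧ LooksUnbiased ζ H₁ (f G))] at h3
  rw [mul_add, mul_add]
  have hpow : (n.choose t : ℝ) ^ Fintype.card (ι ⊕ κ) =
      n.choose t ^ Fintype.card ι * n.choose t ^ Fintype.card κ := by
    rw [Fintype.card_sum, pow_add]
  refine le_trans ?_ (add_le_add (add_le_add h1 (h2.trans_eq (by rw [hpow])))
    (h3.trans_eq (by rw [hpow, mul_comm ((n.choose t : ℝ) ^ Fintype.card κ)])))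
  rw [← Finset.sum_add_distrib, ← Finset.sum_add_distrib]
  refine Finset.sum_le_sum fun H _ => ?_
  rw [inf_comm (kerRows fun i => H (.inr i)), ← kerRows_sum]
  refine (matProb_mono fun G _ hG => ?_).trans
    ((matProb_or_le _ _).trans (add_le_add (matProb_or_le _ _) le_rfl))
  by_cases h : ∃ u, G.mulVec u ∈ unstructured n σ
  · exact Or.inl (Or.inl h)
  · push Not at h
    -- If the total of the signs is below its threshold, so is the total over at least one block.
    -- This is why both orders of the blocks are summed.
    by_cases h4 : LooksUnbiased ζ (fun i => H (.inr i)) (f G)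
    · exact Or.inl (Or.inr ⟨h, h4⟩)
    · refine Or.inr ⟨h, ?_⟩
      unfold LooksUnbiased at hG h4 ⊢
      rw [Fintype.sum_sum_type, Fintype.card_sum, Nat.cast_add] at hG
      push Not at h4
      linarith

end Cases

/-! ### First-moment estimates by weight class -/

section Estimates

variable {n t : ℕ} {σ : ℝ}

/-- The numerical conditions of the weight estimates. -/
structure WeightConditions (n t : ℕ) (σ : ℝ) : Prop where
  even : Even t
  t_ge : 16 ≤ t
  σ_eq : σ = Real.exp (-(t / 64))
  t_le : 16 * (t : ℝ) ≤ σ ^ 2 * n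
  tσ_le : 2 * t * σ ≤ 1
  σ_le : σ ≤ 1 / 40
  t_sq_le : 8 * (t : ℝ) ^ 2 ≤ n

theorem sum_pow_hammingNorm (n : ℕ) (z : ℝ) :
    ∑ v : BitVec2 n, z ^ hammingNorm v = (1 + z) ^ n := by
  have h : ∀ v : BitVec2 n, z ^ hammingNorm v = ∏ i, if v i ≠ 0 then z else 1 := by
    intro v
    rw [Finset.prod_ite, Finset.prod_const, Finset.prod_const_one, mul_one]
    rfl
  simp_rw [h]
  rw [← Fintype.piFinset_univ, ← Finset.prod_univ_sum (fun _ => Finset.univ)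
    fun (_ : Fin n) (a : ZMod 2) => if a ≠ 0 then z else 1, Finset.prod_const]
  have : ∑ a : ZMod 2, (if a ≠ 0 then z else 1) = 1 + z := by
    change ∑ a : Fin 2, (if a ≠ 0 then z else 1) = 1 + z
    rw [Fin.sum_univ_two]
    simp
  rw [this]
  simp

/-- Sum of a rapidly decreasing function of the weight over the vectors that are not too light. -/
theorem sum_le_exp_of_le_pow (hσ0 : 0 < σ) (hσ : σ ≤ 1 / 40) (S : Finset (BitVec2 n))
    (F : BitVec2 n → ℝ) (hS : ∀ v ∈ S, σ * n < hammingNorm v)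
    (hF : ∀ v ∈ S, F v ≤ (σ ^ 2) ^ hammingNorm v) :
    ∑ v ∈ S, F v ≤ Real.exp (-(σ * n / 2)) := by
  have he := Real.exp_one_lt_d9
  calc ∑ v ∈ S, F v ≤ ∑ v ∈ S, Real.exp (-(σ * n)) * (Real.exp 1 * σ ^ 2) ^ hammingNorm v := by
        refine Finset.sum_le_sum fun v hv => (hF v hv).trans ?_
        -- Inserting exp(|v| - σn), at least one on S, allows an extension to all vectors, where the
        -- sum factors over coordinates.
        rw [mul_pow, ← mul_assoc, ← Real.exp_nat_mul, ← Real.exp_add]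
        refine le_mul_of_one_le_left (by positivity) (Real.one_le_exp ?_)
        linarith [hS v hv]
    _ ≤ ∑ v : BitVec2 n, Real.exp (-(σ * n)) * (Real.exp 1 * σ ^ 2) ^ hammingNorm v :=
        Finset.sum_le_sum_of_subset_of_nonneg (Finset.subset_univ S) fun _ _ _ => by positivity
    _ = Real.exp (-(σ * n)) * (1 + Real.exp 1 * σ ^ 2) ^ n := by
        rw [← Finset.mul_sum, sum_pow_hammingNorm]
    _ ≤ Real.exp (-(σ * n)) * Real.exp (Real.exp 1 * σ ^ 2) ^ n := by
        gcongr
        rw [add_comm]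
        exact Real.add_one_le_exp _
    _ = Real.exp (-(σ * n) + n * (Real.exp 1 * σ ^ 2)) := by
        rw [← Real.exp_nat_mul, ← Real.exp_add]
    _ ≤ _ := by
        apply Real.exp_le_exp.mpr
        have h1 : Real.exp 1 * σ ^ 2 ≤ σ / 2 := by nlinarith
        have h2 : (n : ℝ) * (Real.exp 1 * σ ^ 2) ≤ n * (σ / 2) := by gcongr
        linarith

/-- A sum over vectors is bounded by a uniform bound on the weight classes. -/
theorem sum_le_of_choose_mul_le (S : Finset (BitVec2 n)) (F : BitVec2 n → ℝ) {M : ℝ} (hM : 0 ≤ M)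
    (hF : ∀ v ∈ S, n.choose (hammingNorm v) * F v ≤ M) : ∑ v ∈ S, F v ≤ (n + 1) * M := by
  have hw : ∀ v : BitVec2 n, hammingNorm v ≤ n := fun v => by
    simpa using hammingNorm_le_card_fintype (x := v)
  have hc : ∀ w, w ≤ n → (0 : ℝ) < n.choose w := fun w h => by exact_mod_cast Nat.choose_pos h
  calc ∑ v ∈ S, F v ≤ ∑ v ∈ S, M / n.choose (hammingNorm v) := by
        refine Finset.sum_le_sum fun v hv => ?_
        rw [le_div_iff₀ (hc _ (hw v)), mul_comm]
        exact hF v hv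
    _ ≤ ∑ v : BitVec2 n, M / n.choose (hammingNorm v) :=
        Finset.sum_le_sum_of_subset_of_nonneg (Finset.subset_univ S) fun _ _ _ => by positivity
    _ = ∑ w ∈ Finset.range (n + 1), ∑ v ∈ sparse n w, M / n.choose (hammingNorm v) := by
        rw [← Finset.sum_fiberwise_of_maps_to (s := Finset.univ) (t := Finset.range (n + 1))
          (g := fun v : BitVec2 n => hammingNorm v)
          (fun v _ => Finset.mem_range.mpr (by have := hw v; omega))]
        rfl
    _ = ∑ w ∈ Finset.range (n + 1), M := by
        refine Finset.sum_congr rfl fun w hw' => ?_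
        rw [Finset.sum_congr rfl (g := fun _ => M / n.choose w)
          (fun v hv => by rw [mem_sparse.mp hv]), Finset.sum_const, card_sparse, nsmul_eq_mul,
          mul_div_cancel₀ _ (hc w (by simpa [Nat.lt_succ_iff] using hw')).ne']
    _ = _ := by simp

/-- Chernoff bound for binomial coefficients. -/
theorem choose_le_two_pow_mul_exp (n w : ℕ) (hw : w ≤ n) (hn : 0 < n) :
    (n.choose w : ℝ) ≤ 2 ^ n * Real.exp (-((n - 2 * w) ^ 2 / (2 * n))) := by
  have hn' : (0 : ℝ) < n := by exact_mod_cast hn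
  -- The optimal tilt for the bound cosh s ≤ exp(s²/2); the binomial coefficient is read off from
  -- one term of (exp(-s) + exp s)^n.
  set s : ℝ := (n - 2 * w) / n with hs
  have h1 : (n.choose w : ℝ) * Real.exp (s * (n - 2 * w)) ≤ (2 * Real.cosh s) ^ n := by
    have h2 : (2 * Real.cosh s) ^ n = (Real.exp (-s) + Real.exp s) ^ n := by
      rw [Real.cosh_eq]
      ring_nf
    rw [h2, add_pow]
    refine le_trans (le_of_eq ?_) (Finset.single_le_sum
      (f := fun m => Real.exp (-s) ^ m * Real.exp s ^ (n - m) * (n.choose m : ℝ))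
      (fun _ _ => by positivity) (Finset.mem_range.mpr (Nat.lt_succ_of_le hw)))
    rw [← Real.exp_nat_mul, ← Real.exp_nat_mul, ← Real.exp_add, mul_comm, Nat.cast_sub hw]
    congr 2
    ring
  have h3 : (2 * Real.cosh s) ^ n ≤ 2 ^ n * Real.exp (n * (s ^ 2 / 2)) := by
    rw [mul_pow, Real.exp_nat_mul]
    have := Real.cosh_pos s
    gcongr
    exact Real.cosh_le_exp_half_sq s
  have h4 := h1.trans h3
  rw [← le_div_iff₀ (Real.exp_pos _), mul_div_assoc, ← Real.exp_sub] at h4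
  refine h4.trans_eq ?_
  congr 2
  rw [hs]
  field_simp
  ring

theorem annihProb_le_one (v : BitVec2 n) : annihProb t v ≤ 1 := by
  have := (abs_le.mp (abs_krawtchouk_le_one (fun i => sgn (v i)) (fun i => sgn_sq _)
    Finset.univ t)).2
  unfold annihProb
  linarith

theorem annihProb_add_ones (ht : Even t) (v : BitVec2 n) :
    annihProb t (v + fun _ => 1) = annihProb t v := by
  unfold annihProb
  rw [krawtchouk_congr (y := fun i => -sgn (v i)), krawtchouk_neg, ht.neg_one_pow, one_mul]
  intro i _
  rw [Pi.add_apply, sgn_add, sgn_one, mul_neg_one]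

namespace WeightConditions

variable (hw : WeightConditions n t σ)
include hw

theorem σ_pos : 0 < σ := by
  rw [hw.σ_eq]
  exact Real.exp_pos _

theorem t_ge' : (16 : ℝ) ≤ t := by exact_mod_cast hw.t_ge

theorem n_ge : 256 * (t : ℝ) ≤ n := by
  have h1 := hw.t_sq_le
  have h2 := hw.t_le
  have h3 := hw.σ_pos
  have h4 := hw.σ_le
  have h5 := hw.t_ge'
  have h6 : σ ^ 2 ≤ 1 / 16 := by nlinarith
  have h7 : σ ^ 2 * n ≤ 1 / 16 * n := by gcongr
  linarith

theorem n_pos : 0 < n := by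
  have h1 := hw.n_ge
  have h2 := hw.t_ge'
  have : (0 : ℝ) < n := by linarith
  exact_mod_cast this

theorem σ_pow (w : ℕ) : (σ ^ 2) ^ w = Real.exp (-(w * t / 32)) := by
  rw [hw.σ_eq, ← Real.exp_nat_mul, ← Real.exp_nat_mul]
  congr 1
  push_cast
  ring

theorem t_le_σ : (t : ℝ) ≤ σ * n := by
  have h1 := hw.t_le
  have h3 := hw.σ_pos
  have h4 := hw.σ_le
  have h5 : σ ^ 2 * n ≤ σ * n := by
    gcongr
    nlinarith
  have : (0 : ℝ) ≤ t := Nat.cast_nonneg _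
  linarith

/-- A sparse row annihilates a light vector with small probability. -/
theorem annihProb_pow_le_of_light {v : BitVec2 n} (h1 : σ * n < hammingNorm v)
    (h2 : (hammingNorm v : ℝ) * t ≤ n) {r : ℕ} (hr : (n : ℝ) ≤ 8 * r) :
    annihProb t v ^ r ≤ (σ ^ 2) ^ hammingNorm v := by
  have hn : (0 : ℝ) < n := by exact_mod_cast hw.n_pos
  have ht := hw.t_ge'
  have hnt := hw.n_ge
  have hS := sum_sgn_eq v
  set w : ℝ := (hammingNorm v : ℝ) with hwdef
  have hwt : (t : ℝ) ≤ w := hw.t_le_σ.trans h1.le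
  have hw16 : w * 16 ≤ n := by nlinarith
  have hcard : ((Finset.univ : Finset (Fin n)).card : ℝ) = n := by simp
  have hk := krawtchouk_le_pow (s := Finset.univ) (t := t) (sgn_signs_sq v) (σ := 1 / 2)
    (by rw [hS, hcard]; linarith) (by norm_num) (by rw [hcard]; linarith)
    (by
      have : 2 * (t : ℝ) < n := by linarith
      rw [Finset.card_univ, Fintype.card_fin]
      exact_mod_cast this) le_rfl
  rw [hS, hcard] at hk
  have hd : (0 : ℝ) < n - t := by linarith
  have hq : (n - 2 * w) / (n - t) ≤ Real.exp (-(w / n)) := by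
    refine le_trans ?_ (Real.add_one_le_exp _)
    rw [div_le_iff₀ hd]
    have : (-(w / n) + 1) * (n - t) = n - t - w + w * t / n := by
      field_simp
      ring
    rw [this]
    have : 0 ≤ w * t / n := by positivity
    linarith
  have hq0 : 0 ≤ (n - 2 * w) / (n - t) := div_nonneg (by linarith) hd.le
  have hk2 : krawtchouk Finset.univ (fun i => sgn (v i)) t ≤ Real.exp (-(w * t / n)) := by
    refine hk.trans ((pow_le_pow_left₀ hq0 hq t).trans_eq ?_)
    rw [← Real.exp_nat_mul]
    congr 1
    ring
  set y := w * t / n with hy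
  have hy0 : 0 ≤ y := by positivity
  have hy1 : y ≤ 1 := by rw [hy, div_le_one hn]; exact h2
  have hexp : Real.exp (-y) ≤ 1 - y / 2 := by
    have h3 := Real.exp_bound' (x := y) hy0 hy1 (n := 1) (by norm_num)
    have h4 : 1 + y + y ^ 2 / 2 ≤ Real.exp y := Real.quadratic_le_exp_of_nonneg hy0
    rw [Real.exp_neg]
    refine inv_le_of_inv_le₀ (by linarith) ?_
    refine le_trans ?_ h4
    rw [inv_le_iff_one_le_mul₀ (by linarith)]
    nlinarith [mul_nonneg hy0 (sub_nonneg.mpr hy1), mul_nonneg hy0 hy0]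
  have ha : annihProb t v ≤ Real.exp (-(y / 4)) := by
    unfold annihProb
    have := Real.add_one_le_exp (-(y / 4))
    linarith
  -- The exponent is r w t/(4n), at least w t/32 because n ≤ 8r. This is the exponent of σ^(2w) for
  -- σ = exp(-t/64).
  rw [hw.σ_pow]
  refine (pow_le_pow_left₀ (annihProb_nonneg v) ha r).trans ?_
  rw [← Real.exp_nat_mul]
  apply Real.exp_le_exp.mpr
  rw [hy, ← hwdef]
  have h5 : w * t / 32 * (8 * r / n) = (r : ℝ) * (w * t / n / 4) := by
    field_simp
    ring
  have h6 : w * t / 32 * 1 ≤ w * t / 32 * (8 * r / n) := by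
    gcongr
    rw [le_div_iff₀ hn]
    linarith
  linarith

theorem krawtchouk_nonneg {v : BitVec2 n} (hv : σ * n < |∑ i, sgn (v i)|) :
    0 ≤ krawtchouk Finset.univ (fun i => sgn (v i)) t := by
  have hcard : ((Finset.univ : Finset (Fin n)).card : ℝ) = n := by simp
  have h4 : 4 * (t : ℝ) ≤ σ ^ 2 * (Finset.univ : Finset (Fin n)).card := by
    rw [hcard]
    have := hw.t_le
    have := hw.t_ge'
    linarith
  have h2 : 2 * t ≤ (Finset.univ : Finset (Fin n)).card := by
    rw [Finset.card_univ, Fintype.card_fin]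
    have h1 := hw.n_ge
    have h2 := hw.t_ge'
    have : 2 * (t : ℝ) ≤ n := by linarith
    exact_mod_cast this
  rcases lt_abs.mp hv with h | h
  · exact (krawtchouk_pos (sgn_signs_sq v) (by rw [hcard]; exact h.le) hw.σ_pos h4 h2 le_rfl).le
  · rw [← Finset.sum_neg_distrib] at h
    have := krawtchouk_pos (x := fun i => -sgn (v i)) (fun i => by simpa using sgn_sq (v i))
      (by rw [hcard]; exact h.le) hw.σ_pos h4 h2 (le_refl t)
    rw [krawtchouk_neg, hw.even.neg_one_pow, one_mul] at this
    exact this.le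

/-- With s the normalized sum of signs, the power bound is s² times s^(t - 2) times a factor close
to one. As s ≤ 1 - 2/t, the power s^(t - 2) is about exp(-2) or less, which yields the constant 1/4.
-/
theorem krawtchouk_le_sq_of_pos {v : BitVec2 n} (hv : σ * n < ∑ i, sgn (v i))
    (hv' : (∑ i, sgn (v i)) ≤ n - 2 * n / t) :
    krawtchouk Finset.univ (fun i => sgn (v i)) t ≤ ((∑ i, sgn (v i)) / n) ^ 2 / 4 := by
  have hn : (0 : ℝ) < n := by exact_mod_cast hw.n_pos
  have ht := hw.t_ge'
  have hnt := hw.n_ge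
  have hσ := hw.σ_pos
  have hcard : ((Finset.univ : Finset (Fin n)).card : ℝ) = n := by simp
  have hk := krawtchouk_le_pow (s := Finset.univ) (t := t) (sgn_signs_sq v) (σ := σ)
    (by rw [hcard]; exact hv.le) hσ (by rw [hcard]; linarith [hw.t_le])
    (by
      have : 2 * (t : ℝ) < n := by linarith
      rw [Finset.card_univ, Fintype.card_fin]
      exact_mod_cast this) le_rfl
  rw [hcard] at hk
  set s : ℝ := (∑ i, sgn (v i)) / n with hs
  have hS : ∑ i, sgn (v i) = s * n := by rw [hs]; field_simp
  rw [hS] at hk hv hv'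
  have hs0 : 0 < s := by
    have : 0 < s * n := lt_trans (by positivity) hv
    exact pos_of_mul_pos_left this hn.le
  have hs1 : s ≤ 1 - 2 / t := by
    have : s * n ≤ (1 - 2 / t) * n := by
      refine hv'.trans_eq ?_
      ring
    exact le_of_mul_le_mul_right this hn
  have hd : (0 : ℝ) < n - t := by linarith
  obtain ⟨m, hm⟩ : ∃ m, t = m + 2 := ⟨t - 2, by have := hw.t_ge; omega⟩
  have hfac : (s * n / (n - t)) ^ t = s ^ 2 * (s ^ m * (n / (n - t)) ^ t) := by
    rw [mul_div_assoc, mul_pow, hm, pow_add s]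
    ring
  have h1 : s ^ m ≤ Real.exp (-(2 - 4 / t)) := by
    have h2 : s ≤ Real.exp (-(2 / t)) := by linarith [Real.add_one_le_exp (-(2 / (t : ℝ)))]
    refine (pow_le_pow_left₀ hs0.le h2 m).trans_eq ?_
    rw [← Real.exp_nat_mul]
    congr 1
    have : (t : ℝ) = m + 2 := by exact_mod_cast hm
    have hm' : (m : ℝ) = t - 2 := by linarith
    rw [hm']
    field_simp
    ring
  have h3 : (n / (n - t) : ℝ) ^ t ≤ Real.exp (1 / 4) := by
    have h4 : (n / (n - t) : ℝ) ≤ Real.exp (t / (n - t)) := by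
      have h5 : (n / (n - t) : ℝ) = t / (n - t) + 1 := by
        field_simp
        ring
      rw [h5]
      exact Real.add_one_le_exp _
    refine (pow_le_pow_left₀ (by positivity) h4 t).trans ?_
    rw [← Real.exp_nat_mul]
    apply Real.exp_le_exp.mpr
    rw [mul_div_assoc', div_le_iff₀ hd]
    have := hw.t_sq_le
    nlinarith
  have h6 : s ^ m * (n / (n - t)) ^ t ≤ 1 / 4 := by
    calc _ ≤ Real.exp (-(2 - 4 / t)) * Real.exp (1 / 4) := by gcongr
      _ = Real.exp (-(2 - 4 / t) + 1 / 4) := (Real.exp_add _ _).symm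
      _ ≤ Real.exp (-(3 / 2)) := by
          apply Real.exp_le_exp.mpr
          have : 4 / (t : ℝ) ≤ 4 / 16 := by gcongr
          linarith
      _ ≤ 1 / 4 := by
          rw [Real.exp_neg]
          refine inv_le_of_inv_le₀ (by norm_num) ?_
          have h7 := Real.sum_le_exp_of_nonneg (x := 3 / 2) (by norm_num) 5
          norm_num [Finset.sum_range_succ, Nat.factorial] at h7 ⊢
          linarith
  calc _ ≤ _ := hk
    _ = s ^ 2 * (s ^ m * (n / (n - t)) ^ t) := hfac
    _ ≤ s ^ 2 * (1 / 4) := by gcongr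
    _ = _ := by ring

theorem krawtchouk_le_sq {v : BitVec2 n} (hv : σ * n < |∑ i, sgn (v i)|)
    (hv' : |∑ i, sgn (v i)| ≤ n - 2 * n / t) :
    krawtchouk Finset.univ (fun i => sgn (v i)) t ≤ ((∑ i, sgn (v i)) / n) ^ 2 / 4 := by
  rcases lt_abs.mp hv with h | h
  · exact hw.krawtchouk_le_sq_of_pos h ((le_abs_self _).trans hv')
  · have hneg : ∑ i, sgn ((v + fun _ => 1 : BitVec2 n) i) = -∑ i, sgn (v i) := by
      rw [← Finset.sum_neg_distrib]
      refine Finset.sum_congr rfl fun i _ => ?_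
      rw [Pi.add_apply, sgn_add, sgn_one, mul_neg_one]
    have h1 := hw.krawtchouk_le_sq_of_pos (v := v + fun _ => 1) (by rwa [hneg])
      (by rw [hneg]; exact (neg_le_abs _).trans hv')
    have h2 := annihProb_add_ones hw.even v
    unfold annihProb at h2
    rw [hneg, neg_div, neg_sq] at h1
    linarith

/-- With S the sum of signs, the Chernoff saving S²/(2n) on the weight class beats the excess
annihilation probability, worth S²/(4n) over n rows. -/
theorem choose_mul_annihProb_pow_le {v : BitVec2 n} (hv : σ * n < |∑ i, sgn (v i)|)
    (hv' : |∑ i, sgn (v i)| ≤ n - 2 * n / t) :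
    n.choose (hammingNorm v) * annihProb t v ^ n ≤ Real.exp (-(σ ^ 2 * n / 4)) := by
  have hn : (0 : ℝ) < n := by exact_mod_cast hw.n_pos
  have h1 := hw.krawtchouk_le_sq hv hv'
  have h0 := hw.krawtchouk_nonneg hv
  have hσ := hw.σ_pos
  have h2 := choose_le_two_pow_mul_exp n (hammingNorm v)
    (by simpa using hammingNorm_le_card_fintype (x := v)) hw.n_pos
  rw [← sum_sgn_eq] at h2
  set S := ∑ i, sgn (v i)
  have hS : σ ^ 2 * n ≤ S ^ 2 / n := by
    rw [le_div_iff₀ hn]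
    have : (σ * n) ^ 2 ≤ |S| ^ 2 := by gcongr
    rw [sq_abs] at this
    linarith
  calc _ ≤ 2 ^ n * Real.exp (-(S ^ 2 / (2 * n))) * annihProb t v ^ n := by
        have := pow_nonneg (annihProb_nonneg (t := t) v) n
        gcongr
    _ = Real.exp (-(S ^ 2 / (2 * n))) *
        (1 + krawtchouk Finset.univ (fun i => sgn (v i)) t) ^ n := by
        rw [annihProb, div_pow]
        field_simp
    _ ≤ Real.exp (-(S ^ 2 / (2 * n))) * Real.exp ((S / n) ^ 2 / 4) ^ n := by
        gcongr
        rw [add_comm]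
        exact (Real.add_one_le_exp _).trans (Real.exp_le_exp.mpr h1)
    _ = Real.exp (-(S ^ 2 / n / 4)) := by
        rw [← Real.exp_nat_mul, ← Real.exp_add]
        congr 1
        field_simp
        ring
    _ ≤ _ := by
        apply Real.exp_le_exp.mpr
        linarith

theorem sum_midWeight_le {r : ℕ} (hr : (n : ℝ) ≤ 8 * r) :
    ∑ v ∈ midWeight n σ, annihProb t v ^ r ≤ Real.exp (-(σ * n / 2)) := by
  refine sum_le_exp_of_le_pow hw.σ_pos hw.σ_le _ _ (fun v hv => (Finset.mem_filter.mp hv).2.1)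
    fun v hv => hw.annihProb_pow_le_of_light (Finset.mem_filter.mp hv).2.1 ?_ hr
  have h1 := (Finset.mem_filter.mp hv).2.2
  have h2 := hw.tσ_le
  have h3 : (0 : ℝ) ≤ t := Nat.cast_nonneg _
  calc (hammingNorm v : ℝ) * t ≤ 2 * (σ * n) * t := by gcongr
    _ = 2 * t * σ * n := by ring
    _ ≤ 1 * n := by gcongr
    _ = n := one_mul _

/-- Complementation preserves `annihProb` for even t and turns heavy vectors into light ones. -/
theorem sum_heavy_le (S : Finset (BitVec2 n)) (h1 : ∀ v ∈ S, (hammingNorm v : ℝ) < n - σ * n)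
    (h2 : ∀ v ∈ S, (n - hammingNorm v : ℝ) * t ≤ n) :
    ∑ v ∈ S, annihProb t v ^ n ≤ Real.exp (-(σ * n / 2)) := by
  classical
  have hinj : Function.Injective fun v : BitVec2 n => v + fun _ => 1 :=
    add_left_injective _
  have e : ∑ v ∈ S, annihProb t v ^ n =
      ∑ v ∈ S.image (fun v : BitVec2 n => v + fun _ => 1), annihProb t v ^ n := by
    rw [Finset.sum_image hinj.injOn]
    exact Finset.sum_congr rfl fun v _ => (congrArg (· ^ n) (annihProb_add_ones hw.even v)).symm
  have hn8 : (n : ℝ) ≤ 8 * (n : ℕ) := by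
    have : (0 : ℝ) ≤ n := Nat.cast_nonneg _
    linarith
  rw [e]
  have h3 : ∀ v ∈ S.image (fun v : BitVec2 n => v + fun _ => 1),
      σ * n < hammingNorm v ∧ (hammingNorm v : ℝ) * t ≤ n := by
    intro v hv
    obtain ⟨w, hwS, rfl⟩ := Finset.mem_image.mp hv
    have h4 := h1 w hwS
    rw [hammingNorm_add_ones]
    exact ⟨by linarith, h2 w hwS⟩
  exact sum_le_exp_of_le_pow hw.σ_pos hw.σ_le _ _ (fun v hv => (h3 v hv).1)
    fun v hv => hw.annihProb_pow_le_of_light (h3 v hv).1 (h3 v hv).2 hn8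

/-- Weights below n/t and above n - n/t use the decay for light vectors. In between, the sum of
signs is at most n - 2n/t in absolute value and `choose_mul_annihProb_pow_le` applies. -/
theorem sum_unstructured_le :
    ∑ v ∈ unstructured n σ, annihProb t v ^ n ≤
      2 * Real.exp (-(σ * n / 2)) + (n + 1) * Real.exp (-(σ ^ 2 * n / 4)) := by
  classical
  have hn : (0 : ℝ) < n := by exact_mod_cast hw.n_pos
  have ht := hw.t_ge'
  set S := unstructured n σ
  have hn8 : (n : ℝ) ≤ 8 * (n : ℕ) := by linarith
  have h1 : ∑ v ∈ S.filter (fun v => (hammingNorm v : ℝ) * t ≤ n), annihProb t v ^ n ≤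
      Real.exp (-(σ * n / 2)) := by
    refine sum_le_exp_of_le_pow hw.σ_pos hw.σ_le _ _ (fun v hv => ?_) fun v hv => ?_
    · exact (Finset.mem_filter.mp (Finset.mem_filter.mp hv).1).2.1.1
    · exact hw.annihProb_pow_le_of_light (Finset.mem_filter.mp (Finset.mem_filter.mp hv).1).2.1.1
        (Finset.mem_filter.mp hv).2 hn8
  have h2 : ∑ v ∈ S.filter (fun v => (n - hammingNorm v : ℝ) * t ≤ n), annihProb t v ^ n ≤
      Real.exp (-(σ * n / 2)) :=
    hw.sum_heavy_le _ (fun v hv => (Finset.mem_filter.mp (Finset.mem_filter.mp hv).1).2.1.2)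
      fun v hv => (Finset.mem_filter.mp hv).2
  have h3 : ∑ v ∈ S.filter (fun v => ¬ ((hammingNorm v : ℝ) * t ≤ n) ∧
      ¬ ((n - hammingNorm v : ℝ) * t ≤ n)), annihProb t v ^ n ≤
      (n + 1) * Real.exp (-(σ ^ 2 * n / 4)) := by
    refine sum_le_of_choose_mul_le _ _ (Real.exp_pos _).le fun v hv => ?_
    obtain ⟨hv, h4, h5⟩ := Finset.mem_filter.mp hv
    refine hw.choose_mul_annihProb_pow_le (Finset.mem_filter.mp hv).2.2 ?_
    push Not at h4 h5
    have e1 : (n : ℝ) / t < hammingNorm v := by rwa [div_lt_iff₀ (by linarith)]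
    have e2 : (n : ℝ) / t < n - hammingNorm v := by rwa [div_lt_iff₀ (by linarith)]
    rw [sum_sgn_eq, mul_div_assoc, abs_le]
    constructor <;> linarith
  have hcover : S ⊆ (S.filter (fun v => (hammingNorm v : ℝ) * t ≤ n) ∪
      S.filter (fun v => (n - hammingNorm v : ℝ) * t ≤ n)) ∪
      S.filter (fun v => ¬ ((hammingNorm v : ℝ) * t ≤ n) ∧
        ¬ ((n - hammingNorm v : ℝ) * t ≤ n)) := by
    intro v hv
    simp only [Finset.mem_union, Finset.mem_filter]
    tauto
  have hnn : ∀ v : BitVec2 n, 0 ≤ annihProb t v ^ n := fun v => pow_nonneg (annihProb_nonneg v) n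
  refine (Finset.sum_le_sum_of_subset_of_nonneg hcover fun v _ _ => hnn v).trans ?_
  have hu : ∀ A B : Finset (BitVec2 n), ∑ v ∈ A ∪ B, annihProb t v ^ n ≤
      ∑ v ∈ A, annihProb t v ^ n + ∑ v ∈ B, annihProb t v ^ n := by
    intro A B
    rw [← Finset.sum_union_inter]
    exact le_add_of_nonneg_right (Finset.sum_nonneg fun v _ => hnn v)
  refine (hu _ _).trans ((add_le_add (hu _ _) le_rfl).trans ?_)
  linarith

/-- r = n is the worst case: up to n rows the product is (1 + κ)^r/2^n with κ ≥ 0 the Krawtchouk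
value, which increases in r; beyond n the minimum is replaced by 1 and powers of a probability
decrease. -/
theorem min_mul_annihProb_pow_le {v : BitVec2 n} (hv : σ * n < |∑ i, sgn (v i)|) (r : ℕ) :
    min 1 (2 ^ r / 2 ^ n) * annihProb t v ^ r ≤ annihProb t v ^ n := by
  have h0 := hw.krawtchouk_nonneg hv
  have ha0 := annihProb_nonneg (t := t) v
  rcases le_total r n with h | h
  · calc _ ≤ 2 ^ r / 2 ^ n * annihProb t v ^ r := by
          gcongr
          exact min_le_right _ _
      _ = (1 + krawtchouk Finset.univ (fun i => sgn (v i)) t) ^ r / 2 ^ n := by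
          rw [annihProb, div_pow]
          field_simp
      _ ≤ (1 + krawtchouk Finset.univ (fun i => sgn (v i)) t) ^ n / 2 ^ n := by
          gcongr
          linarith
      _ = _ := by rw [annihProb, div_pow]
  · calc _ ≤ 1 * annihProb t v ^ r := by
          gcongr
          exact min_le_left _ _
      _ ≤ _ := by
          rw [one_mul]
          exact pow_le_pow_of_le_one ha0 (annihProb_le_one v) h

theorem min_mul_sum_unstructured_le (r : ℕ) :
    min 1 (2 ^ r / 2 ^ n) * ∑ v ∈ unstructured n σ, annihProb t v ^ r ≤
      2 * Real.exp (-(σ * n / 2)) + (n + 1) * Real.exp (-(σ ^ 2 * n / 4)) := by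
  refine le_trans ?_ hw.sum_unstructured_le
  rw [Finset.mul_sum]
  exact Finset.sum_le_sum fun v hv => hw.min_mul_annihProb_pow_le (Finset.mem_filter.mp hv).2.2 r

/-- Beyond the unstructured vectors there are only near-constant ones. Each weight class of these
has at most 2^n exp(-9n/20) members, and 2^r ≤ exp(7n/20) for 2r ≤ n, so counting suffices without
any annihilation estimate. -/
theorem min_mul_sum_nonConstUnbalanced_le {r : ℕ} (hr : 2 * r ≤ n) :
    min 1 (2 ^ r / 2 ^ n) * ∑ v ∈ nonConstUnbalanced n σ, annihProb t v ^ r ≤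
      2 * Real.exp (-(σ * n / 2)) + (n + 1) * Real.exp (-(σ ^ 2 * n / 4)) +
        (n + 1) * Real.exp (-(n / 10)) := by
  classical
  have hn : (0 : ℝ) < n := by exact_mod_cast hw.n_pos
  have hσ := hw.σ_pos
  have hσ' := hw.σ_le
  have hnn : ∀ v : BitVec2 n, 0 ≤ min (1 : ℝ) (2 ^ r / 2 ^ n) * annihProb t v ^ r :=
    fun v => mul_nonneg (by positivity) (pow_nonneg (annihProb_nonneg v) r)
  rw [Finset.mul_sum, ← Finset.sum_filter_add_sum_filter_not _ (fun v => v ∈ unstructured n σ)]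
  refine add_le_add ?_ ?_
  · refine le_trans ?_ (hw.min_mul_sum_unstructured_le r)
    rw [Finset.mul_sum]
    refine Finset.sum_le_sum_of_subset_of_nonneg (fun v hv => (Finset.mem_filter.mp hv).2)
      fun v _ _ => hnn v
  · refine sum_le_of_choose_mul_le _ _ (Real.exp_pos _).le fun v hv => ?_
    obtain ⟨h1, h2⟩ := Finset.mem_filter.mp hv
    have h3 := (Finset.mem_filter.mp h1).2.2
    have h4 := choose_le_two_pow_mul_exp n (hammingNorm v)
      (by simpa using hammingNorm_le_card_fintype (x := v)) hw.n_pos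
    have h5 : (n : ℝ) ^ 2 * (9 / 10) ≤ ((n : ℝ) - 2 * hammingNorm v) ^ 2 := by
      have h6 : (19 / 20 * (n : ℝ)) ≤ |(n : ℝ) - 2 * hammingNorm v| := by
        by_contra! h7
        obtain ⟨h8, h9⟩ := abs_lt.mp h7
        refine h2 (Finset.mem_filter.mpr ⟨Finset.mem_univ _, ⟨?_, ?_⟩, h3⟩) <;> nlinarith
      have : (19 / 20 * (n : ℝ)) ^ 2 ≤ |(n : ℝ) - 2 * hammingNorm v| ^ 2 := by gcongr
      rw [sq_abs] at this
      nlinarith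
    have h6 : Real.exp (-(((n : ℝ) - 2 * hammingNorm v) ^ 2 / (2 * n))) ≤
        Real.exp (-(9 / 20 * n)) := by
      apply Real.exp_le_exp.mpr
      rw [neg_le_neg_iff, le_div_iff₀ (by positivity)]
      linarith
    have h7 : (2 : ℝ) ^ r ≤ Real.exp (7 / 20 * n) := by
      have h8 : (2 : ℝ) ≤ Real.exp (7 / 10) := by
        have := Real.log_two_lt_d9
        rw [← Real.log_le_iff_le_exp (by norm_num)]
        linarith
      calc (2 : ℝ) ^ r ≤ Real.exp (7 / 10) ^ r := by gcongr
        _ = Real.exp (r * (7 / 10)) := by rw [← Real.exp_nat_mul]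
        _ ≤ _ := by
            apply Real.exp_le_exp.mpr
            have : 2 * (r : ℝ) ≤ n := by exact_mod_cast hr
            linarith
    have ha : annihProb t v ^ r ≤ 1 := pow_le_one₀ (annihProb_nonneg v) (annihProb_le_one v)
    calc _ ≤ (2 ^ n * Real.exp (-(9 / 20 * n))) * (2 ^ r / 2 ^ n * 1) := by
          have h9 : min (1 : ℝ) (2 ^ r / 2 ^ n) ≤ 2 ^ r / 2 ^ n := min_le_right _ _
          have := pow_nonneg (annihProb_nonneg (t := t) v) r
          gcongr
          exact h4.trans (by gcongr)
      _ = 2 ^ r * Real.exp (-(9 / 20 * n)) := by field_simp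
      _ ≤ Real.exp (7 / 20 * n) * Real.exp (-(9 / 20 * n)) := by gcongr
      _ = _ := by
          rw [← Real.exp_add]
          congr 1
          ring

end WeightConditions

end Estimates

/-! ### Reduction of the robustness game to the counting problem -/

section Game

open Classical in
/-- An adversary that sees only the second component of a pair does no better than the best
deterministic choice of an error. -/
theorem exists_deterministic_error {α β γ ε : Type*} [Fintype α] [Fintype β] (μ : PMF (α × β))
    (Q : β → PMF γ) (S : Finset ε) (hS : S.Nonempty) (e : β → γ → ε) (he : ∀ b c, e b c ∈ S)
    (W : α → β → γ → Prop) (L : α → ε → Prop)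
    (hWL : ∀ a b c, (a, b) ∈ μ.support → W a b c → L a (e b c)) :
    ∃ f : β → ε, (∀ b, f b ∈ S) ∧
      (μ.bind fun ab => (Q ab.2).map fun c => decide (W ab.1 ab.2 c)) true ≤
        ∑ b, ∑ a, μ (a, b) * if L a (f b) then 1 else 0 := by
  choose f hfS hf using fun b => S.exists_max_image
    (fun x => ∑ a, μ (a, b) * if L a x then 1 else 0) hS
  refine ⟨f, hfS, ?_⟩
  rw [PMF.bind_apply, tsum_fintype, Fintype.sum_prod_type, Finset.sum_comm]
  refine Finset.sum_le_sum fun b _ => ?_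
  have h1 : ∀ a, μ (a, b) * ((Q b).map fun c => decide (W a b c)) true ≤
      ∑' c, Q b c * (μ (a, b) * if L a (e b c) then 1 else 0) := by
    intro a
    rw [PMF.map_apply, ← ENNReal.tsum_mul_left]
    refine ENNReal.tsum_le_tsum fun c => ?_
    by_cases hW : W a b c
    · by_cases h0 : μ (a, b) = 0
      · simp [h0]
      · have := hWL a b c ((PMF.mem_support_iff _ _).mpr h0) hW
        simp [hW, this, mul_comm]
    · simp [hW]
  calc _ ≤ ∑ a, ∑' c, Q b c * (μ (a, b) * if L a (e b c) then 1 else 0) :=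
        Finset.sum_le_sum fun a _ => h1 a
    _ = ∑' c, Q b c * ∑ a, (μ (a, b) * if L a (e b c) then 1 else 0) := by
        rw [← Summable.tsum_finsetSum fun _ _ => ENNReal.summable]
        simp_rw [Finset.mul_sum]
    _ ≤ ∑' c, Q b c * ∑ a, (μ (a, b) * if L a (f b) then 1 else 0) :=
        ENNReal.tsum_le_tsum fun c => mul_le_mul_right (hf b _ (he b c)) _
    _ = _ := by rw [ENNReal.tsum_mul_right, PMF.tsum_coe, one_mul]

theorem ldpc_apply {n d t r : ℕ} (h : t ≤ n) (H : Matrix (Fin r) (Fin n) (ZMod 2))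
    (G : Matrix (Fin n) (Fin d) (ZMod 2)) :
    ldpc n d t r h (H, G) =
      PMF.uniformOfFinset (sparseMatrices r n t) (sparseMatrices_nonempty h) H *
        PMF.uniformOfFinset (kernelMatrices H d) (kernelMatrices_nonempty H d) G := by
  classical
  rw [ldpc, PMF.bind_apply, tsum_eq_single H]
  · rw [PMF.map_apply, tsum_eq_single G]
    · simp
    · intro G' hG'
      simp [hG'.symm]
  · intro H' hH'
    rw [PMF.map_apply]
    simp [hH'.symm]

theorem mem_sparseMatrices {r n t : ℕ} {H : Matrix (Fin r) (Fin n) (ZMod 2)} :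
    H ∈ sparseMatrices r n t ↔ ∀ i, hammingNorm (H i) = t := by
  simp [sparseMatrices]

theorem sparseMatrices_eq (r n t : ℕ) : sparseMatrices r n t = rowTuples (Fin r) n t :=
  Finset.ext fun _ => mem_sparseMatrices.trans mem_rowTuples.symm

theorem card_sparseMatrices (r n t : ℕ) : (sparseMatrices r n t).card = n.choose t ^ r := by
  have h := card_rowTuples (Fin r) n t
  rw [Fintype.card_fin] at h
  exact (congrArg Finset.card (sparseMatrices_eq r n t)).trans h

theorem mem_kernelMatrices {r n d : ℕ} {H : Matrix (Fin r) (Fin n) (ZMod 2)}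
    {G : Matrix (Fin n) (Fin d) (ZMod 2)} : G ∈ kernelMatrices H d ↔ H * G = 0 := by
  simp [kernelMatrices]

theorem kernelMatrices_eq {r n : ℕ} (H : Matrix (Fin r) (Fin n) (ZMod 2)) (d : ℕ) :
    kernelMatrices H d = matsIn (kerRows H) d := by
  ext G
  rw [mem_kernelMatrices, mem_matsIn]
  constructor
  · intro h u i
    have : H.mulVec (G.mulVec u) = 0 := by rw [Matrix.mulVec_mulVec, h, Matrix.zero_mulVec]
    exact congrFun this i
  · intro h
    refine Matrix.ext_of_mulVec_single fun j => ?_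
    rw [← Matrix.mulVec_mulVec, Matrix.zero_mulVec]
    exact funext fun i => h _ i

open Classical in
theorem toReal_sum_ldpc_mul {n d t r : ℕ} (h : t ≤ n)
    (L : Matrix (Fin r) (Fin n) (ZMod 2) → Matrix (Fin n) (Fin d) (ZMod 2) → Prop) :
    (∑ G, ∑ H, ldpc n d t r h (H, G) * if L H G then 1 else 0).toReal =
      ((n.choose t : ℝ) ^ r)⁻¹ * ∑ H ∈ rowTuples (Fin r) n t, matProb (kerRows H) d (L H) := by
  have e : ∑ H ∈ sparseMatrices r n t, matProb (kerRows H) d (L H) =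
      ∑ H ∈ rowTuples (Fin r) n t, matProb (kerRows H) d (L H) :=
    congrArg (fun s : Finset (Fin r → BitVec2 n) => ∑ H ∈ s, matProb (kerRows H) d (L H))
      (sparseMatrices_eq r n t)
  rw [← e]
  have h1 : ∀ H G, ldpc n d t r h (H, G) * (if L H G then 1 else 0) =
      if H ∈ sparseMatrices r n t then
        (if G ∈ (matsIn (kerRows H) d).filter (L H) then
          ((n.choose t ^ r : ℕ) : ENNReal)⁻¹ * ((Nat.card (kerRows H) ^ d : ℕ) : ENNReal)⁻¹ else 0)
        else 0 := by
    intro H G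
    rw [ldpc_apply, PMF.uniformOfFinset_apply, PMF.uniformOfFinset_apply, card_sparseMatrices,
      kernelMatrices_eq, card_matsIn]
    by_cases h1 : H ∈ sparseMatrices r n t <;> by_cases h2 : G ∈ matsIn (kerRows H) d <;>
      by_cases h3 : L H G <;> simp [h1, h2, h3]
  rw [Finset.sum_comm]
  simp_rw [h1]
  have h2 : ∀ H : Matrix (Fin r) (Fin n) (ZMod 2),
      (∑ G, if H ∈ sparseMatrices r n t then
        (if G ∈ (matsIn (kerRows H) d).filter (L H) then
          ((n.choose t ^ r : ℕ) : ENNReal)⁻¹ * ((Nat.card (kerRows H) ^ d : ℕ) : ENNReal)⁻¹ else 0)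
        else 0) = if H ∈ sparseMatrices r n t then
          (((matsIn (kerRows H) d).filter (L H)).card : ENNReal) *
          (((n.choose t ^ r : ℕ) : ENNReal)⁻¹ * ((Nat.card (kerRows H) ^ d : ℕ) : ENNReal)⁻¹)
          else 0 := by
    intro H
    split_ifs
    · rw [Finset.sum_ite_mem, Finset.univ_inter, Finset.sum_const, nsmul_eq_mul]
    · simp
  simp_rw [h2]
  rw [Finset.sum_ite_mem, Finset.univ_inter, ENNReal.toReal_sum, Finset.mul_sum]
  · refine Finset.sum_congr rfl fun H _ => ?_
    simp only [ENNReal.toReal_mul, ENNReal.toReal_inv, ENNReal.toReal_natCast, matProb]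
    push_cast
    ring
  · intro H _
    have hC : n.choose t ^ r ≠ 0 := (pow_pos (Nat.choose_pos h) r).ne'
    have hK : Nat.card (kerRows H) ^ d ≠ 0 := (pow_pos (nat_card_pos _) d).ne'
    refine ENNReal.mul_ne_top (ENNReal.natCast_ne_top _) (ENNReal.mul_ne_top ?_ ?_) <;>
      rw [ENNReal.inv_ne_top] <;> exact_mod_cast ‹_›

/-- Two syndromes agree on words that differ by a codeword. -/
theorem mulVec_add_codeword {r n d : ℕ} {H : Matrix (Fin r) (Fin n) (ZMod 2)}
    {G : Matrix (Fin n) (Fin d) (ZMod 2)} (hHG : H * G = 0) (x z e : BitVec2 n) (u : BitVec2 d) :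
    H.mulVec (x + (G.mulVec u + z + e) + e) = H.mulVec (x + z) := by
  have he : e + e = 0 := by
    ext i
    exact CharTwo.add_self_eq_zero (e i)
  have : x + (G.mulVec u + z + e) + e = (x + z) + G.mulVec u + (e + e) := by abel
  rw [this, he, add_zero, Matrix.mulVec_add, Matrix.mulVec_mulVec, hHG, Matrix.zero_mulVec,
    add_zero]

theorem looksUnbiased_of_le_hammingNorm {r n : ℕ} {H : Matrix (Fin r) (Fin n) (ZMod 2)}
    {e : BitVec2 n} {ζ : ℝ} (h : (1 / 2 - ζ) * r ≤ hammingNorm (H.mulVec e)) :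
    LooksUnbiased ζ H e := by
  have h1 := sum_sgn_eq (H.mulVec e)
  have h2 : ∑ i, sgn (dotProduct (H i) e) = r - 2 * hammingNorm (H.mulVec e) := h1
  change ∑ i, sgn (dotProduct (H i) e) ≤ 2 * ζ * Fintype.card (Fin r)
  rw [h2, Fintype.card_fin]
  linarith

theorem hammingNorm_add_le {n : ℕ} (v w : BitVec2 n) :
    hammingNorm (v + w) ≤ hammingNorm v + hammingNorm w := by
  have h := hammingDist_triangle v 0 w
  have hw : ∀ v : BitVec2 n, -v = v := fun v => by
    ext i
    exact CharTwo.neg_eq (v i)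
  have hd : hammingDist v w = hammingNorm (v + w) := by
    rw [hammingDist_eq_hammingNorm, hw]
  rwa [hammingDist_zero_right, hammingDist_zero_left, hd] at h

namespace LDPCParams

variable (P : LDPCParams)

/-- The advantage in the robustness game is bounded by the probability that a low-weight error,
chosen as a function of `G`, looks unbiased to the parity checks. -/
theorem robustGame_le {δ α : ℝ} {k : ℕ} (hα : 0 ≤ α) (hδα : δ + P.η k ≤ α)
    (A : P.zeroBitCode.Adversary) :
    ∃ f : Matrix (Fin (P.n k)) (Fin (P.d k)) (ZMod 2) → BitVec2 (P.n k),
      (∀ G, (hammingNorm (f G) : ℝ) ≤ α * P.n k) ∧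
      (P.zeroBitCode.robustGame δ A k true).toReal ≤
        (((P.n k).choose (P.t k) : ℝ) ^ P.r k)⁻¹ *
          ∑ H ∈ rowTuples (Fin (P.r k)) (P.n k) (P.t k),
            matProb (kerRows H) (P.d k) fun G => LooksUnbiased (P.ζ k) H (f G) := by
  classical
  -- The shift z is independent of the code, so together with the adversary's output it counts as
  -- randomness whose law depends on G alone.
  let Q : Matrix (Fin (P.n k)) (Fin (P.d k)) (ZMod 2) →
      PMF (BitVec2 (P.n k) × (Unit × (BitVec2 (P.d k) × P.Noise k) × BitVec2 (P.n k))) := fun G =>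
    (PMF.uniformOfFintype (BitVec2 (P.n k))).bind fun z => (A k (G, z)).map fun a => (z, a)
  let W : Matrix (Fin (P.r k)) (Fin (P.n k)) (ZMod 2) →
      Matrix (Fin (P.n k)) (Fin (P.d k)) (ZMod 2) →
      BitVec2 (P.n k) × (Unit × (BitVec2 (P.d k) × P.Noise k) × BitVec2 (P.n k)) → Prop :=
    fun H G c => P.zeroBitCode.Wins δ k (H, c.1) (G, c.1) c.2
  -- The error is x + c + e*, that is x + z up to an element of ker H. Words outside the radius get
  -- the default 0, so that the weight bound holds for every output.
  let e : Matrix (Fin (P.n k)) (Fin (P.d k)) (ZMod 2) →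
      BitVec2 (P.n k) × (Unit × (BitVec2 (P.d k) × P.Noise k) × BitVec2 (P.n k)) →
      BitVec2 (P.n k) := fun G c =>
    if (hammingNorm (c.2.2.2 + (G.mulVec c.2.2.1.1 + c.1 + c.2.2.1.2.1)) : ℝ) ≤ δ * P.n k then
      c.2.2.2 + (G.mulVec c.2.2.1.1 + c.1 + c.2.2.1.2.1) + c.2.2.1.2.1 else 0
  have hgame : P.zeroBitCode.robustGame δ A k =
      (ldpc (P.n k) (P.d k) (P.t k) (P.r k) (P.t_le k)).bind fun HG =>
        (Q HG.2).map fun c => decide (W HG.1 HG.2 c) := by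
    unfold PublicKeyCode.robustGame
    change PMF.bind (PMF.bind _ _) _ = _
    refine (PMF.bind_bind _ _ _).trans (congrArg (PMF.bind _) (funext fun HG => ?_))
    refine (PMF.bind_map _ _ _).trans ?_
    rw [PMF.map_bind]
    refine congrArg (PMF.bind _) (funext fun z => ?_)
    exact (PMF.map_comp (fun a => (z, a)) (A k (HG.2, z))
      (fun c => decide (W HG.1 HG.2 c))).symm
  have hn : (0 : ℝ) ≤ P.n k := Nat.cast_nonneg _
  obtain ⟨f, hfS, hf⟩ := exists_deterministic_error
    (ldpc (P.n k) (P.d k) (P.t k) (P.r k) (P.t_le k)) Q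
    (Finset.univ.filter fun v : BitVec2 (P.n k) => (hammingNorm v : ℝ) ≤ α * P.n k)
    ⟨0, by simpa using mul_nonneg hα hn⟩ e
    (fun G c => by
      refine Finset.mem_filter.mpr ⟨Finset.mem_univ _, ?_⟩
      simp only [e]
      split_ifs with hc
      · have h1 := hammingNorm_add_le (c.2.2.2 + (G.mulVec c.2.2.1.1 + c.1 + c.2.2.1.2.1))
          c.2.2.1.2.1
        rw [c.2.2.1.2.2] at h1
        have h2 := Nat.floor_le (mul_nonneg (P.η_mem k).1 hn)
        have h3 : (hammingNorm (c.2.2.2 + (G.mulVec c.2.2.1.1 + c.1 + c.2.2.1.2.1) +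
          c.2.2.1.2.1) : ℝ) ≤ hammingNorm (c.2.2.2 + (G.mulVec c.2.2.1.1 + c.1 +
            c.2.2.1.2.1)) + (⌊P.η k * P.n k⌋₊ : ℝ) := by exact_mod_cast h1
        nlinarith
      · simpa using mul_nonneg hα hn) W (LooksUnbiased (P.ζ k))
    (fun H G c hHG hW => by
      rw [PMF.mem_support_iff, ldpc_apply] at hHG
      have hG : H * G = 0 := by
        rw [← mem_kernelMatrices]
        by_contra hG
        rw [PMF.uniformOfFinset_apply_of_notMem _ hG, mul_zero] at hHG
        exact hHG rfl
      obtain ⟨h1, h2⟩ := hW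
      have h1' : (hammingNorm (c.2.2.2 + (G.mulVec c.2.2.1.1 + c.1 + c.2.2.1.2.1)) : ℝ) ≤
        δ * P.n k := h1
      simp only [e, if_pos h1']
      apply looksUnbiased_of_le_hammingNorm
      rw [mulVec_add_codeword hG]
      by_contra! h3
      exact h2 (if_pos h3))
  refine ⟨f, fun G => (Finset.mem_filter.mp (hfS G)).2, ?_⟩
  refine le_trans ?_ (toReal_sum_ldpc_mul (P.t_le k)
    fun H G => LooksUnbiased (P.ζ k) H (f G)).le
  rw [hgame]
  refine ENNReal.toReal_mono ?_ hf
  refine ENNReal.sum_ne_top.mpr fun G _ => ENNReal.sum_ne_top.mpr fun H _ => ?_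
  refine ENNReal.mul_ne_top (PMF.apply_ne_top _ _) ?_
  split_ifs <;> simp

end LDPCParams

end Game

/-! ### Advantage for an arbitrary number of rows -/

section Reindex

variable {n t d : ℕ} {ι κ : Type*} [Fintype ι] [DecidableEq ι] [Fintype κ] [DecidableEq κ]

theorem sum_rowTuples_reindex (φ : ι ≃ κ) (ζ : ℝ)
    (f : Matrix (Fin n) (Fin d) (ZMod 2) → BitVec2 n) :
    ∑ H ∈ rowTuples ι n t, matProb (kerRows H) d (fun G => LooksUnbiased ζ H (f G)) =
      ∑ H ∈ rowTuples κ n t, matProb (kerRows H) d (fun G => LooksUnbiased ζ H (f G)) := by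
  refine Finset.sum_nbij' (fun H => H ∘ φ.symm) (fun H => H ∘ φ) ?_ ?_ ?_ ?_ ?_
  · intro H hH
    exact mem_rowTuples.mpr fun i => mem_rowTuples.mp hH _
  · intro H hH
    exact mem_rowTuples.mpr fun i => mem_rowTuples.mp hH _
  · intro H _
    ext i : 1
    simp
  · intro H _
    ext i : 1
    simp
  · intro H _
    have h1 : kerRows (H ∘ φ.symm) = kerRows H := by
      ext v
      rw [mem_kerRows, mem_kerRows]
      exact φ.symm.forall_congr_left.trans (by simp)
    have h2 : ∀ e, LooksUnbiased ζ (H ∘ φ.symm) e ↔ LooksUnbiased ζ H e := by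
      intro e
      unfold LooksUnbiased
      rw [Fintype.card_congr φ, ← Equiv.sum_comp φ.symm]
      rfl
    rw [h1]
    simp_rw [h2]

end Reindex

section Advantage

variable {n t d : ℕ} {σ α s₂ σ₁ x₀ ζ : ℝ}

/-- The advantage bound for any number of rows. -/
theorem CountingConditions.mul_sum_matProb_le
    (hc : CountingConditions n t d (2 * (σ * n)) σ α s₂ σ₁ x₀ ζ) (hw : WeightConditions n t σ)
    (r : ℕ) (f : Matrix (Fin n) (Fin d) (ZMod 2) → BitVec2 n)
    (hf : ∀ G, (hammingNorm (f G) : ℝ) ≤ α * n) :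
    ((n.choose t : ℝ) ^ r)⁻¹ *
      ∑ H ∈ rowTuples (Fin r) n t, matProb (kerRows H) d (fun G => LooksUnbiased ζ H (f G)) ≤
      2 ^ d * ((2 * n + 6) * Real.exp (-(σ ^ 2 * n / 4))) +
        2 * (2 ^ (d * d) * Real.exp (-(biasBound σ₁ t ^ 2 / 256 * r))) := by
  have hσ := hw.σ_pos
  have hσ' := hw.σ_le
  have hn : (0 : ℝ) < n := by exact_mod_cast hw.n_pos
  have hC : (0 : ℝ) < n.choose t := by exact_mod_cast Nat.choose_pos hc.t_le
  rw [inv_mul_le_iff₀ (pow_pos hC r)]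
  have hd : (1 : ℝ) ≤ 2 ^ d := one_le_pow₀ one_le_two
  set E := Real.exp (-(σ ^ 2 * n / 4)) with hE
  have hE0 : 0 < E := Real.exp_pos _
  have hσσ : σ ^ 2 * n ≤ 1 / 40 * n := by
    gcongr
    nlinarith
  have hσσ' : σ ^ 2 * n ≤ σ * n := by
    gcongr
    nlinarith
  have e1 : Real.exp (-(σ * n / 2)) ≤ E := by
    apply Real.exp_le_exp.mpr
    have := mul_pos hσ hn
    linarith
  have e2 : Real.exp (-((n : ℝ) / 10)) ≤ E := by
    apply Real.exp_le_exp.mpr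
    linarith
  have hexp : ∀ m : ℕ, (r : ℝ) ≤ 4 * m →
      2 ^ (d * d) * Real.exp (-(biasBound σ₁ t ^ 2 / 64 * m)) ≤
        2 ^ (d * d) * Real.exp (-(biasBound σ₁ t ^ 2 / 256 * r)) := by
    intro m hm
    have : (0 : ℝ) ≤ biasBound σ₁ t ^ 2 := sq_nonneg _
    gcongr ?_ * Real.exp (-?_)
    calc biasBound σ₁ t ^ 2 / 256 * r ≤ biasBound σ₁ t ^ 2 / 256 * (4 * m) := by gcongr
      _ = _ := by ring
  have hX0 : (0 : ℝ) < 2 ^ (d * d) * Real.exp (-(biasBound σ₁ t ^ 2 / 256 * r)) := by positivity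
  rcases le_or_gt (2 * r) n with hr | hr
  · refine (hc.sum_matProb_le_of_few_rows (by positivity) f hf).trans ?_
    rw [Fintype.card_fin]
    have h1 := hw.min_mul_sum_nonConstUnbalanced_le hr
    have h2 := hexp r (by
      have : (0 : ℝ) ≤ r := Nat.cast_nonneg _
      linarith)
    have h3 : (n + 1 : ℝ) * Real.exp (-((n : ℝ) / 10)) ≤ (n + 1) * E := by gcongr
    gcongr ?_ * ?_
    refine add_le_add (mul_le_mul_of_nonneg_left ?_ (by positivity)) (by linarith)
    calc _ ≤ _ := h1
      _ ≤ 2 * E + (n + 1) * E + (n + 1) * E := by gcongr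
      _ ≤ _ := by linarith
  -- Each block keeps at least r/4 rows, so n < 2r gives the condition n ≤ 8m of the mid-weight
  -- estimate for both.
  · obtain ⟨m₁, m₂, hm, hm₁, hm₂⟩ : ∃ m₁ m₂ : ℕ, m₁ + m₂ = r ∧ r ≤ 4 * m₁ ∧ r ≤ 4 * m₂ := by
      have := hw.n_ge
      have h16 := hw.t_ge'
      have h2 : (16 : ℝ) ≤ n := by linarith
      have h3 : 16 ≤ n := by exact_mod_cast h2
      exact ⟨r / 2, r - r / 2, by omega, by omega, by omega⟩
    have hm₁' : (r : ℝ) ≤ 4 * m₁ := by exact_mod_cast hm₁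
    have hm₂' : (r : ℝ) ≤ 4 * m₂ := by exact_mod_cast hm₂
    have hr' : (n : ℝ) ≤ 2 * r := by exact_mod_cast hr.le
    have hs := hc.sum_matProb_le_of_many_rows hσ.le (ι := Fin m₁) (κ := Fin m₂) f hf
    have hcard : Fintype.card (Fin m₁ ⊕ Fin m₂) = r := by simp [hm]
    rw [sum_rowTuples_reindex (finSumFinEquiv.trans (finCongr hm)), hcard, Fintype.card_fin,
      Fintype.card_fin] at hs
    refine hs.trans ?_
    have h1 := hw.min_mul_sum_unstructured_le r
    have h2 := hw.sum_midWeight_le (r := m₁) (by linarith)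
    have h3 := hw.sum_midWeight_le (r := m₂) (by linarith)
    have h4 := hexp m₁ hm₁'
    have h5 := hexp m₂ hm₂'
    have h6 : 2 ^ d * (min 1 (2 ^ r / 2 ^ n) * ∑ v ∈ unstructured n σ, annihProb t v ^ r) ≤
        2 ^ d * ((n + 3) * E) := by
      refine mul_le_mul_of_nonneg_left ?_ (by positivity)
      calc _ ≤ _ := h1
        _ ≤ 2 * E + (n + 1) * E := by gcongr
        _ = _ := by ring
    have h7 : 2 * E ≤ 2 ^ d * (2 * E) := le_mul_of_one_le_left (by positivity) hd
    have h8 : 0 ≤ (2 : ℝ) ^ d * ((n + 1) * E) := by positivity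
    gcongr ?_ * ?_
    calc _ ≤ 2 ^ d * ((n + 3) * E) + 2 ^ d * (2 * E) +
          2 * (2 ^ (d * d) * Real.exp (-(biasBound σ₁ t ^ 2 / 256 * r))) := by linarith
      _ ≤ _ := by linarith

end Advantage

/-! ### Asymptotic choice of the numerical parameters -/

section Asymptotic

/-- The requirements on the sparsity alone, for `s₀` the relative distance of the error rate from
one half. -/
structure LargeSparsity (s₀ x : ℝ) : Prop where
  ge : 16 ≤ x
  s_le : Real.exp (-(x / 128)) ≤ 1 / 40
  s_le_s₀ : 4 * Real.exp (-(x / 128)) ≤ s₀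
  xs_le : 2 * x * Real.exp (-(x / 128)) ≤ 1
  exp_le : 10 * (Real.exp (4 * (x * Real.exp (-(x / 128)))) - 1) ≤ 1 / 8
  le_exp : 32 * x ≤ (s₀ / 2) ^ 2 * Real.exp x
  pow_four_le : 256 * (x ^ 4 + x ^ 2 + 3) ≤ Real.exp x
  sq_ge : x + 2 * (x * Real.log (4 / s₀)) + 14 ≤ 3 * x ^ 2 / 1024

theorem eventually_largeSparsity {s₀ : ℝ} (hs : 0 < s₀) :
    ∀ᶠ x : ℝ in atTop, LargeSparsity s₀ x := by
  have h128 : Tendsto (fun x : ℝ => x / 128) atTop atTop :=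
    tendsto_id.atTop_div_const (by norm_num)
  have h1 : Tendsto (fun x : ℝ => Real.exp (-(x / 128))) atTop (𝓝 0) :=
    Real.tendsto_exp_neg_atTop_nhds_zero.comp h128
  have h2 : Tendsto (fun x : ℝ => x * Real.exp (-(x / 128))) atTop (𝓝 0) := by
    have := ((Real.tendsto_pow_mul_exp_neg_atTop_nhds_zero 1).comp h128).const_mul 128
    simp only [mul_zero] at this
    refine this.congr fun x => ?_
    simp only [Function.comp_apply, pow_one]
    ring
  have h3 : Tendsto (fun x : ℝ => Real.exp (4 * (x * Real.exp (-(x / 128))))) atTop (𝓝 1) := by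
    have := (Real.continuous_exp.tendsto _).comp (h2.const_mul 4)
    simpa [Function.comp_def] using this
  have h4 : ∀ m : ℕ, Tendsto (fun x : ℝ => x ^ m * Real.exp (-x)) atTop (𝓝 0) :=
    fun m => Real.tendsto_pow_mul_exp_neg_atTop_nhds_zero m
  have h5 : Tendsto (fun x : ℝ => 256 * (x ^ 4 * Real.exp (-x) + x ^ 2 * Real.exp (-x) +
      3 * (x ^ 0 * Real.exp (-x)))) atTop (𝓝 0) := by
    have := (((h4 4).add (h4 2)).add ((h4 0).const_mul 3)).const_mul 256
    simpa only [mul_zero, add_zero] using this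
  have h6 : Tendsto (fun x : ℝ => 32 * (x ^ 1 * Real.exp (-x))) atTop (𝓝 0) := by
    simpa only [mul_zero] using (h4 1).const_mul 32
  filter_upwards [eventually_ge_atTop 16, h1.eventually_le_const (u := 1 / 40) (by norm_num),
    h1.eventually_le_const (u := s₀ / 4) (by positivity),
    h2.eventually_le_const (u := 1 / 2) (by norm_num),
    h3.eventually_le_const (u := 81 / 80) (by norm_num),
    h6.eventually_le_const (u := (s₀ / 2) ^ 2) (by positivity),
    h5.eventually_le_const (u := 1) (by norm_num),
    eventually_ge_atTop (512 * (1 + 2 * Real.log (4 / s₀) + 14)),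
    eventually_ge_atTop (512 : ℝ)] with x a1 a2 a3 a4 a5 a6 a7 a8 a9
  have hx : Real.exp (-x) * Real.exp x = 1 := by rw [← Real.exp_add]; simp
  have hx0 := Real.exp_pos x
  refine ⟨a1, a2, by linarith, by linarith, by linarith, ?_, ?_, ?_⟩
  · calc 32 * x = 32 * (x ^ 1 * (Real.exp (-x) * Real.exp x)) := by rw [hx]; ring
      _ = 32 * (x ^ 1 * Real.exp (-x)) * Real.exp x := by ring
      _ ≤ _ := by gcongr
  · calc 256 * (x ^ 4 + x ^ 2 + 3) =
        256 * (x ^ 4 + x ^ 2 + 3) * (Real.exp (-x) * Real.exp x) := by rw [hx, mul_one]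
      _ = 256 * (x ^ 4 * Real.exp (-x) + x ^ 2 * Real.exp (-x) +
          3 * (x ^ 0 * Real.exp (-x))) * Real.exp x := by ring
      _ ≤ 1 * Real.exp x := by gcongr
      _ = _ := one_mul _
  · have b1 : 512 * (1 + 2 * Real.log (4 / s₀) + 14) * x ≤ x * x := by gcongr
    nlinarith

theorem biasBound_eq_exp {s₀ : ℝ} (hs : 0 < s₀) (t : ℕ) :
    biasBound (s₀ / 2) t = Real.exp (-(t * Real.log (4 / s₀))) / 2 := by
  rw [biasBound, ← mul_neg, Real.exp_nat_mul, ← Real.log_inv, Real.exp_log (by positivity)]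
  congr 2
  field_simp
  norm_num

variable {s₀ α ζ : ℝ} {n t d r : ℕ}

theorem two_pow_le_exp (m : ℕ) : (2 : ℝ) ^ m ≤ Real.exp m := by
  calc (2 : ℝ) ^ m ≤ Real.exp 1 ^ m := by
        gcongr
        have := Real.add_one_le_exp 1
        linarith
    _ = _ := by rw [← Real.exp_nat_mul, mul_one]

theorem LargeSparsity.weightConditions (h : LargeSparsity s₀ t) (hs₀ : s₀ ≤ 1) (hs : 0 < s₀)
    (ht : Even t) (hn : Real.exp (2 * t) ≤ n) :
    WeightConditions n t (Real.exp (-(t / 64))) := by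
  have hx := h.ge
  have h2 : Real.exp (2 * (t : ℝ)) = Real.exp t * Real.exp t := by rw [← Real.exp_add]; ring_nf
  have hE : 32 * (t : ℝ) ≤ Real.exp t := h.le_exp.trans <| by
    have : (s₀ / 2) ^ 2 ≤ 1 := by nlinarith
    exact mul_le_of_le_one_left (Real.exp_pos _).le this
  have hσ : Real.exp (-((t : ℝ) / 64)) = Real.exp (-(t / 128)) * Real.exp (-(t / 128)) := by
    rw [← Real.exp_add]
    ring_nf
  have hs0 := Real.exp_pos (-((t : ℝ) / 128))
  have hs1 := h.s_le
  refine ⟨ht, by exact_mod_cast hx, rfl, ?_, ?_, ?_, ?_⟩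
  · calc 16 * (t : ℝ) ≤ Real.exp t := by linarith
      _ ≤ Real.exp (-(t / 64)) ^ 2 * Real.exp (2 * t) := by
          rw [← Real.exp_nat_mul, ← Real.exp_add]
          apply Real.exp_le_exp.mpr
          push_cast
          linarith
      _ ≤ _ := by gcongr
  · rw [hσ, ← mul_assoc]
    have := h.xs_le
    nlinarith
  · rw [hσ]
    nlinarith
  · nlinarith

/-- The Krawtchouk decay is exp(-t²/256 + O(t)). The dimension costs at most exp(t²/1024), and the
surplus 3t²/1024 outweighs the squared bias exp(-O(t)), which is `sq_ge`. -/
theorem LargeSparsity.two_pow_mul_le (h : LargeSparsity s₀ t) (hs : 0 < s₀) (ht : Even t)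
    (hd : 1024 * d ≤ t ^ 2) :
    2 ^ d * (4 * Real.exp (-(t / 128))) ^ (t / 2) ≤ biasBound (s₀ / 2) t ^ 2 / 2048 := by
  obtain ⟨m, rfl⟩ := ht
  have hm : (m + m) / 2 = m := by omega
  have hd' : 1024 * (d : ℝ) ≤ ((m + m : ℕ) : ℝ) ^ 2 := by exact_mod_cast hd
  have h4 : (4 : ℝ) ≤ Real.exp 2 := by
    have := two_pow_le_exp 2
    norm_num at this
    exact this
  have hsq := h.sq_ge
  rw [hm, biasBound_eq_exp hs, div_pow, ← Real.exp_nat_mul, div_div]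
  calc (2 : ℝ) ^ d * (4 * Real.exp (-(((m + m : ℕ) : ℝ) / 128))) ^ m
      ≤ Real.exp d * (Real.exp 2 * Real.exp (-(((m + m : ℕ) : ℝ) / 128))) ^ m := by
        gcongr
        exact two_pow_le_exp d
    _ = Real.exp (d + m * (2 - ((m + m : ℕ) : ℝ) / 128)) := by
        rw [← Real.exp_add, ← Real.exp_nat_mul, ← Real.exp_add, sub_eq_add_neg]
    _ ≤ Real.exp ((2 : ℕ) * -(((m + m : ℕ) : ℝ) * Real.log (4 / s₀)) - 14) := by
        apply Real.exp_le_exp.mpr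
        push_cast at hsq hd' ⊢
        nlinarith
    _ = Real.exp ((2 : ℕ) * -(((m + m : ℕ) : ℝ) * Real.log (4 / s₀))) / Real.exp 14 := by
        rw [Real.exp_sub]
    _ ≤ _ := by
        gcongr
        have := two_pow_le_exp 14
        norm_num at this ⊢
        linarith

/-- Here s₂ is the square root of σ, and x₀ = 2tσ equals t j/n for j = 2σn. Then x₀/s₂ is of order t
s₂ and still tends to zero, so rows meeting J stay harmless. -/
theorem LargeSparsity.countingConditions (h : LargeSparsity s₀ t) (hs₀ : s₀ ≤ 1) (hs : 0 < s₀)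
    (hα : s₀ = 1 - 2 * α)
    (ht : Even t) (hn : Real.exp (2 * t) ≤ n) (hd : 1024 * d ≤ t ^ 2)
    (hζ : ζ ≤ Real.exp (-(t * Real.log (4 / s₀) + t))) :
    CountingConditions n t d (2 * (Real.exp (-(t / 64)) * n)) (Real.exp (-(t / 64))) α
      (Real.exp (-(t / 128))) (s₀ / 2) (2 * t * Real.exp (-(t / 64))) ζ := by
  have hw := h.weightConditions hs₀ hs ht hn
  have hx := h.ge
  have hn0 : (0 : ℝ) < n := by exact_mod_cast hw.n_pos
  have h2 : Real.exp (2 * (t : ℝ)) = Real.exp t * Real.exp t := by rw [← Real.exp_add]; ring_nf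
  have hσ : Real.exp (-((t : ℝ) / 64)) = Real.exp (-(t / 128)) * Real.exp (-(t / 128)) := by
    rw [← Real.exp_add]
    ring_nf
  have hs2 := Real.exp_pos (-((t : ℝ) / 128))
  have hs1 := h.s_le
  have hs3 := h.s_le_s₀
  have hxs := h.xs_le
  have hσ40 := hw.σ_le
  have hge := hw.n_ge
  have htl := hw.t_le
  have herr := h.two_pow_mul_le hs ht hd
  set s := Real.exp (-((t : ℝ) / 128))
  rw [hσ] at hw hσ40 htl ⊢
  have hss : s * s * n ≤ 1 / 40 * n := by gcongr
  have hxsn : 2 * t * (s * s) ≤ s := by nlinarith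
  have het : (t : ℝ) ≤ Real.exp t := by linarith [Real.add_one_le_exp (t : ℝ)]
  have hen : Real.exp t ≤ n := by
    refine le_trans ?_ hn
    apply Real.exp_le_exp.mpr
    linarith
  refine ⟨ht, ?_, hw.n_pos, hs2, by linarith, by positivity, by linarith, ?_, ?_, ?_, ?_, ?_, ?_,
    ?_, ?_, ?_, ?_, ?_, ?_⟩
  · have : (t : ℝ) ≤ n := by linarith
    exact_mod_cast this
  · have h5 : (s * s) ^ 2 * n ≤ s ^ 2 * n := by
      gcongr
      nlinarith
    have h6 : s ^ 2 * (1 / 2 * n) ≤ s ^ 2 * (n - 2 * (s * s * n)) := by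
      gcongr
      linarith
    linarith
  · have h5 : (s₀ / 2) ^ 2 * (1 / 2 * n) ≤ (s₀ / 2) ^ 2 * (n - 2 * (s * s * n)) := by
      gcongr
      linarith
    have h6 : (s₀ / 2) ^ 2 * Real.exp t ≤ (s₀ / 2) ^ 2 * n := by gcongr
    linarith [h.le_exp]
  · linarith
  · have h5 : s * (3 * s * n) ≤ s * (n - 2 * (s * s * n)) := by
      gcongr
      have : s * n ≤ 1 / 40 * n := by gcongr
      linarith
    linarith
  · have h5 : 4 * s * (s * n) ≤ s₀ * (1 * n) := by
      gcongr
      linarith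
    rw [← hα]
    linarith
  · refine herr.trans ?_
    have : 0 ≤ biasBound (s₀ / 2) t ^ 2 := sq_nonneg _
    linarith
  · positivity
  · linarith
  · exact le_of_eq (by ring)
  · have h5 : 2 / s * (2 * t * (s * s)) = 4 * (t * s) := by
      field_simp
      ring
    rw [h5]
    exact h.exp_le
  · have h5 : (2 * t * (s * s)) ^ (t / 2) ≤ (4 * s) ^ (t / 2) :=
      pow_le_pow_left₀ (by positivity) (by linarith) _
    have he := Real.exp_one_lt_d9
    calc 4 * 2 ^ d * (Real.exp 1 * (2 * t * (s * s)) ^ (t / 2))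
        ≤ 4 * 2 ^ d * (3 * (4 * s) ^ (t / 2)) := by
          gcongr
          linarith
      _ = 12 * (2 ^ d * (4 * s) ^ (t / 2)) := by ring
      _ ≤ 12 * (biasBound (s₀ / 2) t ^ 2 / 2048) := by gcongr
      _ ≤ _ := by
          have : 0 ≤ biasBound (s₀ / 2) t ^ 2 := sq_nonneg _
          linarith
  · rw [biasBound_eq_exp hs]
    have h5 : Real.exp (-(t * Real.log (4 / s₀) + t)) =
        Real.exp (-(t * Real.log (4 / s₀))) * Real.exp (-t) := by
      rw [← Real.exp_add]
      ring_nf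
    have h6 : Real.exp (-(t : ℝ)) ≤ 1 / 16 := by
      rw [Real.exp_neg, ← one_div]
      apply one_div_le_one_div_of_le (by norm_num)
      linarith [Real.add_one_le_exp (t : ℝ)]
    have h7 := Real.exp_pos (-(t * Real.log (4 / s₀)))
    rw [h5] at hζ
    nlinarith

/-- For large sparsity the advantage is at most `exp (-t ^ 2)`. -/
theorem LargeSparsity.advantage_le (h : LargeSparsity s₀ t) (hs₀ : s₀ ≤ 1) (hs : 0 < s₀)
    (hα : s₀ = 1 - 2 * α)
    (ht : Even t) (hn : Real.exp (2 * t) ≤ n) (hd : 1024 * d ≤ t ^ 2)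
    (hζ : ζ ≤ Real.exp (-(t * Real.log (4 / s₀) + t)))
    (hr : Real.exp (4 * (t * Real.log (4 / s₀) + t)) ≤ r)
    (f : Matrix (Fin n) (Fin d) (ZMod 2) → BitVec2 n)
    (hf : ∀ G, (hammingNorm (f G) : ℝ) ≤ α * n) :
    ((n.choose t : ℝ) ^ r)⁻¹ *
      ∑ H ∈ rowTuples (Fin r) n t, matProb (kerRows H) d (fun G => LooksUnbiased ζ H (f G)) ≤
      Real.exp (-(t : ℝ) ^ 2) := by
  refine ((h.countingConditions hs₀ hs hα ht hn hd hζ).mul_sum_matProb_le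
    (h.weightConditions hs₀ hs ht hn) r f hf).trans ?_
  have hx := h.ge
  have hp4 := h.pow_four_le
  have hlog : 0 ≤ Real.log (4 / s₀) := Real.log_nonneg (by rw [le_div_iff₀ hs]; linarith)
  have hd' : 1024 * (d : ℝ) ≤ (t : ℝ) ^ 2 := by exact_mod_cast hd
  have hd0 : (0 : ℝ) ≤ d := Nat.cast_nonneg _
  have hn0 : (0 : ℝ) < n := (Real.exp_pos _).trans_le hn
  have hhalf : ∀ y : ℝ, y ≤ -(t : ℝ) ^ 2 - 1 → Real.exp y ≤ Real.exp (-(t : ℝ) ^ 2) / 2 := by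
    intro y hy
    have h1 : Real.exp y ≤ Real.exp (-(t : ℝ) ^ 2 - 1) := Real.exp_le_exp.mpr hy
    rw [Real.exp_sub] at h1
    refine h1.trans ?_
    gcongr
    linarith [Real.add_one_le_exp 1]
  -- The quantity m = σ²n is at least exp t, so exp(-m/4) absorbs the factor n = exp(t/32) m and
  -- 2^d.
  have hfirst : 2 ^ d * ((2 * n + 6) * Real.exp (-(Real.exp (-((t : ℝ) / 64)) ^ 2 * n / 4))) ≤
      Real.exp (-(t : ℝ) ^ 2) / 2 := by
    set m := Real.exp (-((t : ℝ) / 64)) ^ 2 * n with hm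
    have hm0 : 0 < m := by positivity
    have hnm : (n : ℝ) = Real.exp (t / 32) * m := by
      rw [hm, ← Real.exp_nat_mul, ← mul_assoc, ← Real.exp_add]
      have : (t : ℝ) / 32 + (2 : ℕ) * -((t : ℝ) / 64) = 0 := by
        push_cast
        ring
      rw [this, Real.exp_zero, one_mul]
    have hmt : Real.exp t ≤ m := by
      rw [hm, ← Real.exp_nat_mul]
      calc Real.exp t ≤ Real.exp ((2 : ℕ) * -((t : ℝ) / 64)) * Real.exp (2 * t) := by
            rw [← Real.exp_add]
            apply Real.exp_le_exp.mpr
            push_cast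
            linarith
        _ ≤ _ := by gcongr
    have hmexp : m * Real.exp (-(m / 4)) ≤ 8 * Real.exp (-(m / 8)) := by
      have h1 : m / 8 ≤ Real.exp (m / 8) := by linarith [Real.add_one_le_exp (m / 8)]
      calc m * Real.exp (-(m / 4)) = 8 * (m / 8) * Real.exp (-(m / 4)) := by ring
        _ ≤ 8 * Real.exp (m / 8) * Real.exp (-(m / 4)) := by gcongr
        _ = _ := by
            rw [mul_assoc, ← Real.exp_add]
            ring_nf
    have hn1 : (1 : ℝ) ≤ n := (Real.one_le_exp (by positivity)).trans hn
    calc 2 ^ d * ((2 * n + 6) * Real.exp (-(m / 4)))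
        ≤ Real.exp d * ((8 * n) * Real.exp (-(m / 4))) := by
          gcongr
          · exact two_pow_le_exp d
          · linarith
      _ = Real.exp d * (8 * Real.exp (t / 32) * (m * Real.exp (-(m / 4)))) := by
          rw [hnm]
          ring
      _ ≤ Real.exp d * (8 * Real.exp (t / 32) * (8 * Real.exp (-(m / 8)))) := by gcongr
      _ = Real.exp d * Real.exp (t / 32) * Real.exp (-(m / 8)) * 64 := by ring
      _ ≤ Real.exp d * Real.exp (t / 32) * Real.exp (-(m / 8)) * Real.exp 6 := by
          gcongr
          have := two_pow_le_exp 6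
          norm_num at this
          exact this
      _ = Real.exp (d + t / 32 + -(m / 8) + 6) := by simp only [Real.exp_add]
      _ ≤ _ := by
          apply hhalf
          nlinarith [sq_nonneg ((t : ℝ) ^ 2)]
  have hsecond : 2 * (2 ^ (d * d) * Real.exp (-(biasBound (s₀ / 2) t ^ 2 / 256 * r))) ≤
      Real.exp (-(t : ℝ) ^ 2) / 2 := by
    -- Half of the exponent of r pays for the squared bias; the remainder exp t dominates d² ≤ t⁴.
    have hb : Real.exp t ≤ biasBound (s₀ / 2) t ^ 2 * r := by
      rw [biasBound_eq_exp hs, div_pow, ← Real.exp_nat_mul]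
      have h4 : (2 : ℝ) ^ 2 ≤ Real.exp 2 := by exact_mod_cast two_pow_le_exp 2
      calc Real.exp t ≤ Real.exp ((2 : ℕ) * -(t * Real.log (4 / s₀)) +
            4 * (t * Real.log (4 / s₀) + t) - 2) := by
            apply Real.exp_le_exp.mpr
            have : 0 ≤ (t : ℝ) * Real.log (4 / s₀) := by positivity
            push_cast
            linarith
        _ = Real.exp ((2 : ℕ) * -(t * Real.log (4 / s₀))) / Real.exp 2 *
            Real.exp (4 * (t * Real.log (4 / s₀) + t)) := by
            rw [Real.exp_sub, Real.exp_add]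
            ring
        _ ≤ _ := by gcongr
    have hdd : (d : ℝ) * d ≤ (t : ℝ) ^ 4 := by
      have : (d : ℝ) ≤ (t : ℝ) ^ 2 := by linarith
      calc (d : ℝ) * d ≤ (t : ℝ) ^ 2 * (t : ℝ) ^ 2 := by gcongr
        _ = _ := by ring
    calc 2 * (2 ^ (d * d) * Real.exp (-(biasBound (s₀ / 2) t ^ 2 / 256 * r)))
        ≤ Real.exp 1 * (Real.exp (d * d) * Real.exp (-(biasBound (s₀ / 2) t ^ 2 / 256 * r))) := by
          gcongr
          · linarith [Real.add_one_le_exp 1]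
          · exact_mod_cast two_pow_le_exp (d * d)
      _ = Real.exp (1 + (d * d + -(biasBound (s₀ / 2) t ^ 2 / 256 * r))) := by
          simp only [Real.exp_add]
      _ ≤ _ := by
          apply hhalf
          linarith
  linarith

end Asymptotic

/-! ### Closed-form parameters and the conclusion -/

section Parameters

theorem log_le_of_log_two {n : ℕ} (hn : 1 ≤ Nat.log 2 n) :
    Real.log n ≤ 2 * Nat.log 2 n := by
  have h0 : n ≠ 0 := by
    rintro rfl
    simp at hn
  have h1 : (n : ℝ) < 2 ^ (Nat.log 2 n + 1) := by
    exact_mod_cast Nat.lt_pow_succ_log_self one_lt_two n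
  have h2 : Real.log n ≤ Real.log (2 ^ (Nat.log 2 n + 1)) :=
    Real.log_le_log (by positivity) h1.le
  rw [Real.log_pow] at h2
  have h3 := Real.log_two_lt_d9
  have h4 : (1 : ℝ) ≤ Nat.log 2 n := by exact_mod_cast hn
  push_cast at h2
  nlinarith

theorem nat_log_mul_log_two_le {n : ℕ} (hn : n ≠ 0) :
    Nat.log 2 n * Real.log 2 ≤ Real.log n := by
  have h1 : (2 : ℝ) ^ Nat.log 2 n ≤ n := by exact_mod_cast Nat.pow_log_le_self 2 hn
  have h2 := Real.log_le_log (by positivity) h1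
  rwa [Real.log_pow] at h2

theorem log_two_le_mul_sparsity {p l : ℕ} (h : 1 ≤ l / p) : l ≤ p * (2 * (l / p)) := by
  have hp : 0 < p := Nat.pos_of_ne_zero fun h0 => by simp [h0] at h
  have h1 := Nat.lt_mul_div_succ l hp
  nlinarith

theorem dimension_le_sq_sparsity {p l : ℕ} (h : 1 ≤ l / p) :
    1024 * (l ^ 2 / (1024 * p ^ 2)) ≤ (2 * (l / p)) ^ 2 := by
  have hp : 0 < p := Nat.pos_of_ne_zero fun h0 => by simp [h0] at h
  have h1 := Nat.pow_le_pow_left (log_two_le_mul_sparsity h) 2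
  have h2 := Nat.mul_div_le (l ^ 2) (1024 * p ^ 2)
  have h3 : p ^ 2 * (1024 * (l ^ 2 / (1024 * p ^ 2))) ≤ p ^ 2 * (2 * (l / p)) ^ 2 := by
    calc _ = 1024 * p ^ 2 * (l ^ 2 / (1024 * p ^ 2)) := by ring
      _ ≤ l ^ 2 := h2
      _ ≤ _ := by rw [← mul_pow]; exact h1
  exact Nat.le_of_mul_le_mul_left h3 (by positivity)

variable {n : ℕ → ℕ}

theorem tendsto_nat_log_atTop (hn : Tendsto n atTop atTop) :
    Tendsto (fun k => Nat.log 2 (n k)) atTop atTop :=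
  tendsto_atTop.mpr fun b => by
    filter_upwards [hn.eventually_ge_atTop (2 ^ b)] with k hk
    exact Nat.le_log_of_pow_le one_lt_two hk

theorem tendsto_sparsity_atTop (hn : Tendsto n atTop atTop) {p : ℕ} (hp : 0 < p) :
    Tendsto (fun k => 2 * (Nat.log 2 (n k) / p)) atTop atTop :=
  tendsto_atTop.mpr fun b => by
    filter_upwards [(tendsto_nat_log_atTop hn).eventually_ge_atTop (p * b)] with k hk
    have : b ≤ Nat.log 2 (n k) / p := (Nat.le_div_iff_mul_le hp).mpr (by rwa [mul_comm])
    omega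

theorem sparsity_isTheta_log (hn : Tendsto n atTop atTop) {p : ℕ} (hp : 0 < p) :
    (fun k => ((2 * (Nat.log 2 (n k) / p) : ℕ) : ℝ)) =Θ[atTop] (fun k => Real.log (n k)) := by
  constructor
  · refine IsBigO.of_bound 4 ?_
    filter_upwards [hn.eventually_ge_atTop 1] with k hk
    have h1 := nat_log_mul_log_two_le (n := n k) (by omega)
    have h2 := Real.log_two_gt_d9
    have h3 : ((2 * (Nat.log 2 (n k) / p) : ℕ) : ℝ) ≤ 2 * Nat.log 2 (n k) := by
      have := Nat.div_le_self (Nat.log 2 (n k)) p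
      exact_mod_cast Nat.mul_le_mul_left 2 this
    have h4 : (0 : ℝ) ≤ Nat.log 2 (n k) := Nat.cast_nonneg _
    rw [Real.norm_of_nonneg (Nat.cast_nonneg _)]
    refine le_trans ?_ (mul_le_mul_of_nonneg_left (Real.le_norm_self _) (by norm_num))
    nlinarith
  · refine IsBigO.of_bound (2 * p) ?_
    filter_upwards [(tendsto_nat_log_atTop hn).eventually_ge_atTop p] with k hk
    have h1 := log_le_of_log_two (n := n k) (by omega)
    have h2 := log_two_le_mul_sparsity (p := p) ((Nat.one_le_div_iff hp).mpr hk)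
    have h3 : (Nat.log 2 (n k) : ℝ) ≤ p * ((2 * (Nat.log 2 (n k) / p) : ℕ) : ℝ) := by
      exact_mod_cast h2
    rw [Real.norm_of_nonneg (Nat.cast_nonneg _), Real.norm_of_nonneg (Real.log_natCast_nonneg _)]
    linarith

theorem log_sq_isBigO_dimension (hn : Tendsto n atTop atTop) {q : ℕ} (hq : 0 < q) :
    (fun k => Real.log (n k) ^ 2) =O[atTop] (fun k => ((Nat.log 2 (n k) ^ 2 / q : ℕ) : ℝ)) := by
  refine IsBigO.of_bound (8 * q) ?_
  filter_upwards [(tendsto_nat_log_atTop hn).eventually_ge_atTop q] with k hk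
  have h1 := log_le_of_log_two (n := n k) (by omega)
  have h0 := Real.log_natCast_nonneg (n k)
  have h2 : Nat.log 2 (n k) ^ 2 ≤ 2 * (q * (Nat.log 2 (n k) ^ 2 / q)) := by
    have h3 := Nat.lt_mul_div_succ (Nat.log 2 (n k) ^ 2) hq
    have h4 : 1 ≤ Nat.log 2 (n k) ^ 2 / q := (Nat.one_le_div_iff hq).mpr (by nlinarith)
    nlinarith
  have h3 : (Nat.log 2 (n k) : ℝ) ^ 2 ≤ 2 * (q * ((Nat.log 2 (n k) ^ 2 / q : ℕ) : ℝ)) := by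
    exact_mod_cast h2
  rw [Real.norm_of_nonneg (sq_nonneg _), Real.norm_of_nonneg (Nat.cast_nonneg _)]
  nlinarith

theorem exp_mul_sparsity_le {p n : ℕ} (hn : n ≠ 0) :
    Real.exp (p * Real.log 2 / 2 * ((2 * (Nat.log 2 n / p) : ℕ) : ℝ)) ≤ n := by
  have h1 := nat_log_mul_log_two_le hn
  have h2 : ((p * (Nat.log 2 n / p) : ℕ) : ℝ) ≤ Nat.log 2 n := by
    exact_mod_cast Nat.mul_div_le _ _
  have h3 : (0 : ℝ) < n := by positivity
  have h4 := Real.log_pos one_lt_two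
  rw [← Real.le_log_iff_exp_le h3]
  push_cast at h2 ⊢
  nlinarith

theorem tendsto_atTop_of_rpow_le {a : ℝ} (ha : 0 < a)
    (h : ∀ᶠ k : ℕ in atTop, (k : ℝ) ^ a ≤ (n k : ℝ)) : Tendsto n atTop atTop :=
  tendsto_natCast_atTop_iff.mp <| tendsto_atTop_mono' _ h <|
    (tendsto_rpow_atTop ha).comp tendsto_natCast_atTop_atTop

/-- Since k^m ≤ exp(m c g), one factor of g in g² outgrows the constant m c. -/
theorem superpolynomialDecay_of_le_exp_neg_sq {f g : ℕ → ℝ} {c : ℝ} (hg : Tendsto g atTop atTop)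
    (hc : ∀ᶠ k : ℕ in atTop, Real.log k ≤ c * g k) (hf : ∀ k, 0 ≤ f k)
    (hfg : ∀ᶠ k in atTop, f k ≤ Real.exp (-(g k) ^ 2)) :
    SuperpolynomialDecay atTop (fun k : ℕ => (k : ℝ)) f := by
  intro m
  have h1 : Tendsto (fun k => Real.exp (-g k)) atTop (𝓝 0) :=
    Real.tendsto_exp_neg_atTop_nhds_zero.comp hg
  refine squeeze_zero' (Eventually.of_forall fun k => mul_nonneg (by positivity) (hf k)) ?_ h1
  filter_upwards [hc, hfg, eventually_ge_atTop 1, hg.eventually_ge_atTop (m * c + 1),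
    hg.eventually_ge_atTop 0] with k h2 h3 h4 h5 h6
  have hk : (0 : ℝ) < k := by exact_mod_cast h4
  calc (k : ℝ) ^ m * f k ≤ Real.exp (m * (c * g k)) * Real.exp (-(g k) ^ 2) := by
        gcongr
        · exact hf k
        rw [← Real.exp_log hk, ← Real.exp_nat_mul]
        gcongr
    _ = Real.exp (m * (c * g k) + -(g k) ^ 2) := by rw [Real.exp_add]
    _ ≤ _ := by
        apply Real.exp_le_exp.mpr
        nlinarith

end Parameters

/-- Let `δ < 1/2`, let the codeword length `n` be at least polynomial in the security parameter `k`,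
and let `r = n ^ Ω(1)`. Then there are `η = Ω(1)`, `t = Θ(log n)` and `d = Ω(log² n)` for which the
zero-bit public-key LDPC code with slack `r ^ (-1/4)` is adaptively `δ`-robust. The parameters are
efficiently computable from `n`: `η` is a rational constant, and `t`, `d` have closed forms. -/
theorem theorem1 (δ : ℝ) (hδ : δ < 1 / 2) (n r : ℕ → ℕ)
    (hn : ∃ a : ℝ, 0 < a ∧ ∀ᶠ k : ℕ in atTop, (k : ℝ) ^ a ≤ (n k : ℝ))
    (hr : ∃ γ : ℝ, 0 < γ ∧ ∀ᶠ k : ℕ in atTop, (n k : ℝ) ^ γ ≤ (r k : ℝ)) :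
    ∃ P : LDPCParams,
      P.n = n ∧ P.r = r ∧ (∀ k, P.ζ k = (r k : ℝ) ^ (-(1 / 4) : ℝ)) ∧
      (∃ η₀ : ℚ, 0 < η₀ ∧ ∀ k, P.η k = (η₀ : ℝ)) ∧
      (fun k => (P.t k : ℝ)) =Θ[atTop] (fun k => Real.log (n k)) ∧
      (fun k => Real.log (n k) ^ 2) =O[atTop] (fun k => (P.d k : ℝ)) ∧
      (∃ p q : ℕ, 0 < p ∧ 0 < q ∧
        ∀ k, P.t k = 2 * (Nat.log 2 (n k) / p) ∧ P.d k = Nat.log 2 (n k) ^ 2 / q) ∧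
      P.zeroBitCode.AdaptivelyRobust δ := by
  obtain ⟨a, ha, hna⟩ := hn
  obtain ⟨γ, hγ, hrγ⟩ := hr
  have hnt := tendsto_atTop_of_rpow_le ha hna
  -- A noise rate below the gap keeps α < 1/2. The maximum with 0 covers negative δ, and also forces
  -- η₀ < 1/2.
  obtain ⟨η₀, hη0, hη1⟩ := exists_rat_btwn (show (0 : ℝ) < 1 / 2 - max δ 0 by
    rw [sub_pos, max_lt_iff]
    exact ⟨hδ, by norm_num⟩)
  have hδ0 := le_max_right δ 0
  have hδ1 := le_max_left δ 0
  set α : ℝ := max δ 0 + η₀ with hα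
  have hα0 : 0 < α := by linarith
  set s₀ : ℝ := 1 - 2 * α with hs₀
  have hs : 0 < s₀ := by linarith
  have hs1 : s₀ ≤ 1 := by linarith
  set M : ℝ := 4 * (Real.log (4 / s₀) + 1) with hM
  have hl2 := Real.log_two_gt_d9
  -- The bound 6 gives n ≥ exp(2t), as 3 log 2 > 2. The other bound turns r ≥ n^γ into r ≥ exp(M t).
  obtain ⟨p, hp⟩ := exists_nat_ge (max 6 (2 * M / (γ * Real.log 2)))
  obtain ⟨hp6, hpM⟩ := max_le_iff.mp hp
  have hp6' : 6 ≤ p := by exact_mod_cast hp6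
  have hp0 : 0 < p := by omega
  have hpM' : M ≤ γ * (p * Real.log 2 / 2) := by
    rw [div_le_iff₀ (by positivity)] at hpM
    linarith
  have hη0' : 0 < η₀ := by exact_mod_cast hη0
  let P : LDPCParams :=
    { n := n
      d := fun k => Nat.log 2 (n k) ^ 2 / (1024 * p ^ 2)
      t := fun k => 2 * (Nat.log 2 (n k) / p)
      r := r
      η := fun _ => η₀
      ζ := fun k => (r k : ℝ) ^ (-(1 / 4) : ℝ)
      t_le := fun k => by
        have h1 : Nat.log 2 (n k) / p ≤ Nat.log 2 (n k) / 2 :=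
          Nat.div_le_div_left (by omega) (by norm_num)
        have h2 := Nat.log_le_self 2 (n k)
        omega
      η_mem := fun _ => ⟨hη0.le, by linarith⟩ }
  have htt := tendsto_sparsity_atTop hnt hp0
  have htt' : Tendsto (fun k => ((2 * (Nat.log 2 (n k) / p) : ℕ) : ℝ)) atTop atTop :=
    tendsto_natCast_atTop_atTop.comp htt
  refine ⟨P, rfl, rfl, fun _ => rfl, ⟨η₀, hη0', fun _ => rfl⟩, sparsity_isTheta_log hnt hp0,
    log_sq_isBigO_dimension hnt (by positivity), ⟨p, 1024 * p ^ 2, hp0, by positivity,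
      fun k => ⟨rfl, rfl⟩⟩, fun A => ?_⟩
  refine superpolynomialDecay_of_le_exp_neg_sq (c := 2 * p / a) htt' ?_
    (fun k => ENNReal.toReal_nonneg) ?_
  · filter_upwards [hna, eventually_ge_atTop 1,
      (tendsto_nat_log_atTop hnt).eventually_ge_atTop p] with k h1 h2 h3
    have hk : (0 : ℝ) < k := by exact_mod_cast h2
    have h4 := Real.log_le_log (by positivity) h1
    rw [Real.log_rpow hk] at h4
    have h5 := log_le_of_log_two (n := n k) (by omega)
    have h6 : (Nat.log 2 (n k) : ℝ) ≤ p * ((2 * (Nat.log 2 (n k) / p) : ℕ) : ℝ) := by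
      exact_mod_cast log_two_le_mul_sparsity ((Nat.one_le_div_iff hp0).mpr h3)
    rw [div_mul_eq_mul_div, le_div_iff₀ ha]
    linarith
  · filter_upwards [hrγ, htt'.eventually (eventually_largeSparsity hs),
      hnt.eventually_ge_atTop 1] with k h1 h2 h3
    obtain ⟨f, hf, hle⟩ := P.robustGame_le (δ := δ) (k := k) hα0.le
      (by change δ + η₀ ≤ α; linarith) A
    refine hle.trans ?_
    have hnE := exp_mul_sparsity_le (p := p) (n := n k) (by omega)
    have hx := h2.ge
    have hrE : Real.exp (4 * (((2 * (Nat.log 2 (n k) / p) : ℕ) : ℝ) * Real.log (4 / s₀) +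
        ((2 * (Nat.log 2 (n k) / p) : ℕ) : ℝ))) ≤ r k := by
      refine le_trans ?_ ((Real.rpow_le_rpow (Real.exp_pos _).le hnE hγ.le).trans h1)
      rw [← Real.exp_mul]
      apply Real.exp_le_exp.mpr
      calc _ = M * ((2 * (Nat.log 2 (n k) / p) : ℕ) : ℝ) := by rw [hM]; ring
        _ ≤ γ * (p * Real.log 2 / 2) * ((2 * (Nat.log 2 (n k) / p) : ℕ) : ℝ) := by gcongr
        _ = _ := by ring
    refine h2.advantage_le hs1 hs hs₀ (even_two_mul _) ?_ ?_ ?_ hrE f hf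
    · refine le_trans (Real.exp_le_exp.mpr ?_) hnE
      gcongr
      nlinarith
    · refine dimension_le_sq_sparsity (Nat.pos_of_ne_zero fun h0 => ?_)
      rw [h0] at hx
      norm_num at hx
    -- The factor 4 in M matches the exponent -1/4 of the slack.
    · refine (Real.rpow_le_rpow_of_nonpos (Real.exp_pos _) hrE (by norm_num)).trans ?_
      rw [← Real.exp_mul]
      apply Real.exp_le_exp.mpr
      linarith
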